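/- A quantum set $\mathcal X$ is given by a family $\mathrm{At}(\mathcal X)$ of nonzero finite-dimensional complex Hilbert spaces, its atoms; $\mathcal X^*$ has the dual spaces as atoms, and $\ell^\infty(\mathcal X)$ is the $\ell^\infty$-direct sum of the algebras $L(X)$, $X\in\mathrm{At}(\mathcal X)$. A binary relation $F$ from $\mathcal X$ to $\mathcal Y$ is a choice of subspaces $F(X,Y)\le L(X,Y)$ for all atoms $X$, $Y$. Binary relations are ordered by inclusion, with composition $(G\circ F)(X,Z)=\sum_Y G(Y,Z)\cdot F(X,Y)$, adjoint $F^\dagger(Y,X)=\{f^\dagger : f\in F(X,Y)\}$, and identity $I_{\mathcal X}$ with $I_{\mathcal X}(X,X)=\mathbb C 1_X$ and $0$ elsewhere. The conjugate $F_*$ from $\mathcal X^*$ to $\mathcal Y^*$ is $F_*(X^*,Y^*)=\{(f^\dagger)^* : f\in F(X,Y)\}$, where $(f^\dagger)^*$ is the transpose of $f^\dagger$. $F$ is a function if $F^\dagger\circ F\ge I_{\mathcal X}$ and $F\circ F^\dagger\le I_{\mathcal Y}$; a function $F$ is injective if $F^\dagger\circ F=I_{\mathcal X}$ and surjective if $F\circ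 F^\dagger=I_{\mathcal Y}$. A relation of arity $(\mathcal X_1,\dots,\mathcal X_n)$ is a choice of a subspace of the functionals on $X_1\otimes\dots\otimes X_n$ for all atoms $X_i$ of $\mathcal X_i$; $\top$ denotes the largest relation of a given arity, and relations are multiplied by $(R\times S)(X\otimes X')=R(X)\otimes S(X')$. A formula with distinct free variables among $x_1\in\mathcal X_1,\dots,x_n\in\mathcal X_n$ is interpreted as a relation $[\![\,\cdot\,]\!]$ of arity $(\mathcal X_1,\dots,\mathcal X_n)$: an atomic formula $R(x_{i_1},\dots,x_{i_m})$ with distinct variables as the product of $R$ with $\top$ on the other variables, the factors permuted accordingly; $\neg$ and $\wedge$ as atomwise orthocomplement and intersection; and $[\![(\forall x_1\in\mathcal X_1)\,\phi]\!]$ as the largest $R$ with $\top_{\mathcal X_1}\times R\le[\![\phi]\!]$. Moreover, $\phi\vee\psi$ is $\neg(\neg\phi\wedge\neg\psi)$, $\phi\to\psi$ is $\neg\phi\vee(\phi\wedge\psi)$, and $\exists$ is $\neg\forall\neg$. The equality relation $E_{\mathcal X}$ of arity $(\mathcal X,\mathcal X^*)$ is spanned on $X\otimes X^*$ by the evaluation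 functional and is $0$ on $X_1\otimes X_2^*$ for $X_1\ne X_2$. The diagonal quantifier $(\forall(x=x_*)\in\mathcal X\times\mathcal X^*)\,\phi$ is $(\forall x_*\in\mathcal X^*)(\forall x\in\mathcal X)(E_{\mathcal X}(x,x_*)\to\phi)$, and $(\exists(x=x_*)\in\mathcal X\times\mathcal X^*)\,\phi$ is $\neg(\forall(x=x_*)\in\mathcal X\times\mathcal X^*)\,\neg\phi$. A sentence is true if its interpretation is $\top$. For a binary relation $F$ from $\mathcal X$ to $\mathcal Y$, let $\breve F$ be the relation of arity $(\mathcal X,\mathcal Y^*)$ that consists of the functionals $x\otimes\eta\mapsto\eta(fx)$, $f\in F(X,Y)$, and let $\breve F_*$ be its conjugate, the relation of arity $(\mathcal X^*,\mathcal Y)$ that consists of the functionals $\xi\otimes y\mapsto\xi(f^\dagger y)$, $f\in F(X,Y)$. Let $(F_*)\breve{\ }$ be the relation of arity $(\mathcal X^*,\mathcal Y^{**})$ obtained in the same way as $\breve F$ from $F_*$. The formulas $E_{\mathcal Y}(F(x),F_*(x_*))$ and $E_{\mathcal Y}(F(x),y_*)$ abbreviate $$(\exists(y_2=y_{2*})\in\mathcal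 Y^*\times\mathcal Y^{**})\,(\exists(y_1=y_{1*})\in\mathcal Y\times\mathcal Y^*)\,\bigl(E_{\mathcal Y}(y_1,y_2)\wedge\breve F(x,y_{1*})\wedge\theta\bigr),$$ where $\theta$ is $(F_*)\breve{\ }(x_*,y_{2*})$ and $E_{\mathcal Y^*}(y_*,y_{2*})$, respectively. **Proposition.** Let $\mathcal X$ and $\mathcal Y$ be quantum sets, and consider for binary relations $F$ from $\mathcal X$ to $\mathcal Y$ the sentences 1. $(\forall x\in\mathcal X)(\exists y_*\in\mathcal Y^*)\,\breve F(x,y_*)$; 2. $(\forall(x=x_*)\in\mathcal X\times\mathcal X^*)(\forall(y_1=y_{1*})\in\mathcal Y\times\mathcal Y^*)(\forall(y_2=y_{2*})\in\mathcal Y\times\mathcal Y^*)\,\bigl((\breve F(x,y_{1*})\wedge\breve F_*(x_*,y_2))\to E_{\mathcal Y}(y_1,y_{2*})\bigr)$; 3. $(\forall x\in\mathcal X)(\forall x_*\in\mathcal X^*)\,\bigl(E_{\mathcal Y}(F(x),F_*(x_*))\to E_{\mathcal X}(x,x_*)\bigr)$; 4. $(\forall y_*\in\mathcal Y^*)(\exists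 x\in\mathcal X)\,E_{\mathcal Y}(F(x),y_*)$. Then there is a one-to-one correspondence between the binary relations $F$ from $\mathcal X$ to $\mathcal Y$ for which (1) and (2) are true and the unital normal $*$-homomorphisms $\phi:\ell^\infty(\mathcal Y)\to\ell^\infty(\mathcal X)$. It is given by $\phi=F^\star$, that is, $F$ corresponds to $\phi$ if and only if $b(Y)\cdot f=f\cdot\phi(b)(X)$ for all atoms $X$, $Y$, all $f\in F(X,Y)$ and all $b\in\ell^\infty(\mathcal Y)$. The relations $F$ for which (1) and (2) are true are exactly the functions from $\mathcal X$ to $\mathcal Y$. The correspondence restricts to a one-to-one correspondence between the relations $F$ for which (1), (2) and (3) are true, which are exactly the injective functions, and the surjective $\phi$; and to a one-to-one correspondence between the relations $F$ for which (1), (2) and (4) are true, which are exactly the surjective functions, and the injective $\phi$. -/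

import Mathlib

open scoped ENNReal

universe u v

noncomputable section

/-- The Hilbert space structure on the dual of a Hilbert space: its norm is the operator norm, and
`⟪⟨u|, ⟨v|⟫ = ⟪v, u⟫` for the functionals `⟨u| = ⟪u, ·⟫` and `⟨v| = ⟪v, ·⟫`. -/
abbrev dualInnerProductSpace (E : Type*) [NormedAddCommGroup E] [InnerProductSpace ℂ E]
    [CompleteSpace E] : InnerProductSpace ℂ (StrongDual ℂ E) where
  inner f g := inner ℂ ((InnerProductSpace.toDual ℂ E).symm g)
    ((InnerProductSpace.toDual ℂ E).symm f)
  norm_sq_eq_re_inner f := by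
    rw [inner_self_eq_norm_sq, LinearIsometryEquiv.norm_map]
  conj_inner_symm f g := by
    rw [inner_conj_symm]
  add_left f g h := by
    rw [map_add, inner_add_right]
  smul_left f g r := by
    rw [LinearIsometryEquiv.map_smulₛₗ, inner_smul_right]

set_option linter.checkUnivs false in
/-- A quantum set: a family of nonzero finite-dimensional complex Hilbert spaces, its atoms.
Atoms with different indices count as different atoms. -/
structure QSet : Type (max (u + 1) (v + 1)) where
  /-- the index set of the atoms -/
  At : Type u
  /-- the atom with a given index -/
  space : At → Type v
  [normedAddCommGroup : ∀ a, NormedAddCommGroup (space a)]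
  [innerProductSpace : ∀ a, InnerProductSpace ℂ (space a)]
  [finiteDimensional : ∀ a, FiniteDimensional ℂ (space a)]
  [nontrivial : ∀ a, Nontrivial (space a)]

namespace QSet

attribute [instance] normedAddCommGroup innerProductSpace finiteDimensional nontrivial

instance completeSpace (X : QSet.{u, v}) (a : X.At) : CompleteSpace (X.space a) :=
  FiniteDimensional.complete ℂ _

/-- The dual `X*` of a quantum set: its atoms are the duals of the atoms of `X`. -/
abbrev dual (X : QSet.{u, v}) : QSet.{u, v} where
  At := X.At
  space a := StrongDual ℂ (X.space a)
  innerProductSpace a := dualInnerProductSpace (X.space a)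
  finiteDimensional a := inferInstanceAs (FiniteDimensional ℂ (X.space a →L[ℂ] ℂ))
  nontrivial a := (InnerProductSpace.toDual ℂ (X.space a)).toEquiv.symm.nontrivial

/-- The von Neumann algebra `ℓ^∞(X)`: the bounded families of operators `b a ∈ L(X_a)`, with the
supremum norm and the pointwise operations (`star` is the Hermitian adjoint in each component). -/
abbrev Linfty (X : QSet.{u, v}) := lp (fun a : X.At => X.space a →L[ℂ] X.space a) ∞

/-- The operator order on `ℓ^∞(X)`: `b ≤ c` iff every component of `c - b` is positive. -/
def LoewnerLE {X : QSet.{u, v}} (b c : X.Linfty) : Prop :=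
  ∀ a, (c a - b a).IsPositive

/-- `s` is the least upper bound of `S` in the operator order. -/
def IsSup {X : QSet.{u, v}} (S : Set X.Linfty) (s : X.Linfty) : Prop :=
  (∀ b ∈ S, LoewnerLE b s) ∧ ∀ c, (∀ b ∈ S, LoewnerLE b c) → LoewnerLE s c

/-- A unital `*`-homomorphism is normal if it preserves the suprema of bounded upward directed
families of self-adjoint elements. -/
def IsNormal {X Y : QSet.{u, v}} (φ : Y.Linfty →⋆ₐ[ℂ] X.Linfty) : Prop :=
  ∀ (S : Set Y.Linfty) (s : Y.Linfty), S.Nonempty → DirectedOn LoewnerLE S →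
    (∀ b ∈ S, IsSelfAdjoint b) → IsSup S s → IsSup (φ '' S) (φ s)

/-! ### Binary relations -/

/-- A binary relation from `X` to `Y`: a choice of subspaces `F(X_a, Y_b) ≤ L(X_a, Y_b)`. -/
abbrev BinRel (X Y : QSet.{u, v}) :=
  ∀ (a : X.At) (b : Y.At), Submodule ℂ (X.space a →L[ℂ] Y.space b)

namespace BinRel

variable {X Y Z : QSet.{u, v}}

/-- The identity binary relation: `ℂ·1` on the diagonal, and `0` off the diagonal. -/
def id (X : QSet.{u, v}) : BinRel X X := fun a b =>
  Submodule.span ℂ {f | ∃ h : a = b, ∀ x, f x = h ▸ x}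

/-- The composition `G ∘ F`, with components `∑_b G(Y_b, Z_c) · F(X_a, Y_b)`. -/
def comp (G : BinRel Y Z) (F : BinRel X Y) : BinRel X Z := fun a c =>
  Submodule.span ℂ {h | ∃ b, ∃ g ∈ G b c, ∃ f ∈ F a b, h = g ∘L f}

/-- The adjoint `F†`, with components `{f† | f ∈ F(X_a, Y_b)}`. -/
def dagger (F : BinRel X Y) : BinRel Y X := fun b a =>
  Submodule.span ℂ {g | ∃ f ∈ F a b, g = ContinuousLinearMap.adjoint f}

/-- The conjugate `F_*`, from `X*` to `Y*`, with components `{f_* | f ∈ F(X_a, Y_b)}`, where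
`f_* : X_a* → Y_b*` is the transpose of `f†`. -/
def conjugate (F : BinRel X Y) : BinRel X.dual Y.dual := fun a b =>
  Submodule.span ℂ {g | ∃ f ∈ F a b,
    ∀ ξ : StrongDual ℂ (X.space a), g ξ = ξ ∘L ContinuousLinearMap.adjoint f}

/-- `F` is a function from `X` to `Y`: `F† ∘ F ≥ I_X` and `F ∘ F† ≤ I_Y`. -/
def IsFunction (F : BinRel X Y) : Prop :=
  id X ≤ comp (dagger F) F ∧ comp F (dagger F) ≤ id Y

/-- `F` is an injective function: a function with `F† ∘ F = I_X`. -/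
def IsInjectiveFunction (F : BinRel X Y) : Prop :=
  F.IsFunction ∧ comp (dagger F) F = id X

/-- `F` is a surjective function: a function with `F ∘ F† = I_Y`. -/
def IsSurjectiveFunction (F : BinRel X Y) : Prop :=
  F.IsFunction ∧ comp F (dagger F) = id Y

/-- `φ = F^⋆`: for all atoms `X_a`, `Y_b`, all `f ∈ F(X_a, Y_b)` and all `c ∈ ℓ^∞(Y)`, one has
`c(Y_b) · f = f · φ(c)(X_a)`. -/
def IsStar (F : BinRel X Y) (φ : Y.Linfty →⋆ₐ[ℂ] X.Linfty) : Prop :=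
  ∀ (a : X.At) (b : Y.At), ∀ f ∈ F a b, ∀ c : Y.Linfty, c b ∘L f = f ∘L φ c a

end BinRel

/-! ### Relations of finite arity -/

/-- A relation of arity `(X_0, …, X_{n-1})`: for each choice of atoms, a subspace of the
functionals on their tensor product, i.e. of the multilinear functionals on these atoms.
The order is inclusion. -/
abbrev Rel {n : ℕ} (X : Fin n → QSet.{u, v}) :=
  ∀ a : (∀ i, (X i).At), Submodule ℂ (MultilinearMap ℂ (fun i => (X i).space (a i)) ℂ)

namespace Rel

/-- The coordinates of a multilinear functional (a functional on the tensor product of the atoms)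
with respect to an orthonormal basis of the tensor product that consists of simple tensors. -/
def coords {n : ℕ} {X : Fin n → QSet.{u, v}} (a : ∀ i, (X i).At) :
    MultilinearMap ℂ (fun i => (X i).space (a i)) ℂ →ₗ[ℂ]
      EuclideanSpace ℂ (∀ i, Fin (Module.finrank ℂ ((X i).space (a i)))) where
  toFun f := WithLp.toLp 2 fun k => f fun i => stdOrthonormalBasis ℂ ((X i).space (a i)) (k i)
  map_add' _ _ := rfl
  map_smul' _ _ := rfl

/-- The negation: the orthogonal complement in each component, for the inner product on the
functionals on a finite-dimensional Hilbert space (it does not depend on the basis in `coords`). -/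
def neg {n : ℕ} {X : Fin n → QSet.{u, v}} (R : Rel X) : Rel X := fun a =>
  ((R a).map (coords a))ᗮ.comap (coords a)

/-- The relation `R(x_{w 0}, …, x_{w (m-1)})` in the context `x_0, …, x_{n-1}`, for distinct
variables: the product of `R` with the largest relation on the other variables, with the factors
permuted to the order of the context. Its components are spanned by the functionals
`x ↦ ξ(x_{w 0}, …, x_{w (m-1)}) · η(the other x_i)`. -/
def cyl {n m : ℕ} {X : Fin n → QSet.{u, v}} (w : Fin m ↪ Fin n) (R : Rel fun j => X (w j)) :
    Rel X := fun a =>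
  Submodule.span ℂ {f | ∃ ξ ∈ R (fun j => a (w j)),
    ∃ η : MultilinearMap ℂ (fun i : {i // i ∉ Set.range w} => (X i).space (a i)) ℂ,
      ∀ x, f x = ξ (fun j => x (w j)) * η fun i => x i}

/-- The product `⊤_Z × R`. -/
def topProd {n : ℕ} {X : Fin n → QSet.{u, v}} (Z : QSet.{u, v}) (R : Rel X) :
    Rel (Fin.cons Z X : Fin (n + 1) → QSet.{u, v}) :=
  cyl (X := (Fin.cons Z X : Fin (n + 1) → QSet.{u, v})) (Fin.succEmb n) R

/-- The dependent pair `(x, y)`, as a function on `Fin 2`. -/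
def pair {A : Fin 2 → Type*} (x : A 0) (y : A 1) : ∀ i, A i :=
  Fin.cons x (Fin.cons y finZeroElim)

/-- The equality relation `E_X` of arity `(X, X*)`: it is spanned by the evaluation functional
`(x, ξ) ↦ ξ x` on the diagonal, and it is `0` off the diagonal. -/
def eq (X : QSet.{u, v}) : Rel ![X, X.dual] := fun a =>
  let p : X.At := a 0
  let q : X.At := a 1
  Submodule.span ℂ {f | ∃ h : p = q, ∀ (x : X.space p) (ξ : StrongDual ℂ (X.space q)),
    f (pair x ξ) = ξ (h ▸ x)}

/-- The conjugate `R_*` of a relation `R` of arity `(X, Y*)`, as a relation of arity `(X*, Y)`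
through the canonical identification of `Y**` with `Y`. A functional `ζ` has the conjugate
`ζ_*(⟨u|, y) = conj (ζ(u, ⟨y|))`, where `⟨u| = ⟪u, ·⟫` and `⟨y| = ⟪y, ·⟫`. -/
def conjugate {X Y : QSet.{u, v}} (R : Rel ![X, Y.dual]) : Rel ![X.dual, Y] := fun a =>
  let p : X.At := a 0
  let q : Y.At := a 1
  Submodule.span ℂ {g | ∃ ζ ∈ R (pair (A := fun i => (![X, Y.dual] i).At) p q),
    ∀ (u : X.space p) (y : Y.space q),
      g (pair (InnerProductSpace.toDual ℂ (X.space p) u) y) =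
        starRingEnd ℂ (ζ (pair u (InnerProductSpace.toDual ℂ (Y.space q) y)))}

end Rel

/-- The relation `F˘ = E_Y ∘ (F × I_{Y*})` of arity `(X, Y*)`: its components consist of the
functionals `(x, η) ↦ η (f x)` for `f ∈ F(X_a, Y_b)`. -/
def BinRel.bend {X Y : QSet.{u, v}} (F : BinRel X Y) : Rel ![X, Y.dual] := fun a =>
  let p : X.At := a 0
  let q : Y.At := a 1
  Submodule.span ℂ {g | ∃ f ∈ F p q, ∀ (x : X.space p) (η : StrongDual ℂ (Y.space q)),
    g (Rel.pair x η) = η (f x)}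

/-! ### Formulas and their interpretation -/

/-- Primitive formulas in a context of variables of sorts `X 0, …, X (n-1)`: atomic formulas
`R(x_{w 0}, …, x_{w (m-1)})` with distinct variables of the sorts given by the arity of `R`,
negations, conjunctions, and universal quantifications. A quantifier binds the variable with
index `0` of the extended context. -/
inductive Formula : {n : ℕ} → (Fin n → QSet.{u, v}) → Type (max (u + 1) (v + 1))
  | atom {n m : ℕ} {X : Fin n → QSet.{u, v}} {Y : Fin m → QSet.{u, v}} (R : Rel Y)
      (w : Fin m ↪ Fin n) (h : Y = fun j => X (w j)) : Formula X
  | neg {n : ℕ} {X : Fin n → QSet.{u, v}} (φ : Formula X) : Formula X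
  | conj {n : ℕ} {X : Fin n → QSet.{u, v}} (φ ψ : Formula X) : Formula X
  | all {n : ℕ} {X : Fin n → QSet.{u, v}} (Z : QSet.{u, v})
      (φ : Formula (Fin.cons Z X : Fin (n + 1) → QSet.{u, v})) : Formula X

namespace Formula

/-- The interpretation of a formula as a relation whose arity is the context. -/
def interp : {n : ℕ} → {X : Fin n → QSet.{u, v}} → Formula X → Rel X
  | _, _, atom R w h => Rel.cyl w (h ▸ R)
  | _, _, neg φ => φ.interp.neg
  | _, _, conj φ ψ => φ.interp ⊓ ψ.interp
  | _, X, all Z φ => sSup {R : Rel X | Rel.topProd Z R ≤ φ.interp}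

/-- A sentence is a formula in the empty context. It is true if its interpretation is `⊤`. -/
def IsTrue {X : Fin 0 → QSet.{u, v}} (φ : Formula X) : Prop := φ.interp = ⊤

variable {n : ℕ} {X : Fin n → QSet.{u, v}}

/-- The disjunction. -/
def disj (φ ψ : Formula X) : Formula X := neg (conj (neg φ) (neg ψ))

/-- The Sasaki arrow `φ → ψ`, which is `¬φ ∨ (φ ∧ ψ)`. -/
def imp (φ ψ : Formula X) : Formula X := disj (neg φ) (conj φ ψ)

/-- The existential quantifier `¬∀¬`. -/
def ex (Z : QSet.{u, v}) (φ : Formula (Fin.cons Z X : Fin (n + 1) → QSet.{u, v})) : Formula X :=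
  neg (all Z (neg φ))

/-- The atomic formula `R(x_i, x_j)` with distinct variables. -/
def atom₂ {Y Z : QSet.{u, v}} (R : Rel ![Y, Z]) (i j : Fin n) (hij : i ≠ j) (hi : Y = X i)
    (hj : Z = X j) : Formula X :=
  atom R ⟨![i, j], by
      intro k l hkl
      fin_cases k <;> fin_cases l <;> first | rfl | exact absurd hkl hij | exact absurd hkl.symm hij⟩
    (by
      funext k
      fin_cases k
      · exact hi
      · exact hj)

/-- The diagonal quantifier `(∀ (z = z_*) ∈ Z × Z*) φ(z, z_*, …)`, which abbreviates
`(∀ z_* ∈ Z*) (∀ z ∈ Z) (E_Z(z, z_*) → φ(z, z_*, …))`. In `φ`, the variable `z` has index `0` and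
the variable `z_*` has index `1`. -/
def allDiag (Z : QSet.{u, v})
    (φ : Formula (Fin.cons Z (Fin.cons Z.dual X : Fin (n + 1) → QSet.{u, v}) :
      Fin (n + 2) → QSet.{u, v})) : Formula X :=
  all Z.dual (all Z (imp (atom₂ (Rel.eq Z) 0 1 Fin.zero_ne_one rfl rfl) φ))

/-- The diagonal quantifier `(∃ (z = z_*) ∈ Z × Z*)`, which abbreviates `¬(∀ (z = z_*) ∈ Z × Z*)¬`. -/
def exDiag (Z : QSet.{u, v})
    (φ : Formula (Fin.cons Z (Fin.cons Z.dual X : Fin (n + 1) → QSet.{u, v}) :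
      Fin (n + 2) → QSet.{u, v})) : Formula X :=
  neg (allDiag Z (neg φ))

end Formula

/-! ### The four sentences

The variables are listed in the order of their indices. -/

namespace BinRel

open Formula

variable {X Y : QSet.{u, v}} (F : BinRel X Y)

/-- `(∀ x ∈ X) (∃ y_* ∈ Y*) F˘(x, y_*)`. Variables in the matrix: `y_*, x`. -/
def totalitySentence : Formula (![] : Fin 0 → QSet.{u, v}) :=
  all X (ex Y.dual (atom₂ F.bend 1 0 (by decide) rfl rfl))

/-- `(∀ (x = x_*)) (∀ (y₁ = y₁_*)) (∀ (y₂ = y₂_*)) ((F˘(x, y₁_*) ∧ F˘_*(x_*, y₂)) → E_Y(y₁, y₂_*))`.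
Variables in the matrix: `y₂, y₂_*, y₁, y₁_*, x, x_*`. -/
def univalenceSentence : Formula (![] : Fin 0 → QSet.{u, v}) :=
  allDiag X (allDiag Y (allDiag Y (imp
    (conj (atom₂ F.bend 4 3 (by decide) rfl rfl) (atom₂ F.bend.conjugate 5 0 (by decide) rfl rfl))
    (atom₂ (Rel.eq Y) 2 1 (by decide) rfl rfl))))

/-- `(∀ x ∈ X) (∀ x_* ∈ X*) (E_Y(F(x), F_*(x_*)) → E_X(x, x_*))`, where `E_Y(F(x), F_*(x_*))`
abbreviates `(∃ (y₂ = y₂_*) ∈ Y* × Y**) (∃ (y₁ = y₁_*) ∈ Y × Y*)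
(E_Y(y₁, y₂) ∧ F˘(x, y₁_*) ∧ (F_*)˘(x_*, y₂_*))`.
Variables in the matrix of the abbreviated formula: `y₁, y₁_*, y₂, y₂_*, x_*, x`. -/
def injectivitySentence : Formula (![] : Fin 0 → QSet.{u, v}) :=
  all X (all X.dual (imp
    (exDiag Y.dual (exDiag Y (conj (conj
      (atom₂ (Rel.eq Y) 0 2 (by decide) rfl rfl)
      (atom₂ F.bend 5 1 (by decide) rfl rfl))
      (atom₂ F.conjugate.bend 4 3 (by decide) rfl rfl))))
    (atom₂ (Rel.eq X) 1 0 (by decide) rfl rfl)))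

/-- `(∀ y_* ∈ Y*) (∃ x ∈ X) E_Y(F(x), y_*)`, where `E_Y(F(x), y_*)` abbreviates
`(∃ (y₂ = y₂_*) ∈ Y* × Y**) (∃ (y₁ = y₁_*) ∈ Y × Y*)
(E_Y(y₁, y₂) ∧ F˘(x, y₁_*) ∧ E_{Y*}(y_*, y₂_*))`.
Variables in the matrix of the abbreviated formula: `y₁, y₁_*, y₂, y₂_*, x, y_*`. -/
def surjectivitySentence : Formula (![] : Fin 0 → QSet.{u, v}) :=
  all Y.dual (ex X (exDiag Y.dual (exDiag Y (conj (conj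
      (atom₂ (Rel.eq Y) 0 2 (by decide) rfl rfl)
      (atom₂ F.bend 4 1 (by decide) rfl rfl))
      (atom₂ (Rel.eq Y.dual) 5 3 (by decide) rfl rfl)))))

end BinRel

end QSet

end

/-! The four sentences are translated into operator conditions on `F`; what remains is
finite-dimensional operator algebra.

Translation. On each choice of atoms the functionals form a Hilbert space, and pairing with a simple
tensor is evaluation (`ip_simple_left`). An atomic formula is tested by freezing the variables that
it does not mention (`mem_cyl`), and the Sasaki arrow from φ to ψ is the orthocomplement of the part
of φ orthogonal to φ ∧ ψ (`mem_interp_imp`). With `e` the evaluation functional, the universal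
diagonal quantifier asks whether `e ⊗ ξ` lies in the matrix (`mem_interp_allDiag`), and the
existential one is spanned by contractions of the matrix (`interp_exDiag_le_iff`). Conjunctions of
atoms in disjoint variables are tensor products (`interp_conj_atoms_le_iff`). It follows that (1)
says that the maps in `F(X, ·)` have no common kernel vector, (2) says `F ∘ F† ≤ I`, (3) says `F† ∘
F ≤ I`, and (4) says that no nonzero functional on an atom `Y` vanishes on the ranges of all `f ∈
F(·, Y)`.

Correspondence. If `F ∘ F† ≤ I`, then `(F† ∘ F)(X, X)` is closed under products. A trivial common
kernel gives an injective element, and finite dimension then gives the unit: `1 = ∑ g†f`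
(`one_mem_dagger_comp`). Hence (1) and (2) characterize functions, and the intertwining condition
forces `φ(c)(X) = ∑ g† c f`. This finite formula produces `φ`, shows that it is normal, and shows
that `F` contains every intertwiner of `φ` (`eq_ofHom_of_isStar`). Conversely, the intertwiners of a
normal `φ` satisfy `F ∘ F† ≤ I` by Schur's lemma. A unit vector killed by all of them would be
killed by the images of all finite central projections, which is impossible because these images
have supremum 1 (`isTotal_ofHom`).

Restrictions. A nonzero `f ∈ F(X, Y)` is a multiple of a coisometry. Thus `φ` is injective exactly
when `F` reaches every atom of `Y`; and if `F† ∘ F ≤ I`, then conjugating with such an `f`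
transports elements of `ℓ^∞(X)` back to `ℓ^∞(Y)`, so `φ` is surjective. -/

noncomputable section

namespace QSet

/-! ### The inner product on multilinear functionals -/

namespace Rel

section Ip

variable {n : ℕ} {X : Fin n → QSet.{u, v}} {a : ∀ i, (X i).At}

/-- The multilinear functionals on a choice of atoms. -/
abbrev Form (a : ∀ i, (X i).At) := MultilinearMap ℂ (fun i => (X i).space (a i)) ℂ

/-- The vector of basis elements with a given multi-index. -/
def basisVec (a : ∀ i, (X i).At) (k : ∀ i, Fin (Module.finrank ℂ ((X i).space (a i)))) :
    ∀ i, (X i).space (a i) := fun i => stdOrthonormalBasis ℂ ((X i).space (a i)) (k i)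

/-- The inner product of two multilinear functionals. -/
def ip (f g : Form a) : ℂ := inner ℂ (coords a f) (coords a g)

theorem ip_eq_sum (f g : Form a) :
    ip f g = ∑ k, starRingEnd ℂ (f (basisVec a k)) * g (basisVec a k) := by
  simp only [ip, PiLp.inner_apply, RCLike.inner_apply]
  exact Finset.sum_congr rfl fun k _ => mul_comm _ _

theorem ip_add_left (f g h : Form a) : ip (f + g) h = ip f h + ip g h := by
  rw [ip, map_add, inner_add_left]; rfl

theorem ip_add_right (f g h : Form a) : ip f (g + h) = ip f g + ip f h := by
  rw [ip, map_add, inner_add_right]; rfl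

theorem ip_smul_left (c : ℂ) (f g : Form a) : ip (c • f) g = starRingEnd ℂ c * ip f g := by
  rw [ip, map_smul, inner_smul_left]; rfl

theorem ip_smul_right (c : ℂ) (f g : Form a) : ip f (c • g) = c * ip f g := by
  rw [ip, map_smul, inner_smul_right]; rfl

theorem ip_sum_left {ι : Type*} (s : Finset ι) (f : ι → Form a) (g : Form a) :
    ip (∑ i ∈ s, f i) g = ∑ i ∈ s, ip (f i) g := by
  rw [ip, map_sum, sum_inner]; rfl

theorem ip_sum_right {ι : Type*} (s : Finset ι) (f : ι → Form a) (g : Form a) :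
    ip g (∑ i ∈ s, f i) = ∑ i ∈ s, ip g (f i) := by
  rw [ip, map_sum, inner_sum]; rfl

theorem ip_zero_left (f : Form a) : ip 0 f = 0 := by simp [ip]

theorem ip_zero_right (f : Form a) : ip f 0 = 0 := by simp [ip]

theorem ip_sub_right (f g h : Form a) : ip f (g - h) = ip f g - ip f h := by
  rw [ip, map_sub, inner_sub_right]; rfl

theorem ip_eq_zero_comm {f g : Form a} : ip f g = 0 ↔ ip g f = 0 := inner_eq_zero_symm

/-- The simple tensor `⟨u 0| ⊗ ⟨u 1| ⊗ …`. -/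
def simple (u : ∀ i, (X i).space (a i)) : Form a :=
  (MultilinearMap.mkPiAlgebra ℂ (Fin n) ℂ).compLinearMap
    fun i => (innerSL ℂ (u i) : (X i).space (a i) →L[ℂ] ℂ).toLinearMap

theorem simple_apply (u x : ∀ i, (X i).space (a i)) : simple u x = ∏ i, inner ℂ (u i) (x i) := by
  simp [simple]

theorem apply_eq_sum_basis (f : Form a) (x : ∀ i, (X i).space (a i)) :
    f x = ∑ k, (∏ i, inner ℂ (basisVec a k i) (x i)) * f (basisVec a k) := by
  conv_lhs => rw [show x = fun i => ∑ j, (inner ℂ (stdOrthonormalBasis ℂ ((X i).space (a i)) j) (x i)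
    : ℂ) • stdOrthonormalBasis ℂ ((X i).space (a i)) j from
    funext fun i => ((stdOrthonormalBasis ℂ ((X i).space (a i))).sum_repr' (x i)).symm]
  rw [MultilinearMap.map_sum]
  refine Finset.sum_congr rfl fun k _ => ?_
  rw [MultilinearMap.map_smul_univ]
  rfl

/-- Both sides have the same expansion over the standard basis. This reproducing property does not
mention the basis, so later inner products can be computed with any convenient simple tensors. -/
theorem ip_simple_left (u : ∀ i, (X i).space (a i)) (f : Form a) : ip (simple u) f = f u := by
  rw [ip_eq_sum, apply_eq_sum_basis f u]
  refine Finset.sum_congr rfl fun k _ => ?_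
  rw [simple_apply, map_prod]
  congr 1
  exact Finset.prod_congr rfl fun i _ => inner_conj_symm _ _

theorem eq_sum_simple (f : Form a) : f = ∑ k, f (basisVec a k) • simple (basisVec a k) := by
  ext x
  rw [apply_eq_sum_basis f x, sum_apply]
  refine Finset.sum_congr rfl fun k _ => ?_
  rw [smul_apply, simple_apply, smul_eq_mul, mul_comm]

theorem ip_self_eq_zero {f : Form a} : ip f f = 0 ↔ f = 0 := by
  constructor
  · intro h
    have h0 : coords a f = 0 := inner_self_eq_zero.1 h
    rw [eq_sum_simple f]
    refine Finset.sum_eq_zero fun k _ => ?_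
    have : f (basisVec a k) = 0 := congrArg (fun w => w k) h0
    rw [this, zero_smul]
  · rintro rfl
    exact ip_zero_left _

theorem coords_injective : Function.Injective (coords a) := by
  rw [injective_iff_map_eq_zero]
  intro f hf
  rw [← ip_self_eq_zero, ip, hf, inner_zero_left]

theorem induction_simple {p : Form a → Prop} (f : Form a) (h0 : p 0)
    (hadd : ∀ f g, p f → p g → p (f + g)) (hsimple : ∀ (c : ℂ) u, p (c • simple u)) : p f := by
  rw [eq_sum_simple f]
  exact Finset.sum_induction _ p (fun f g => hadd f g) h0 fun k _ => hsimple _ _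

/-! ### The negation -/

theorem mem_neg {R : Rel X} {f : Form a} : f ∈ R.neg a ↔ ∀ g ∈ R a, ip g f = 0 := by
  simp only [neg, Submodule.mem_comap, Submodule.mem_orthogonal, Submodule.mem_map,
    forall_exists_index, and_imp, forall_apply_eq_imp_iff₂]
  rfl

/-- In a finite-dimensional Hilbert space a subspace equals its double orthocomplement; the
coordinate isomorphism carries this over to functionals. -/
theorem neg_neg (R : Rel X) : R.neg.neg = R := by
  funext a
  ext f
  rw [mem_neg]
  constructor
  · intro h
    have : coords a f ∈ ((R a).map (coords a))ᗮᗮ := by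
      rw [Submodule.mem_orthogonal]
      intro w hw
      -- Orthogonality in coordinates is tested against arbitrary vectors, whereas `h` speaks of
      -- functionals, so every vector has to be the coordinates of one.
      have hdim : Function.Surjective (coords a) := by
        intro w
        refine ⟨∑ k, w k • simple (basisVec a k), ?_⟩
        ext l
        change (∑ k, w k • simple (basisVec a k)) (basisVec a l) = w l
        rw [sum_apply, Finset.sum_eq_single l]
        · rw [smul_apply, simple_apply, Finset.prod_eq_one, smul_eq_mul, mul_one]
          intro i _
          simp [basisVec]
        · intro k _ hk
          obtain ⟨i, hi⟩ := Function.ne_iff.1 hk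
          rw [smul_apply, simple_apply, Finset.prod_eq_zero (Finset.mem_univ i),
            smul_zero]
          simp [basisVec, orthonormal_iff_ite.1 (stdOrthonormalBasis ℂ _).orthonormal, hi]
        · simp
      obtain ⟨g, rfl⟩ := hdim w
      exact h g hw
    rw [Submodule.orthogonal_orthogonal] at this
    obtain ⟨g, hg, hgf⟩ := this
    rwa [← coords_injective hgf]
  · intro h g hg
    rw [ip_eq_zero_comm]
    exact mem_neg.1 hg f h

theorem neg_eq_top {R : Rel X} : R.neg = ⊤ ↔ R = ⊥ := by
  constructor
  · intro h
    funext a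
    rw [Pi.bot_apply, eq_bot_iff]
    intro f hf
    have : f ∈ R.neg a := by rw [h]; trivial
    exact ip_self_eq_zero.1 (mem_neg.1 this f hf)
  · rintro rfl
    funext a
    rw [Pi.top_apply, eq_top_iff]
    intro f _
    rw [mem_neg]
    rintro g (rfl : g = 0)
    exact ip_zero_left f

theorem exists_orthogonal_decomposition (S : Submodule ℂ (Form a)) (f : Form a) :
    ∃ g ∈ S, ∀ h ∈ S, ip h (f - g) = 0 := by
  let K := S.map (coords a)
  obtain ⟨g, hg, hgf⟩ : ∃ g ∈ S, coords a g = K.starProjection (coords a f) :=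
    Submodule.starProjection_apply_mem K (coords a f)
  refine ⟨g, hg, fun h hh => ?_⟩
  rw [ip, map_sub, hgf]
  exact (Submodule.mem_orthogonal _ _).1 (Submodule.sub_starProjection_mem_orthogonal (coords a f))
    _ ⟨h, hh, rfl⟩

end Ip
end Rel

/-! ### Quantifiers -/

namespace Rel

variable {n : ℕ} {X : Fin n → QSet.{u, v}} {Z : QSet.{u, v}}

/-- The index `(z, a)` of the extended context. -/
abbrev consAt (z : Z.At) (a : ∀ i, (X i).At) :
    ∀ i, ((Fin.cons Z X : Fin (n + 1) → QSet.{u, v}) i).At :=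
  Fin.cons (α := fun i => ((Fin.cons Z X : Fin (n + 1) → QSet.{u, v}) i).At) z a

/-- The vector `(x, y)`. -/
abbrev consVec {z : Z.At} {a : ∀ i, (X i).At} (x : Z.space z) (y : ∀ i, (X i).space (a i)) :
    ∀ i, ((Fin.cons Z X : Fin (n + 1) → QSet.{u, v}) i).space (consAt z a i) :=
  Fin.cons (α := fun i => ((Fin.cons Z X : Fin (n + 1) → QSet.{u, v}) i).space (consAt z a i)) x y

variable {z : Z.At} {a : ∀ i, (X i).At}

/-- The functional `f(x, ·)`. -/
def slice (f : Form (consAt z a)) : Z.space z →ₗ[ℂ] Form a := MultilinearMap.curryLeft f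

theorem slice_apply (f : Form (consAt z a)) (x : Z.space z) (y : ∀ i, (X i).space (a i)) :
    slice f x y = f (consVec x y) := rfl

/-- The functional `⟨v| ⊗ ξ`. -/
def consProd (v : Z.space z) (ξ : Form a) : Form (consAt z a) :=
  LinearMap.uncurryLeft (M := fun i => ((Fin.cons Z X : Fin (n + 1) → QSet.{u, v}) i).space
    (consAt z a i)) (((innerSL ℂ v : Z.space z →L[ℂ] ℂ).toLinearMap).smulRight ξ)

theorem consProd_apply (v : Z.space z) (ξ : Form a) (x : Z.space z)
    (y : ∀ i, (X i).space (a i)) : consProd v ξ (consVec x y) = inner ℂ v x * ξ y := rfl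

theorem exists_consVec (x : ∀ i, ((Fin.cons Z X : Fin (n + 1) → QSet.{u, v}) i).space (consAt z a i)) :
    ∃ (s : Z.space z) (y : ∀ i, (X i).space (a i)), x = consVec s y :=
  ⟨x 0, fun i => x i.succ, (Fin.cons_self_tail x).symm⟩

theorem exists_consAt (a : ∀ i, ((Fin.cons Z X : Fin (n + 1) → QSet.{u, v}) i).At) :
    ∃ (z : Z.At) (b : ∀ i, (X i).At), a = consAt z b :=
  ⟨a 0, fun i => a i.succ, (Fin.cons_self_tail a).symm⟩

theorem form_ext {f g : Form (consAt z a)}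
    (h : ∀ (s : Z.space z) (y : ∀ i, (X i).space (a i)), f (consVec s y) = g (consVec s y)) :
    f = g := by
  ext x
  obtain ⟨s, y, rfl⟩ := exists_consVec x
  exact h s y

theorem consProd_add (v : Z.space z) (ξ η : Form a) :
    consProd v (ξ + η) = consProd v ξ + consProd v η :=
  form_ext fun _ _ => mul_add _ _ _

theorem consProd_smul (v : Z.space z) (c : ℂ) (ξ : Form a) :
    consProd v (c • ξ) = c • consProd v ξ :=
  form_ext fun _ _ => mul_left_comm _ _ _

theorem consProd_zero (v : Z.space z) : consProd v (0 : Form a) = 0 :=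
  form_ext fun _ _ => mul_zero _

theorem consProd_simple (v : Z.space z) (w : ∀ i, (X i).space (a i)) :
    consProd v (simple w) = simple (consVec v w) :=
  form_ext fun s y => by
    rw [consProd_apply, simple_apply, simple_apply, Fin.prod_univ_succ]
    rfl

/-- Tensoring with `⟨v|` is adjoint to inserting `v`; by linearity it suffices to check simple
tensors. This is how quantified variables are removed from inner products. -/
theorem ip_consProd (v : Z.space z) (ξ : Form a) (f : Form (consAt z a)) :
    ip (consProd v ξ) f = ip ξ (slice f v) := by
  induction ξ using induction_simple with
  | h0 => rw [consProd_zero, ip_zero_left, ip_zero_left]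
  | hadd ξ η h1 h2 => rw [consProd_add, ip_add_left, ip_add_left, h1, h2]
  | hsimple c w =>
    rw [consProd_smul, ip_smul_left, ip_smul_left, consProd_simple, ip_simple_left, ip_simple_left]
    rfl

theorem eq_sum_consProd (f : Form (consAt z a)) :
    f = ∑ k, consProd (stdOrthonormalBasis ℂ (Z.space z) k)
      (slice f (stdOrthonormalBasis ℂ (Z.space z) k)) :=
  form_ext fun s y => by
    rw [sum_apply]
    simp only [consProd_apply]
    conv_lhs => rw [← slice_apply, ← (stdOrthonormalBasis ℂ (Z.space z)).sum_repr' s]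
    simp

end Rel
end QSet

/-! ### Cylinders, universal quantification and the Sasaki arrow -/

namespace QSet
namespace Rel

variable {n : ℕ} {X : Fin n → QSet.{u, v}} {Z : QSet.{u, v}}

/-- Freezing the variables outside `w` leaves an element of `R`. Conversely, expanding `f` over
basis vectors in those variables writes it as a sum of products whose first factors are such frozen
functionals. -/
theorem mem_cyl {m : ℕ} {w : Fin m ↪ Fin n} {R : Rel fun j => X (w j)} {a : ∀ i, (X i).At}
    {f : Form a} :
    f ∈ cyl w R a ↔ ∀ x : ∀ i, (X i).space (a i), ∃ ξ ∈ R (fun j => a (w j)),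
      ∀ x', (∀ i ∉ Set.range w, x' i = x i) → f x' = ξ fun j => x' (w j) := by
  classical
  constructor
  · intro hf
    induction hf using Submodule.span_induction with
    | mem f hf =>
      obtain ⟨ξ, hξ, η, h⟩ := hf
      intro x
      refine ⟨(η fun i => x i) • ξ, Submodule.smul_mem _ _ hξ, fun x' hx' => ?_⟩
      rw [h, smul_apply, smul_eq_mul, mul_comm]
      congr 2
      exact funext fun i => hx' i i.2
    | zero => exact fun x => ⟨0, Submodule.zero_mem _, fun _ _ => rfl⟩
    | add f g _ _ hf hg =>
      intro x
      obtain ⟨ξ, hξ, h1⟩ := hf x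
      obtain ⟨η, hη, h2⟩ := hg x
      exact ⟨ξ + η, Submodule.add_mem _ hξ hη, fun x' hx' => by
        rw [add_apply, add_apply, h1 x' hx', h2 x' hx']⟩
    | smul c f _ hf =>
      intro x
      obtain ⟨ξ, hξ, h1⟩ := hf x
      exact ⟨c • ξ, Submodule.smul_mem _ c hξ, fun x' hx' => by
        rw [smul_apply, smul_apply, h1 x' hx']⟩
  · intro h
    -- `L k` leaves the variables of `R` alone and projects every other variable onto its basis
    -- vector with index `k i`.
    let L (k : ∀ i, Fin (Module.finrank ℂ ((X i).space (a i)))) (i : Fin n) :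
        (X i).space (a i) →ₗ[ℂ] (X i).space (a i) :=
      if i ∈ Set.range w then LinearMap.id else
        ((innerSL ℂ (basisVec a k i) : (X i).space (a i) →L[ℂ] ℂ).toLinearMap).smulRight
          (basisVec a k i)
    have hpos (i : Fin n) : 0 < Module.finrank ℂ ((X i).space (a i)) := Module.finrank_pos
    -- The variables of `R` are not expanded, so they get a single dummy index; it exists because
    -- atoms are nonzero.
    let A (i : Fin n) : Finset (Fin (Module.finrank ℂ ((X i).space (a i)))) :=
      if i ∈ Set.range w then {⟨0, hpos i⟩} else Finset.univ
    have hsum : f = ∑ k ∈ Fintype.piFinset A, f.compLinearMap (L k) := by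
      ext x
      rw [sum_apply]
      have hx : x = fun i => ∑ j ∈ A i, (if i ∈ Set.range w then x i else
          (inner ℂ (stdOrthonormalBasis ℂ ((X i).space (a i)) j) (x i) : ℂ) •
            stdOrthonormalBasis ℂ ((X i).space (a i)) j) := by
        funext i
        by_cases hi : i ∈ Set.range w
        · simp only [A, if_pos hi, Finset.sum_singleton]
        · simp only [A, if_neg hi]
          exact ((stdOrthonormalBasis ℂ ((X i).space (a i))).sum_repr' (x i)).symm
      conv_lhs => rw [hx]
      rw [MultilinearMap.map_sum_finset]
      refine Finset.sum_congr rfl fun k _ => ?_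
      rw [MultilinearMap.compLinearMap_apply]
      congr 1
      funext i
      by_cases hi : i ∈ Set.range w
      · simp only [L, if_pos hi, LinearMap.id_apply]
      · simp only [L, if_neg hi]
        rfl
    rw [hsum]
    refine Submodule.sum_mem _ fun k _ => Submodule.subset_span ?_
    obtain ⟨ξ, hξ, hk⟩ := h (basisVec a k)
    refine ⟨ξ, hξ, (MultilinearMap.mkPiAlgebra ℂ {i // i ∉ Set.range w} ℂ).compLinearMap
      fun i => (innerSL ℂ (basisVec a k i) : (X i).space (a i) →L[ℂ] ℂ).toLinearMap, fun x => ?_⟩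
    rw [MultilinearMap.compLinearMap_apply]
    have hL : (fun i => L k i (x i)) = fun i =>
        (if i ∈ Set.range w then (1 : ℂ) else inner ℂ (basisVec a k i) (x i)) •
          (if i ∈ Set.range w then x i else basisVec a k i) := by
      funext i
      by_cases hi : i ∈ Set.range w
      · simp only [L, if_pos hi, one_smul, LinearMap.id_apply]
      · simp only [L, if_neg hi]
        rfl
    rw [hL, MultilinearMap.map_smul_univ, hk _ fun i hi => if_neg hi, smul_eq_mul, mul_comm]
    congr 1
    · congr 1
      funext j
      exact if_pos ⟨j, rfl⟩
    · rw [MultilinearMap.compLinearMap_apply, MultilinearMap.mkPiAlgebra_apply,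
        Finset.prod_ite, Finset.prod_const_one, one_mul]
      exact (Finset.prod_subtype _ (by simp) fun i => inner ℂ (basisVec a k i) (x i))

theorem topProd_le_iff {R : Rel X} {T : Rel (Fin.cons Z X : Fin (n + 1) → QSet.{u, v})} :
    topProd Z R ≤ T ↔ ∀ (z : Z.At) (a : ∀ i, (X i).At), ∀ ξ ∈ R a, ∀ v : Z.space z,
      consProd v ξ ∈ T (consAt z a) := by
  constructor
  · intro h z a ξ hξ v
    refine h (consAt z a) (mem_cyl.2 fun x => ?_)
    refine ⟨(inner ℂ v (x 0) : ℂ) • ξ, Submodule.smul_mem _ _ hξ, fun x' hx' => ?_⟩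
    have h0 : x' 0 = x 0 := hx' 0 (by rintro ⟨j, hj⟩; exact Fin.succ_ne_zero j hj)
    rw [← h0]
    rfl
  · intro h a f hf
    obtain ⟨z, b, rfl⟩ := exists_consAt a
    rw [eq_sum_consProd f]
    refine Submodule.sum_mem _ fun k _ => h _ _ _ ?_ _
    obtain ⟨ξ, hξ, hx⟩ := mem_cyl.1 hf (consVec (stdOrthonormalBasis ℂ (Z.space z) k) 0)
    have : slice f (stdOrthonormalBasis ℂ (Z.space z) k) = ξ := by
      ext y
      refine hx (consVec _ y) fun i => ?_
      refine Fin.cases (fun _ => rfl) (fun j hj => absurd ⟨j, rfl⟩ hj) i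
    rw [this]
    exact hξ

end Rel

namespace Formula
open QSet.Rel

variable {n : ℕ} {X : Fin n → QSet.{u, v}} {Z : QSet.{u, v}} {a : ∀ i, (X i).At}

theorem mem_interp_neg {φ : Formula X} {f : Form a} :
    f ∈ (neg φ).interp a ↔ ∀ g ∈ φ.interp a, ip g f = 0 := Rel.mem_neg

/-- The condition on the right is linear in `ξ`, so it defines a relation `R`; this `R` belongs to
the family whose supremum is taken and dominates it. -/
theorem mem_interp_all {φ : Formula (Fin.cons Z X : Fin (n + 1) → QSet.{u, v})} {ξ : Form a} :
    ξ ∈ (all Z φ).interp a ↔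
      ∀ (z : Z.At) (v : Z.space z), consProd v ξ ∈ φ.interp (consAt z a) := by
  let R : Rel X := fun a =>
    { carrier := {ξ | ∀ (z : Z.At) (v : Z.space z), consProd v ξ ∈ φ.interp (consAt z a)}
      add_mem' := fun h1 h2 z v => by
        rw [consProd_add]
        exact Submodule.add_mem _ (h1 z v) (h2 z v)
      zero_mem' := fun z v => by
        rw [consProd_zero]
        exact Submodule.zero_mem _
      smul_mem' := fun c ξ h z v => by
        rw [consProd_smul]
        exact Submodule.smul_mem _ c (h z v) }
  have hR : (all Z φ).interp = R := by
    refine le_antisymm (sSup_le fun S hS a ξ hξ z v => topProd_le_iff.1 hS z a ξ hξ v)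
      (le_sSup (topProd_le_iff.2 fun z a ξ hξ v => hξ z v))
  rw [hR]
  rfl

theorem interp_all_eq_top {φ : Formula (Fin.cons Z X : Fin (n + 1) → QSet.{u, v})} :
    (all Z φ).interp = ⊤ ↔ φ.interp = ⊤ := by
  constructor
  · intro h
    funext a
    obtain ⟨z, b, rfl⟩ := exists_consAt a
    rw [Pi.top_apply, eq_top_iff]
    intro f _
    rw [eq_sum_consProd f]
    refine Submodule.sum_mem _ fun k _ => ?_
    refine mem_interp_all.1 ?_ z _
    rw [h]
    trivial
  · intro h
    funext a
    rw [Pi.top_apply, eq_top_iff]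
    intro ξ _
    refine mem_interp_all.2 fun z v => ?_
    rw [h]
    trivial

/-- By double negation `φ → ψ` is the orthocomplement of `φ ∧ ¬(φ ∧ ψ)`, that is, of the part of `φ`
orthogonal to `φ ∧ ψ`. -/
theorem mem_interp_imp {φ ψ : Formula X} {v : Form a} :
    v ∈ (imp φ ψ).interp a ↔ ∀ f ∈ φ.interp a,
      (∀ g ∈ φ.interp a, g ∈ ψ.interp a → ip g f = 0) → ip f v = 0 := by
  have h : (imp φ ψ).interp = (φ.interp ⊓ (φ.interp ⊓ ψ.interp).neg).neg := by
    change (φ.interp.neg.neg ⊓ (φ.interp ⊓ ψ.interp).neg).neg = _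
    rw [Rel.neg_neg]
  rw [h, Rel.mem_neg]
  refine ⟨fun H f hf hg => H f ⟨hf, Rel.mem_neg.2 fun g hg' => hg g hg'.1 hg'.2⟩,
    fun H f hf => H f hf.1 fun g h1 h2 => Rel.mem_neg.1 hf.2 g ⟨h1, h2⟩⟩

theorem mem_of_mem_imp {φ ψ : Formula X} {f : Form a} (hf : f ∈ φ.interp a)
    (h : f ∈ (imp φ ψ).interp a) : f ∈ ψ.interp a := by
  obtain ⟨g, hg, hfg⟩ := exists_orthogonal_decomposition (φ.interp a ⊓ ψ.interp a) f
  have h1 : ip (f - g) f = 0 :=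
    mem_interp_imp.1 h _ (Submodule.sub_mem _ hf hg.1) fun w h1 h2 => hfg w ⟨h1, h2⟩
  have h2 : ip (f - g) (f - g) = 0 := by
    rw [ip_sub_right, h1, ip_eq_zero_comm.1 (hfg g hg), sub_zero]
  rw [sub_eq_zero.1 (ip_self_eq_zero.1 h2)]
  exact hg.2

theorem interp_imp_eq_top {φ ψ : Formula X} : (imp φ ψ).interp = ⊤ ↔ φ.interp ≤ ψ.interp := by
  constructor
  · intro h a f hf
    refine mem_of_mem_imp hf ?_
    rw [h]
    trivial
  · intro h
    funext a
    rw [Pi.top_apply, eq_top_iff]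
    intro v _
    refine mem_interp_imp.2 fun f hf hg => ?_
    rw [ip_self_eq_zero.1 (hg f hf (h a hf)), ip_zero_left]

end Formula

/-! ### Binary atomic formulas -/

namespace Rel

variable {Y Z : QSet.{u, v}}

/-- The components of a binary relation symbol as subspaces of bilinear functionals. -/
def bil (R : Rel ![Y, Z]) (p : Y.At) (q : Z.At) :
    Submodule ℂ (Y.space p →ₗ[ℂ] Z.space q →ₗ[ℂ] ℂ) where
  carrier := {B | ∃ ξ ∈ R (pair (A := fun i => (![Y, Z] i).At) p q),
    ∀ (s : Y.space p) (t : Z.space q), ξ (pair s t) = B s t}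
  add_mem' := by
    rintro B C ⟨ξ, hξ, h1⟩ ⟨η, hη, h2⟩
    exact ⟨ξ + η, Submodule.add_mem _ hξ hη, fun s t => by
      rw [add_apply, h1, h2]; rfl⟩
  zero_mem' := ⟨0, Submodule.zero_mem _, fun _ _ => rfl⟩
  smul_mem' := by
    rintro c B ⟨ξ, hξ, h1⟩
    exact ⟨c • ξ, Submodule.smul_mem _ c hξ, fun s t => by
      rw [smul_apply, h1]; rfl⟩

/-- The bilinear functional of a functional on two atoms. -/
def toBil {p : Y.At} {q : Z.At} (ξ : Form (X := ![Y, Z]) (pair (A := fun i => (![Y, Z] i).At) p q)) :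
    Y.space p →ₗ[ℂ] Z.space q →ₗ[ℂ] ℂ :=
  LinearMap.mk₂ ℂ (fun s t => ξ (pair s t))
    (fun s s' t => congrArg (fun g => g (Fin.cons t finZeroElim))
      ((MultilinearMap.curryLeft ξ).map_add s s'))
    (fun c s t => congrArg (fun g => g (Fin.cons t finZeroElim))
      ((MultilinearMap.curryLeft ξ).map_smul c s))
    (fun s t t' => congrArg (fun g => g finZeroElim)
      ((MultilinearMap.curryLeft (MultilinearMap.curryLeft ξ s)).map_add t t'))
    (fun c s t => congrArg (fun g => g finZeroElim)
      ((MultilinearMap.curryLeft (MultilinearMap.curryLeft ξ s)).map_smul c t))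

theorem toBil_apply {p : Y.At} {q : Z.At}
    (ξ : Form (X := ![Y, Z]) (pair (A := fun i => (![Y, Z] i).At) p q)) (s : Y.space p)
    (t : Z.space q) : toBil ξ s t = ξ (pair s t) := rfl

/-- The interpretation of an atom transports `R` along an equality of arities. Comparing values on
heterogeneously equal arguments removes the transport once and for all. -/
theorem exists_cast {m : ℕ} {Y X : Fin m → QSet.{u, v}} (R : Rel Y) (h : Y = X)
    (a : ∀ j, (Y j).At) (b : ∀ j, (X j).At) (hab : ∀ j, HEq (a j) (b j)) :
    (∀ ξ ∈ (h ▸ R : Rel X) b, ∃ η ∈ R a, ∀ x y, (∀ j, HEq (x j) (y j)) → η x = ξ y) ∧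
      ∀ η ∈ R a, ∃ ξ ∈ (h ▸ R : Rel X) b, ∀ x y, (∀ j, HEq (x j) (y j)) → η x = ξ y := by
  subst h
  obtain rfl : a = b := funext fun j => eq_of_heq (hab j)
  have key (ξ : Form a) (x y : ∀ j, (Y j).space (a j)) (hxy : ∀ j, HEq (x j) (y j)) : ξ x = ξ y := by
    rw [show x = y from funext fun j => eq_of_heq (hxy j)]
  exact ⟨fun ξ hξ => ⟨ξ, hξ, key ξ⟩, fun ξ hξ => ⟨ξ, hξ, key ξ⟩⟩

end Rel

namespace Formula
open QSet.Rel

variable {n : ℕ} {X : Fin n → QSet.{u, v}}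

theorem mem_interp_atom₂ {i j : Fin n} (R : Rel ![X i, X j]) (hij : i ≠ j) {a : ∀ i, (X i).At}
    {f : Form a} :
    f ∈ (atom₂ R i j hij rfl rfl).interp a ↔ ∀ x : ∀ i, (X i).space (a i), ∃ B ∈ R.bil (a i) (a j),
      ∀ x', (∀ k, k ≠ i → k ≠ j → x' k = x k) → f x' = B (x' i) (x' j) := by
  refine mem_cyl.trans (forall_congr' fun x => ?_)
  have hr (x' : ∀ k, (X k).space (a k)) :
      (∀ k ∉ Set.range (![i, j] : Fin 2 → Fin n), x' k = x k) ↔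
        ∀ k, k ≠ i → k ≠ j → x' k = x k := by
    simp only [Matrix.range_cons, Matrix.range_empty, Set.union_empty, Set.mem_union,
      Set.mem_singleton_iff, not_or, and_imp]
  constructor
  · rintro ⟨ξ, hξ, h⟩
    obtain ⟨η, hη, h'⟩ := (exists_cast (X := fun k => X (![i, j] k)) R
      (by funext k; fin_cases k <;> rfl) (pair (A := fun k => (![X i, X j] k).At) (a i) (a j))
      (fun k => a (![i, j] k))
      (by intro k; fin_cases k <;> rfl)).1 ξ hξ
    refine ⟨toBil η, ⟨η, hη, fun _ _ => rfl⟩, fun x' hx' => ?_⟩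
    rw [h x' ((hr x').2 hx'), toBil_apply]
    exact (h' _ _ (by intro k; fin_cases k <;> rfl)).symm
  · rintro ⟨B, ⟨η, hη, hB⟩, h⟩
    obtain ⟨ξ, hξ, h'⟩ := (exists_cast (X := fun k => X (![i, j] k)) R
      (by funext k; fin_cases k <;> rfl) (pair (A := fun k => (![X i, X j] k).At) (a i) (a j))
      (fun k => a (![i, j] k))
      (by intro k; fin_cases k <;> rfl)).2 η hη
    refine ⟨ξ, hξ, fun x' hx' => ?_⟩
    rw [h x' ((hr x').1 hx'), ← hB]
    exact h' _ _ (by intro k; fin_cases k <;> rfl)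

end Formula
end QSet

namespace QSet

attribute [local instance] dualInnerProductSpace

/-! ### Diagonal quantifiers -/

namespace Rel

variable {n : ℕ} {X : Fin n → QSet.{u, v}} {Z : QSet.{u, v}} {p : Z.At} {a : ∀ i, (X i).At}

theorem inner_toDual (v : Z.space p) (η : StrongDual ℂ (Z.space p)) :
    inner ℂ (InnerProductSpace.toDual ℂ (Z.space p) v) η = η v := by
  change inner ℂ ((InnerProductSpace.toDual ℂ (Z.space p)).symm η)
    ((InnerProductSpace.toDual ℂ (Z.space p)).symm (InnerProductSpace.toDual ℂ (Z.space p) v)) = _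
  rw [LinearIsometryEquiv.symm_apply_apply, InnerProductSpace.toDual_symm_apply]

theorem sum_inner_mul_apply {E : Type*} [NormedAddCommGroup E] [InnerProductSpace ℂ E]
    [FiniteDimensional ℂ E] (f : E →ₗ[ℂ] ℂ) (x : E) :
    ∑ i, inner ℂ (stdOrthonormalBasis ℂ E i) x * f (stdOrthonormalBasis ℂ E i) = f x := by
  conv_rhs => rw [← (stdOrthonormalBasis ℂ E).sum_repr' x, map_sum]
  simp

/-- The functional `e_p ⊗ ξ`, where `e_p` is the evaluation functional. -/
def evalProd (p : Z.At) (ξ : Form a) : Form (consAt (Z := Z) p (consAt (Z := Z.dual) p a)) :=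
  ∑ i, consProd (Z := Z) (stdOrthonormalBasis ℂ (Z.space p) i)
    (consProd (Z := Z.dual) (z := p)
      (InnerProductSpace.toDual ℂ (Z.space p) (stdOrthonormalBasis ℂ (Z.space p) i)) ξ)

theorem evalProd_apply (ξ : Form a) (x : Z.space p) (η : StrongDual ℂ (Z.space p))
    (y : ∀ i, (X i).space (a i)) :
    evalProd p ξ (consVec (Z := Z) x (consVec (Z := Z.dual) (z := p) η y)) = η x * ξ y := by
  rw [evalProd, sum_apply, show η x = (η : Z.space p →ₗ[ℂ] ℂ) x from rfl,
    ← sum_inner_mul_apply (η : Z.space p →ₗ[ℂ] ℂ) x, Finset.sum_mul]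
  refine Finset.sum_congr rfl fun i _ => ?_
  rw [consProd_apply, consProd_apply, mul_assoc]
  congr 2
  exact inner_toDual _ _

/-- The contraction of the first two arguments of a functional. -/
def contract (f : Form (consAt (Z := Z) p (consAt (Z := Z.dual) p a))) : Form a :=
  ∑ i, slice (Z := Z.dual) (slice f (stdOrthonormalBasis ℂ (Z.space p) i))
    (InnerProductSpace.toDual ℂ (Z.space p) (stdOrthonormalBasis ℂ (Z.space p) i))

theorem contract_apply (f : Form (consAt (Z := Z) p (consAt (Z := Z.dual) p a)))
    (y : ∀ i, (X i).space (a i)) :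
    contract f y = ∑ i, f (consVec (stdOrthonormalBasis ℂ (Z.space p) i) (consVec (Z := Z.dual)
      (z := p) (InnerProductSpace.toDual ℂ (Z.space p) (stdOrthonormalBasis ℂ (Z.space p) i)) y)) := by
  rw [contract, sum_apply]
  rfl

/-- Tensoring with the evaluation functional `∑ ⟨eᵢ| ⊗ ⟨eᵢ*|` is adjoint to contraction. This
duality links the two diagonal quantifiers. -/
theorem ip_evalProd (ξ : Form a) (f : Form (consAt (Z := Z) p (consAt (Z := Z.dual) p a))) :
    ip (evalProd p ξ) f = ip ξ (contract f) := by
  rw [evalProd, contract, ip_sum_left, ip_sum_right]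
  refine Finset.sum_congr rfl fun i _ => ?_
  rw [ip_consProd]
  exact ip_consProd (Z := Z.dual) _ _ _

theorem contract_add (f g : Form (consAt (Z := Z) p (consAt (Z := Z.dual) p a))) :
    contract (f + g) = contract f + contract g := by
  ext y
  simp only [add_apply, contract_apply, Finset.sum_add_distrib]

theorem contract_smul (c : ℂ) (f : Form (consAt (Z := Z) p (consAt (Z := Z.dual) p a))) :
    contract (c • f) = c • contract f := by
  ext y
  simp only [smul_apply, contract_apply, Finset.smul_sum]

/-! ### The equality relation and the relation of a binary relation -/

/-- The functional on two atoms of a bilinear functional. -/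
def ofBil {Y Z : QSet.{u, v}} {p : Y.At} {q : Z.At} (B : Y.space p →ₗ[ℂ] Z.space q →ₗ[ℂ] ℂ) :
    Form (X := ![Y, Z]) (pair (A := fun i => (![Y, Z] i).At) p q) :=
  ∑ k, ∑ l, B (stdOrthonormalBasis ℂ (Y.space p) k) (stdOrthonormalBasis ℂ (Z.space q) l) •
    simple (X := ![Y, Z]) (a := pair (A := fun i => (![Y, Z] i).At) p q)
      (pair (stdOrthonormalBasis ℂ (Y.space p) k) (stdOrthonormalBasis ℂ (Z.space q) l))

theorem bilinear_eq_sum {V W : Type*} [NormedAddCommGroup V] [InnerProductSpace ℂ V]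
    [FiniteDimensional ℂ V] [NormedAddCommGroup W] [InnerProductSpace ℂ W] [FiniteDimensional ℂ W]
    (B : V →ₗ[ℂ] W →ₗ[ℂ] ℂ) (s : V) (t : W) :
    B s t = ∑ k, ∑ l, B (stdOrthonormalBasis ℂ V k) (stdOrthonormalBasis ℂ W l) *
      (inner ℂ (stdOrthonormalBasis ℂ V k) s * inner ℂ (stdOrthonormalBasis ℂ W l) t) := by
  conv_lhs => rw [← (stdOrthonormalBasis ℂ V).sum_repr' s, ← (stdOrthonormalBasis ℂ W).sum_repr' t]
  simp only [map_sum, LinearMap.sum_apply, map_smul, LinearMap.smul_apply, smul_eq_mul,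
    Finset.mul_sum]
  rw [Finset.sum_comm]
  refine Finset.sum_congr rfl fun k _ => ?_
  refine Finset.sum_congr rfl fun l _ => ?_
  ring

theorem ofBil_apply {Y Z : QSet.{u, v}} {p : Y.At} {q : Z.At}
    (B : Y.space p →ₗ[ℂ] Z.space q →ₗ[ℂ] ℂ) (s : Y.space p) (t : Z.space q) :
    ofBil B (pair s t) = B s t := by
  rw [ofBil, bilinear_eq_sum B s t, sum_apply]
  refine Finset.sum_congr rfl fun k _ => ?_
  rw [sum_apply]
  refine Finset.sum_congr rfl fun l _ => ?_
  rw [smul_apply, simple_apply, smul_eq_mul, Fin.prod_univ_two]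
  rfl

theorem ofBil_mem_bil {Y Z : QSet.{u, v}} {R : Rel ![Y, Z]} {p : Y.At} {q : Z.At}
    {B : Y.space p →ₗ[ℂ] Z.space q →ₗ[ℂ] ℂ}
    (h : ofBil B ∈ R (pair (A := fun i => (![Y, Z] i).At) p q)) : B ∈ R.bil p q :=
  ⟨_, h, ofBil_apply B⟩

/-- The evaluation functional, as a bilinear functional. -/
def evalBil (p : Z.At) : Z.space p →ₗ[ℂ] StrongDual ℂ (Z.space p) →ₗ[ℂ] ℂ :=
  LinearMap.mk₂ ℂ (fun x η => η x) (fun x y η => map_add η x y) (fun c x η => map_smul η c x)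
    (fun _ _ _ => rfl) (fun _ _ _ => rfl)

theorem evalBil_apply (x : Z.space p) (η : StrongDual ℂ (Z.space p)) : evalBil p x η = η x := rfl

theorem mem_bil_eq_self {Z : QSet.{u, v}} {p : Z.At}
    {B : Z.space p →ₗ[ℂ] StrongDual ℂ (Z.space p) →ₗ[ℂ] ℂ} :
    B ∈ bil (Y := Z) (Z := Z.dual) (eq Z) p p ↔ ∃ c : ℂ, ∀ x η, B x η = c * η x := by
  constructor
  · rintro ⟨ξ, hξ, h⟩
    have : ∃ c : ℂ, ∀ (x : Z.space p) (η : StrongDual ℂ (Z.space p)),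
        ξ (pair x η) = c * η x := by
      clear h
      induction hξ using Submodule.span_induction with
      | mem ξ hξ =>
        obtain ⟨h, hξ⟩ := hξ
        exact ⟨1, fun x η => (hξ x η).trans (one_mul _).symm⟩
      | zero => exact ⟨0, fun x η => (zero_mul _).symm⟩
      | add ξ ζ _ _ h1 h2 =>
        obtain ⟨c, h1⟩ := h1
        obtain ⟨d, h2⟩ := h2
        exact ⟨c + d, fun x η => by rw [add_apply, h1, h2, add_mul]⟩
      | smul c ξ _ h1 =>
        obtain ⟨d, h1⟩ := h1
        exact ⟨c * d, fun x η => by rw [smul_apply, h1, smul_eq_mul, mul_assoc]⟩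
    obtain ⟨c, hc⟩ := this
    exact ⟨c, fun x η => (h x η).symm.trans (hc x η)⟩
  · rintro ⟨c, hc⟩
    have he : evalBil p ∈ bil (Y := Z) (Z := Z.dual) (eq Z) p p := ofBil_mem_bil
      (Submodule.subset_span ⟨rfl, fun x η => ofBil_apply (Z := Z.dual) (evalBil p) x η⟩)
    rw [show B = c • evalBil p from LinearMap.ext fun x => LinearMap.ext fun η => hc x η]
    exact Submodule.smul_mem _ c he

theorem eq_zero_of_mem_bil_eq {Z : QSet.{u, v}} {p q : Z.At} (hpq : p ≠ q)
    {B : Z.space p →ₗ[ℂ] StrongDual ℂ (Z.space q) →ₗ[ℂ] ℂ}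
    (hB : B ∈ bil (Y := Z) (Z := Z.dual) (eq Z) p q) : B = 0 := by
  obtain ⟨ξ, hξ, h⟩ := hB
  have hs : eq Z (pair (A := fun i => (![Z, Z.dual] i).At) p q) = ⊥ := by
    refine Submodule.span_eq_bot.2 ?_
    rintro f ⟨h, -⟩
    exact absurd h hpq
  rw [hs] at hξ
  obtain rfl := (Submodule.mem_bot ℂ).1 hξ
  exact LinearMap.ext fun x => LinearMap.ext fun η => (h x η).symm

end Rel

namespace BinRel
open QSet.Rel

variable {X Y : QSet.{u, v}} {F : BinRel X Y} {p : X.At} {q : Y.At}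

/-- The generating set is already a subspace; since the adjoint is conjugate linear, a scalar `c` on
adjoints corresponds to its conjugate on `F`. -/
theorem mem_dagger {g : Y.space q →L[ℂ] X.space p} :
    g ∈ F.dagger q p ↔ ∃ f ∈ F p q, g = ContinuousLinearMap.adjoint f := by
  constructor
  · intro h
    induction h using Submodule.span_induction with
    | mem g hg => exact hg
    | zero => exact ⟨0, Submodule.zero_mem _, (map_zero _).symm⟩
    | add g g' _ _ h1 h2 =>
      obtain ⟨f, hf, rfl⟩ := h1
      obtain ⟨f', hf', rfl⟩ := h2
      exact ⟨f + f', Submodule.add_mem _ hf hf', (map_add _ _ _).symm⟩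
    | smul c g _ h1 =>
      obtain ⟨f, hf, rfl⟩ := h1
      refine ⟨starRingEnd ℂ c • f, Submodule.smul_mem _ _ hf, ?_⟩
      rw [map_smulₛₗ, Complex.conj_conj]
  · exact fun h => Submodule.subset_span h

theorem mem_conjugate {g : StrongDual ℂ (X.space p) →L[ℂ] StrongDual ℂ (Y.space q)} :
    g ∈ F.conjugate p q ↔ ∃ f ∈ F p q, ∀ ξ : StrongDual ℂ (X.space p),
      g ξ = ξ ∘L ContinuousLinearMap.adjoint f := by
  constructor
  · intro h
    induction h using Submodule.span_induction with
    | mem g hg => exact hg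
    | zero =>
      refine ⟨0, Submodule.zero_mem _, fun ξ => ?_⟩
      rw [map_zero, ContinuousLinearMap.comp_zero]
      rfl
    | add g g' _ _ h1 h2 =>
      obtain ⟨f, hf, h1⟩ := h1
      obtain ⟨f', hf', h2⟩ := h2
      refine ⟨f + f', Submodule.add_mem _ hf hf', fun ξ => ?_⟩
      rw [map_add, ContinuousLinearMap.comp_add, ← h1, ← h2]
      rfl
    | smul c g _ h1 =>
      obtain ⟨f, hf, h1⟩ := h1
      refine ⟨starRingEnd ℂ c • f, Submodule.smul_mem _ _ hf, fun ξ => ?_⟩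
      rw [map_smulₛₗ, Complex.conj_conj, ContinuousLinearMap.comp_smul, ← h1]
      rfl
  · exact fun h => Submodule.subset_span h

theorem mem_bil_bend {B : X.space p →ₗ[ℂ] StrongDual ℂ (Y.space q) →ₗ[ℂ] ℂ} :
    B ∈ bil (Y := X) (Z := Y.dual) F.bend p q ↔ ∃ f ∈ F p q, ∀ x η, B x η = η (f x) := by
  constructor
  · rintro ⟨ξ, hξ, h⟩
    have : ∃ f ∈ F p q, ∀ (x : X.space p) (η : StrongDual ℂ (Y.space q)),
        ξ (pair x η) = η (f x) := by
      clear h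
      induction hξ using Submodule.span_induction with
      | mem ξ hξ => exact hξ
      | zero => exact ⟨0, Submodule.zero_mem _, fun x η => (map_zero η).symm⟩
      | add ξ ζ _ _ h1 h2 =>
        obtain ⟨f, hf, h1⟩ := h1
        obtain ⟨g, hg, h2⟩ := h2
        exact ⟨f + g, Submodule.add_mem _ hf hg, fun x η => by
          rw [add_apply, h1, h2]; exact (map_add η _ _).symm⟩
      | smul c ξ _ h1 =>
        obtain ⟨f, hf, h1⟩ := h1
        exact ⟨c • f, Submodule.smul_mem _ c hf, fun x η => by
          rw [smul_apply, h1]; exact (map_smul η _ _).symm⟩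
    obtain ⟨f, hf, hξ⟩ := this
    exact ⟨f, hf, fun x η => (h x η).symm.trans (hξ x η)⟩
  · rintro ⟨f, hf, h⟩
    exact ofBil_mem_bil (Submodule.subset_span ⟨f, hf, fun x η =>
      (ofBil_apply (Z := Y.dual) B x η).trans (h x η)⟩)

/-- The conjugate of `⟪y, f u⟫` is `⟪f u, y⟫ = ⟪u, f† y⟫`, which is the functional `⟨u|` at `f† y`.
-/
theorem mem_bil_bend_conjugate {B : StrongDual ℂ (X.space p) →ₗ[ℂ] Y.space q →ₗ[ℂ] ℂ} :
    B ∈ bil (Y := X.dual) (Z := Y) F.bend.conjugate p q ↔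
      ∃ f ∈ F p q, ∀ ξ y, B ξ y = ξ (ContinuousLinearMap.adjoint f y) := by
  have key (ζ : Form (X := ![X, Y.dual]) (pair (A := fun i => (![X, Y.dual] i).At) p q))
      (f : X.space p →L[ℂ] Y.space q) (ξ : StrongDual ℂ (X.space p)) (y : Y.space q)
      (h : ∀ (x : X.space p) (η : StrongDual ℂ (Y.space q)), ζ (pair x η) = η (f x)) :
      starRingEnd ℂ (ζ (pair ((InnerProductSpace.toDual ℂ (X.space p)).symm ξ)
        (InnerProductSpace.toDual ℂ (Y.space q) y))) = ξ (ContinuousLinearMap.adjoint f y) := by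
    rw [h, InnerProductSpace.toDual_apply_apply, inner_conj_symm,
      ← ContinuousLinearMap.adjoint_inner_right, InnerProductSpace.toDual_symm_apply]
  constructor
  · rintro ⟨g, hg, h⟩
    have : ∃ f ∈ F p q, ∀ (ξ : StrongDual ℂ (X.space p)) (y : Y.space q),
        g (pair ξ y) = ξ (ContinuousLinearMap.adjoint f y) := by
      clear h
      induction hg using Submodule.span_induction with
      | mem g hg =>
        obtain ⟨ζ, hζ, h⟩ := hg
        obtain ⟨f, hf, hζ⟩ := mem_bil_bend.1 ⟨ζ, hζ, fun _ _ => (toBil_apply ζ _ _).symm⟩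
        refine ⟨f, hf, fun ξ y => ?_⟩
        rw [← key ζ f ξ y hζ]
        refine Eq.trans ?_ (h _ y)
        exact congrArg (fun v => g (pair v y))
          ((InnerProductSpace.toDual ℂ (X.space p)).apply_symm_apply ξ).symm
      | zero =>
        refine ⟨0, Submodule.zero_mem _, fun ξ y => ?_⟩
        rw [map_zero]
        exact (map_zero ξ).symm
      | add g g' _ _ h1 h2 =>
        obtain ⟨f, hf, h1⟩ := h1
        obtain ⟨f', hf', h2⟩ := h2
        refine ⟨f + f', Submodule.add_mem _ hf hf', fun ξ y => ?_⟩
        rw [add_apply, h1, h2, map_add]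
        exact (map_add ξ _ _).symm
      | smul c g _ h1 =>
        obtain ⟨f, hf, h1⟩ := h1
        refine ⟨starRingEnd ℂ c • f, Submodule.smul_mem _ _ hf, fun ξ y => ?_⟩
        rw [smul_apply, h1, map_smulₛₗ, Complex.conj_conj]
        exact (map_smul ξ _ _).symm
    obtain ⟨f, hf, hg⟩ := this
    exact ⟨f, hf, fun x η => (h x η).symm.trans (hg x η)⟩
  · rintro ⟨f, hf, h⟩
    let C : X.space p →ₗ[ℂ] StrongDual ℂ (Y.space q) →ₗ[ℂ] ℂ :=
      LinearMap.mk₂ ℂ (fun x η => η (f x)) (fun x y η => by rw [map_add, map_add])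
        (fun c x η => by rw [map_smul, map_smul]) (fun _ _ _ => rfl) (fun _ _ _ => rfl)
    obtain ⟨ζ, hζ, hC⟩ := (mem_bil_bend (F := F) (B := C)).2 ⟨f, hf, fun _ _ => rfl⟩
    refine ofBil_mem_bil (Submodule.subset_span ⟨ζ, hζ,
      fun (x : X.space p) (y : Y.space q) => ?_⟩)
    refine (ofBil_apply (Y := X.dual) B _ _).trans ((h _ _).trans ?_)
    have := key ζ f (InnerProductSpace.toDual ℂ (X.space p) x) y hC
    rw [LinearIsometryEquiv.symm_apply_apply] at this
    exact this.symm

end BinRel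

end QSet

/-! ### Interpretation of the diagonal quantifiers -/

namespace QSet
attribute [local instance] dualInnerProductSpace

namespace Formula
open QSet.Rel

section Diagonal

variable {n : ℕ} {X : Fin n → QSet.{u, v}} {Z : QSet.{u, v}} {a : ∀ i, (X i).At}

/-- The atomic formula `E_Z(z, z_*)` for the first two variables. -/
abbrev eqFormula (Z : QSet.{u, v}) (X : Fin n → QSet.{u, v}) :
    Formula (Fin.cons Z (Fin.cons Z.dual X : Fin (n + 1) → QSet.{u, v}) :
      Fin (n + 2) → QSet.{u, v}) :=
  atom₂ (Rel.eq Z) 0 1 Fin.zero_ne_one rfl rfl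

theorem mem_eqFormula {p q : Z.At}
    {f : Form (consAt (Z := Z) p (consAt (Z := Z.dual) q a))} :
    f ∈ (eqFormula Z X).interp (consAt p (consAt (Z := Z.dual) q a)) ↔
      ∀ y : ∀ i, (X i).space (a i), ∃ B ∈ bil (Y := Z) (Z := Z.dual) (Rel.eq Z) p q,
        ∀ (x : Z.space p) (η : StrongDual ℂ (Z.space q)),
          f (consVec x (consVec (Z := Z.dual) (z := q) η y)) = B x η := by
  refine (mem_interp_atom₂ (X := (Fin.cons Z (Fin.cons Z.dual X : Fin (n + 1) → QSet.{u, v}) :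
      Fin (n + 2) → QSet.{u, v})) (i := 0) (j := 1) (Rel.eq Z) Fin.zero_ne_one).trans ?_
  constructor
  · intro h y
    obtain ⟨B, hB, h⟩ := h (consVec 0 (consVec (Z := Z.dual) (z := q) 0 y))
    refine ⟨B, hB, fun x η => h _ fun k => ?_⟩
    refine Fin.cases (fun h => absurd rfl h) (Fin.cases (fun _ h => absurd rfl h) ?_) k
    exact fun _ _ _ => rfl
  · intro h x
    obtain ⟨B, hB, h⟩ := h fun k => x k.succ.succ
    refine ⟨B, hB, fun x' hx' => ?_⟩
    rw [show x' = consVec (x' 0) (consVec (Z := Z.dual) (z := q) (x' 1) fun k => x k.succ.succ) from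
      funext fun k => Fin.cases rfl (fun k => Fin.cases rfl (fun k => hx' _ (by
        simp) (by
        rw [Ne, ← Fin.succ_zero_eq_one, Fin.succ_inj]
        exact Fin.succ_ne_zero k)) k) k]
    exact h _ _

/-- For every value of the other variables `f` is a multiple of evaluation. Contracting multiplies
the coefficient by the dimension of the atom, which is nonzero, so `ζ` is the contraction of `f`
divided by the dimension. -/
theorem mem_eqFormula_self {p : Z.At}
    {f : Form (consAt (Z := Z) p (consAt (Z := Z.dual) p a))} :
    f ∈ (eqFormula Z X).interp (consAt p (consAt (Z := Z.dual) p a)) ↔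
      ∃ ζ : Form a, f = evalProd p ζ := by
  rw [mem_eqFormula]
  constructor
  · intro h
    have hd : (Module.finrank ℂ (Z.space p) : ℂ) ≠ 0 :=
      Nat.cast_ne_zero.2 Module.finrank_pos.ne'
    refine ⟨(Module.finrank ℂ (Z.space p) : ℂ)⁻¹ • contract f, form_ext fun x w => ?_⟩
    obtain ⟨η, y, rfl⟩ := exists_consVec w
    obtain ⟨B, hB, h⟩ := h y
    obtain ⟨c, hc⟩ := mem_bil_eq_self.1 hB
    rw [h, hc, evalProd_apply, smul_apply, contract_apply]
    simp only [h, hc, InnerProductSpace.toDual_apply_apply, inner_self_eq_norm_sq_to_K,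
      OrthonormalBasis.norm_eq_one]
    simp only [RCLike.ofReal_one, one_pow, mul_one, Finset.sum_const, Finset.card_univ,
      Fintype.card_fin, nsmul_eq_mul, smul_eq_mul]
    field_simp
  · rintro ⟨ζ, rfl⟩ y
    refine ⟨ζ y • evalBil p, mem_bil_eq_self.2 ⟨ζ y, fun _ _ => rfl⟩, fun x η => ?_⟩
    rw [evalProd_apply, mul_comm]
    rfl

theorem eq_zero_of_mem_eqFormula {p q : Z.At} (hpq : p ≠ q)
    {f : Form (consAt (Z := Z) p (consAt (Z := Z.dual) q a))}
    (hf : f ∈ (eqFormula Z X).interp (consAt p (consAt (Z := Z.dual) q a))) : f = 0 := by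
  refine form_ext fun x w => ?_
  obtain ⟨η, y, rfl⟩ := exists_consVec w
  obtain ⟨B, hB, h⟩ := mem_eqFormula.1 hf y
  rw [h, eq_zero_of_mem_bil_eq hpq hB]
  rfl

theorem contract_evalProd {p : Z.At} (ζ : Form a) :
    contract (evalProd p ζ) = (Module.finrank ℂ (Z.space p) : ℂ) • ζ := by
  ext y
  rw [contract_apply, smul_apply]
  simp only [evalProd_apply, InnerProductSpace.toDual_apply_apply, inner_self_eq_norm_sq_to_K,
    OrthonormalBasis.norm_eq_one]
  simp

variable {φ : Formula (Fin.cons Z (Fin.cons Z.dual X : Fin (n + 1) → QSet.{u, v}) :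
  Fin (n + 2) → QSet.{u, v})}

/-- Modus ponens applied to `e ⊗ ξ`, which lies in the equality relation, gives one direction. For
the other, a functional in the equality relation is `e ⊗ ζ`; orthogonality to `e ⊗ ξ` means that `ζ`
is orthogonal to `ξ`, and then `e ⊗ ζ` is orthogonal to every `⟨v| ⊗ ⟨w| ⊗ ξ`. -/
theorem mem_interp_allDiag {ξ : Form a} :
    ξ ∈ (allDiag Z φ).interp a ↔
      ∀ p : Z.At, evalProd p ξ ∈ φ.interp (consAt p (consAt (Z := Z.dual) p a)) := by
  constructor
  · intro h p
    refine mem_of_mem_imp (mem_eqFormula_self.2 ⟨ξ, rfl⟩) ?_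
    rw [evalProd]
    exact Submodule.sum_mem _ fun i _ => mem_interp_all.1 (mem_interp_all.1 h p _) p _
  · intro h
    refine mem_interp_all.2 fun q w => mem_interp_all.2 fun p v => mem_interp_imp.2 ?_
    intro f hf hg
    rw [ip_eq_zero_comm, ip_consProd]
    refine (ip_consProd (Z := Z.dual) w ξ _).trans ?_
    by_cases hpq : p = q
    · subst hpq
      obtain ⟨ζ, rfl⟩ := mem_eqFormula_self.1 hf
      -- The squared norm of `e` is the dimension of the atom, which can be cancelled.
      have h0 := hg _ (mem_eqFormula_self.2 ⟨ξ, rfl⟩) (h p)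
      rw [ip_evalProd, contract_evalProd, ip_smul_right] at h0
      have h1 := (mul_eq_zero.1 h0).resolve_left
        (Nat.cast_ne_zero.2 (Module.finrank_pos (R := ℂ) (M := Z.space p)).ne')
      have : slice (Z := Z.dual) (slice (evalProd p ζ) v) w = (w v) • ζ := by
        ext y
        exact evalProd_apply ζ v w y
      rw [this, ip_smul_right, h1, mul_zero]
    · rw [eq_zero_of_mem_eqFormula hpq hf]
      exact ip_zero_right ξ

/-- Contraction is adjoint to `ξ ↦ e ⊗ ξ`, so the `ξ` with `e ⊗ ξ` always in `¬φ` are those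
orthogonal to all contractions of `φ`. The orthocomplement of these is the span of the contractions,
described here by its upper bounds `T`. -/
theorem interp_exDiag_le_iff {T : Submodule ℂ (Form a)} :
    (exDiag Z φ).interp a ≤ T ↔ ∀ p : Z.At,
      ∀ f ∈ φ.interp (consAt p (consAt (Z := Z.dual) p a)), contract f ∈ T := by
  constructor
  · intro h p f hf
    refine h (mem_interp_neg.2 fun ξ hξ => ?_)
    rw [← ip_evalProd, ip_eq_zero_comm]
    exact mem_interp_neg.1 (mem_interp_allDiag.1 hξ p) f hf
  · intro h f hf
    obtain ⟨g, hg, hfg⟩ := exists_orthogonal_decomposition T f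
    have : f - g ∈ (allDiag Z (neg φ)).interp a := by
      refine mem_interp_allDiag.2 fun p => mem_interp_neg.2 fun w hw => ?_
      rw [ip_eq_zero_comm, ip_evalProd, ip_eq_zero_comm]
      exact hfg _ (h p w hw)
    have h1 := mem_interp_neg.1 hf _ this
    have h2 : ip (f - g) (f - g) = 0 := by
      rw [ip_sub_right, h1, ip_eq_zero_comm.1 (hfg g hg), sub_zero]
    rw [sub_eq_zero.1 (ip_self_eq_zero.1 h2)]
    exact hg

end Diagonal

/-! ### Products of three binary functionals -/

section Triple

variable {n : ℕ} {X : Fin n → QSet.{u, v}} {a : ∀ i, (X i).At} {i₁ j₁ i₂ j₂ i₃ j₃ : Fin n}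

theorem exists_prod_form (hnd : [i₁, j₁, i₂, j₂, i₃, j₃].Nodup)
    (hcov : ∀ k, k ∈ [i₁, j₁, i₂, j₂, i₃, j₃])
    (B₁ : (X i₁).space (a i₁) →ₗ[ℂ] (X j₁).space (a j₁) →ₗ[ℂ] ℂ)
    (B₂ : (X i₂).space (a i₂) →ₗ[ℂ] (X j₂).space (a j₂) →ₗ[ℂ] ℂ)
    (B₃ : (X i₃).space (a i₃) →ₗ[ℂ] (X j₃).space (a j₃) →ₗ[ℂ] ℂ) :
    ∃ f : Form a, ∀ x, f x = B₁ (x i₁) (x j₁) * B₂ (x i₂) (x j₂) * B₃ (x i₃) (x j₃) := by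
  simp only [List.nodup_cons, List.mem_cons, List.not_mem_nil, or_false, not_or,
    List.nodup_nil, and_true, not_false_eq_true] at hnd
  simp only [List.mem_cons, List.not_mem_nil, or_false] at hcov
  obtain ⟨⟨h1, h2, h3, h4, h5⟩, ⟨h6, h7, h8, h9⟩, ⟨h10, h11, h12⟩, ⟨h13, h14⟩, h15⟩ := hnd
  refine ⟨⟨fun x => B₁ (x i₁) (x j₁) * B₂ (x i₂) (x j₂) * B₃ (x i₃) (x j₃), ?_, ?_⟩, fun _ => rfl⟩
  · intro _ m k x y
    rcases hcov k with rfl | rfl | rfl | rfl | rfl | rfl <;>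
      simp [Function.update_of_ne, *, Ne.symm] <;> ring
  · intro _ m k c x
    rcases hcov k with rfl | rfl | rfl | rfl | rfl | rfl <;>
      simp [Function.update_of_ne, *, Ne.symm] <;> ring

theorem exists_projection {V : Type*} [AddCommGroup V] [Module ℂ V] (R : Submodule ℂ V) :
    ∃ π : V →ₗ[ℂ] V, (∀ v, π v ∈ R) ∧ ∀ v ∈ R, π v = v := by
  obtain ⟨π, hπ⟩ := R.subtype.exists_leftInverse_of_injective R.ker_subtype
  exact ⟨R.subtype ∘ₗ π, fun v => (π v).2,
    fun v hv => congrArg Subtype.val (LinearMap.congr_fun hπ ⟨v, hv⟩)⟩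

/-- Expand `B` in products of basis functionals and apply a projection onto `R`: it fixes `B` and
moves the products into `R` without changing the coefficients, which are values of `B`. -/
theorem exists_spanning_family {V W : Type*} [NormedAddCommGroup V] [InnerProductSpace ℂ V]
    [FiniteDimensional ℂ V] [NormedAddCommGroup W] [InnerProductSpace ℂ W] [FiniteDimensional ℂ W]
    (R : Submodule ℂ (V →ₗ[ℂ] W →ₗ[ℂ] ℂ)) :
    ∃ β : Fin (Module.finrank ℂ V) × Fin (Module.finrank ℂ W) → V →ₗ[ℂ] W →ₗ[ℂ] ℂ,
      (∀ k, β k ∈ R) ∧ ∀ B ∈ R,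
        B = ∑ k, B (stdOrthonormalBasis ℂ V k.1) (stdOrthonormalBasis ℂ W k.2) • β k := by
  obtain ⟨π, hπR, hπ⟩ := exists_projection R
  let b (k : Fin (Module.finrank ℂ V) × Fin (Module.finrank ℂ W)) : V →ₗ[ℂ] W →ₗ[ℂ] ℂ :=
    (innerSL ℂ (stdOrthonormalBasis ℂ V k.1) : V →L[ℂ] ℂ).toLinearMap.smulRight
      (innerSL ℂ (stdOrthonormalBasis ℂ W k.2) : W →L[ℂ] ℂ).toLinearMap
  refine ⟨fun k => π (b k), fun k => hπR _, fun B hB => ?_⟩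
  have h : B = ∑ k, B (stdOrthonormalBasis ℂ V k.1) (stdOrthonormalBasis ℂ W k.2) • b k := by
    ext s t
    rw [bilinear_eq_sum, LinearMap.sum_apply, LinearMap.sum_apply, Fintype.sum_prod_type]
    rfl
  conv_lhs => rw [← hπ B hB, h, map_sum]
  exact Finset.sum_congr rfl fun k _ => map_smul _ _ _

/-- The vector `x` with two of its entries replaced by elements of the standard bases. -/
def put (i j : Fin n) (k : Fin (Module.finrank ℂ ((X i).space (a i))) ×
    Fin (Module.finrank ℂ ((X j).space (a j)))) (x : ∀ i, (X i).space (a i)) :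
    ∀ i, (X i).space (a i) :=
  Function.update (Function.update x i (stdOrthonormalBasis ℂ _ k.1)) j
    (stdOrthonormalBasis ℂ _ k.2)

theorem put_of_ne {i j l : Fin n} (hi : l ≠ i) (hj : l ≠ j)
    (k : Fin (Module.finrank ℂ ((X i).space (a i))) ×
    Fin (Module.finrank ℂ ((X j).space (a j)))) (x : ∀ i, (X i).space (a i)) :
    put i j k x l = x l := by
  rw [put, Function.update_of_ne hj, Function.update_of_ne hi]

theorem put_congr {i j l : Fin n} (k : Fin (Module.finrank ℂ ((X i).space (a i))) ×
    Fin (Module.finrank ℂ ((X j).space (a j)))) {x y : ∀ i, (X i).space (a i)}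
    (h : l ≠ i → l ≠ j → x l = y l) : put i j k x l = put i j k y l := by
  by_cases hj : l = j
  · subst hj
    rw [put, put, Function.update_self, Function.update_self]
  by_cases hi : l = i
  · subst hi
    rw [put, put, Function.update_of_ne hj, Function.update_of_ne hj, Function.update_self,
      Function.update_self]
  · rw [put_of_ne hi hj, put_of_ne hi hj, h hi hj]

theorem exists_expansion {i j : Fin n} (R : Rel ![X i, X j]) (hij : i ≠ j) (a : ∀ i, (X i).At) :
    ∃ β : Fin (Module.finrank ℂ ((X i).space (a i))) × Fin (Module.finrank ℂ ((X j).space (a j))) →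
        (X i).space (a i) →ₗ[ℂ] (X j).space (a j) →ₗ[ℂ] ℂ,
      (∀ k, β k ∈ R.bil (a i) (a j)) ∧ ∀ f ∈ (atom₂ R i j hij rfl rfl).interp a,
        ∀ x, f x = ∑ k, f (put i j k x) * β k (x i) (x j) := by
  obtain ⟨β, hβ, h⟩ := exists_spanning_family (R.bil (a i) (a j))
  refine ⟨β, hβ, fun f hf x => ?_⟩
  obtain ⟨B, hB, hf⟩ := (mem_interp_atom₂ R hij).1 hf x
  rw [hf x fun _ _ _ => rfl]
  conv_lhs => rw [h B hB]
  simp only [LinearMap.sum_apply, LinearMap.smul_apply, smul_eq_mul]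
  refine Finset.sum_congr rfl fun k _ => ?_
  rw [hf (put i j k x) fun l hi hj => put_of_ne hi hj k x]
  congr 2
  · rw [put, Function.update_of_ne hij, Function.update_self]
  · rw [put, Function.update_self]

theorem mem_interp_atom₂_of_forall {i j : Fin n} {R : Rel ![X i, X j]} {hij : i ≠ j} {f : Form a}
    {B : (X i).space (a i) →ₗ[ℂ] (X j).space (a j) →ₗ[ℂ] ℂ} (hB : B ∈ R.bil (a i) (a j))
    {c : (∀ k, (X k).space (a k)) → ℂ} (hf : ∀ x, f x = B (x i) (x j) * c x)
    (hc : ∀ x y, (∀ k, k ≠ i → k ≠ j → x k = y k) → c x = c y) :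
    f ∈ (atom₂ R i j hij rfl rfl).interp a := by
  refine (mem_interp_atom₂ R hij).2 fun x => ⟨c x • B, Submodule.smul_mem _ _ hB, fun y hy => ?_⟩
  rw [hf, hc y x hy, mul_comm]
  rfl

/-- For atoms in disjoint pairs of variables that exhaust the context, the intersection of the three
cylinders is the tensor product of the relations: expanding `f` in one pair after the other yields a
combination of products with every factor in its relation. -/
theorem interp_conj_atoms_le_iff (hnd : [i₁, j₁, i₂, j₂, i₃, j₃].Nodup)
    (hcov : ∀ k, k ∈ [i₁, j₁, i₂, j₂, i₃, j₃]) {h₁ : i₁ ≠ j₁} {h₂ : i₂ ≠ j₂} {h₃ : i₃ ≠ j₃}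
    {R₁ : Rel ![X i₁, X j₁]} {R₂ : Rel ![X i₂, X j₂]} {R₃ : Rel ![X i₃, X j₃]}
    {T : Submodule ℂ (Form a)} :
    (conj (conj (atom₂ R₁ i₁ j₁ h₁ rfl rfl) (atom₂ R₂ i₂ j₂ h₂ rfl rfl))
      (atom₂ R₃ i₃ j₃ h₃ rfl rfl)).interp a ≤ T ↔
    ∀ B₁ ∈ R₁.bil (a i₁) (a j₁), ∀ B₂ ∈ R₂.bil (a i₂) (a j₂), ∀ B₃ ∈ R₃.bil (a i₃) (a j₃),
      ∀ f : Form a, (∀ x, f x = B₁ (x i₁) (x j₁) * B₂ (x i₂) (x j₂) * B₃ (x i₃) (x j₃)) → f ∈ T := by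
  have hnd' := hnd
  have hcov' := hcov
  simp only [List.nodup_cons, List.mem_cons, List.not_mem_nil, or_false, not_or,
    List.nodup_nil, and_true, not_false_eq_true] at hnd'
  simp only [List.mem_cons, List.not_mem_nil, or_false] at hcov'
  obtain ⟨⟨-, h12, h12', h13, h13'⟩, ⟨h21, h21', h22, h22'⟩, ⟨-, h31, h31'⟩, ⟨h41, h41'⟩, -⟩ := hnd'
  constructor
  · intro h B₁ hB₁ B₂ hB₂ B₃ hB₃ f hf
    refine h ⟨⟨?_, ?_⟩, ?_⟩
    · refine mem_interp_atom₂_of_forall hB₁ (c := fun x => B₂ (x i₂) (x j₂) * B₃ (x i₃) (x j₃))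
        (fun x => by rw [hf, mul_assoc]) fun x y hxy => ?_
      simp only [hxy i₂ (Ne.symm h12) (Ne.symm h21), hxy j₂ (Ne.symm h12') (Ne.symm h21'),
        hxy i₃ (Ne.symm h13) (Ne.symm h22), hxy j₃ (Ne.symm h13') (Ne.symm h22')]
    · refine mem_interp_atom₂_of_forall hB₂ (c := fun x => B₁ (x i₁) (x j₁) * B₃ (x i₃) (x j₃))
        (fun x => by rw [hf]; ring) fun x y hxy => ?_
      simp only [hxy i₁ h12 h12', hxy j₁ h21 h21', hxy i₃ (Ne.symm h31) (Ne.symm h41),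
        hxy j₃ (Ne.symm h31') (Ne.symm h41')]
    · refine mem_interp_atom₂_of_forall hB₃ (c := fun x => B₁ (x i₁) (x j₁) * B₂ (x i₂) (x j₂))
        (fun x => by rw [hf]; ring) fun x y hxy => ?_
      simp only [hxy i₁ h13 h13', hxy j₁ h22 h22', hxy i₂ h31 h31', hxy j₂ h41 h41']
  · rintro h f ⟨⟨hf₁, hf₂⟩, hf₃⟩
    obtain ⟨β₁, hβ₁, e₁⟩ := exists_expansion R₁ h₁ a
    obtain ⟨β₂, hβ₂, e₂⟩ := exists_expansion R₂ h₂ a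
    obtain ⟨β₃, hβ₃, e₃⟩ := exists_expansion R₃ h₃ a
    choose P hP using fun k l m => exists_prod_form (a := a) hnd hcov (β₁ k) (β₂ l) (β₃ m)
    -- After the three replacements every entry is a basis vector, so the coefficient does not
    -- depend on the initial vector, which may be taken as `0`.
    have key : f = ∑ k, ∑ l, ∑ m, f (put i₃ j₃ m (put i₂ j₂ l (put i₁ j₁ k 0))) • P k l m := by
      ext x
      simp only [sum_apply, smul_apply, smul_eq_mul]
      rw [e₁ f hf₁]
      refine Finset.sum_congr rfl fun k _ => ?_
      rw [e₂ f hf₂, Finset.sum_mul]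
      refine Finset.sum_congr rfl fun l _ => ?_
      rw [e₃ f hf₃, Finset.sum_mul, Finset.sum_mul]
      refine Finset.sum_congr rfl fun m _ => ?_
      rw [hP, put_of_ne (Ne.symm h12) (Ne.symm h21), put_of_ne (Ne.symm h12') (Ne.symm h21'),
        put_of_ne (Ne.symm h31) (Ne.symm h41), put_of_ne (Ne.symm h31') (Ne.symm h41'),
        put_of_ne (Ne.symm h13) (Ne.symm h22), put_of_ne (Ne.symm h13') (Ne.symm h22'),
        show put i₃ j₃ m (put i₂ j₂ l (put i₁ j₁ k x)) =
          put i₃ j₃ m (put i₂ j₂ l (put i₁ j₁ k 0)) from funext fun r =>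
            put_congr m fun hi₃ hj₃ => put_congr l fun hi₂ hj₂ => put_congr k fun hi₁ hj₁ => by
              rcases hcov' r with rfl | rfl | rfl | rfl | rfl | rfl <;> contradiction]
      ring
    rw [key]
    exact Submodule.sum_mem _ fun k _ => Submodule.sum_mem _ fun l _ => Submodule.sum_mem _ fun m _ =>
      Submodule.smul_mem _ _ (h _ (hβ₁ k) _ (hβ₂ l) _ (hβ₃ m) _ (hP k l m))

end Triple

end Formula
end QSet

namespace QSet
attribute [local instance] dualInnerProductSpace

/-! ### Membership in the identity and in composites -/

namespace BinRel

variable {X Y : QSet.{u, v}} {F : BinRel X Y}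

theorem mem_id_self {p : X.At} {f : X.space p →L[ℂ] X.space p} :
    f ∈ id X p p ↔ ∃ c : ℂ, f = c • (1 : X.space p →L[ℂ] X.space p) := by
  have : {f : X.space p →L[ℂ] X.space p | ∃ h : p = p, ∀ x, f x = h ▸ x} = {1} :=
    Set.ext fun f => ⟨fun ⟨_, h⟩ => ContinuousLinearMap.ext h, fun h => ⟨rfl, fun x => by
      rw [Set.mem_singleton_iff.1 h]; rfl⟩⟩
  rw [id, this, Submodule.mem_span_singleton]
  exact exists_congr fun c => eq_comm

theorem mem_id_of_ne {p q : X.At} (hpq : p ≠ q) {f : X.space p →L[ℂ] X.space q} :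
    f ∈ id X p q ↔ f = 0 := by
  have : {f : X.space p →L[ℂ] X.space q | ∃ h : p = q, ∀ x, f x = h ▸ x} = ∅ :=
    Set.eq_empty_of_forall_notMem fun f ⟨h, _⟩ => hpq h
  rw [id, this, Submodule.span_empty, Submodule.mem_bot]

theorem eq_zero_of_forall_dual {E : Type*} [NormedAddCommGroup E] [InnerProductSpace ℂ E]
    {x : E} (h : ∀ η : StrongDual ℂ E, η x = 0) : x = 0 :=
  inner_self_eq_zero.1 (h (innerSL ℂ x))

/-- Bending matches the identity relation with the equality relation: scalars correspond to
multiples of evaluation, and both vanish off the diagonal. -/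
theorem mem_id_iff_bil {p q : X.At} {f : X.space p →L[ℂ] X.space q} :
    f ∈ id X p q ↔ ∃ B ∈ Rel.bil (Y := X) (Z := X.dual) (Rel.eq X) p q,
      ∀ (x : X.space p) (ξ : StrongDual ℂ (X.space q)), B x ξ = ξ (f x) := by
  by_cases hpq : p = q
  · subst hpq
    rw [mem_id_self]
    constructor
    · rintro ⟨c, rfl⟩
      refine ⟨c • Rel.evalBil p, Rel.mem_bil_eq_self.2 ⟨c, fun _ _ => rfl⟩, fun x ξ => ?_⟩
      exact (map_smul ξ c x).symm
    · rintro ⟨B, hB, h⟩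
      obtain ⟨c, hc⟩ := Rel.mem_bil_eq_self.1 hB
      refine ⟨c, ContinuousLinearMap.ext fun x => sub_eq_zero.1 (eq_zero_of_forall_dual fun ξ => ?_)⟩
      rw [map_sub, ← h, hc, sub_eq_zero]
      exact (map_smul ξ c x).symm
  · rw [mem_id_of_ne hpq]
    constructor
    · rintro rfl
      exact ⟨0, Submodule.zero_mem _, fun x ξ => (map_zero ξ).symm⟩
    · rintro ⟨B, hB, h⟩
      refine ContinuousLinearMap.ext fun x => eq_zero_of_forall_dual fun ξ => ?_
      rw [← h, Rel.eq_zero_of_mem_bil_eq hpq hB]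
      rfl

theorem dagger_comp_le_id_iff : comp F.dagger F ≤ id X ↔ ∀ p q b, ∀ f ∈ F p b, ∀ g ∈ F q b,
    ContinuousLinearMap.adjoint g ∘L f ∈ id X p q := by
  constructor
  · exact fun h p q b f hf g hg =>
      h p q (Submodule.subset_span ⟨b, _, mem_dagger.2 ⟨g, hg, rfl⟩, f, hf, rfl⟩)
  · refine fun h p q => Submodule.span_le.2 ?_
    rintro _ ⟨b, _, hg', f, hf, rfl⟩
    obtain ⟨g, hg, rfl⟩ := mem_dagger.1 hg'
    exact h p q b f hf g hg

theorem comp_dagger_le_id_iff : comp F F.dagger ≤ id Y ↔ ∀ p b c, ∀ f ∈ F p c, ∀ g ∈ F p b,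
    f ∘L ContinuousLinearMap.adjoint g ∈ id Y b c := by
  constructor
  · exact fun h p b c f hf g hg =>
      h b c (Submodule.subset_span ⟨p, f, hf, _, mem_dagger.2 ⟨g, hg, rfl⟩, rfl⟩)
  · refine fun h b c => Submodule.span_le.2 ?_
    rintro _ ⟨p, f, hf, _, hg', rfl⟩
    obtain ⟨g, hg, rfl⟩ := mem_dagger.1 hg'
    exact h p b c f hf g hg

end BinRel

/-! ### The sentences -/

namespace Formula
open QSet.Rel

/-- Truth says that `(∀ y) ¬φ` is zero. By Riesz, a functional in the one remaining variable is
`⟨x|`, and it lies in `(∀ y) ¬φ` exactly when every `g ∈ φ` vanishes at `(y, x)` for all `y`. -/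
theorem isTrue_all_ex_iff {X : Fin 0 → QSet.{u, v}} {Z Z' : QSet.{u, v}}
    {φ : Formula (Fin.cons Z' (Fin.cons Z X : Fin 1 → QSet.{u, v}) : Fin 2 → QSet.{u, v})} :
    (all Z (ex Z' φ)).IsTrue ↔ ∀ (p : Z.At) (x : Z.space p),
      (∀ (q : Z'.At) (y : Z'.space q),
        ∀ g ∈ φ.interp (consAt q (consAt p (finZeroElim : ∀ i, (X i).At))),
          g (consVec y (consVec x finZeroElim)) = 0) → x = 0 := by
  have h : (all Z (ex Z' φ)).IsTrue ↔ (all Z' (neg φ)).interp = ⊥ := by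
    rw [IsTrue, interp_all_eq_top]
    exact Rel.neg_eq_top
  have key (p : Z.At) (x : Z.space p) :
      simple (consVec x finZeroElim) ∈ (all Z' (neg φ)).interp
        (consAt p (finZeroElim : ∀ i, (X i).At)) ↔
      (∀ (q : Z'.At) (y : Z'.space q),
        ∀ g ∈ φ.interp (consAt q (consAt p (finZeroElim : ∀ i, (X i).At))),
          g (consVec y (consVec x finZeroElim)) = 0) := by
    refine mem_interp_all.trans (forall_congr' fun q => forall_congr' fun y =>
      mem_interp_neg.trans (forall_congr' fun g => forall_congr' fun _ => ?_))
    rw [ip_eq_zero_comm, ip_consProd, ip_simple_left]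
    rfl
  rw [h]
  constructor
  · intro h p x hx
    rw [← key, h] at hx
    have h0 := (Submodule.mem_bot ℂ).1 hx
    have h1 := simple_apply (a := consAt p (finZeroElim : ∀ i, (X i).At)) (consVec x finZeroElim)
      (consVec x finZeroElim)
    rw [h0, Fin.prod_univ_succ, Fin.prod_univ_zero, mul_one] at h1
    exact inner_self_eq_zero.1 h1.symm
  · intro h
    funext a
    obtain ⟨p, b, rfl⟩ := exists_consAt a
    obtain rfl : b = finZeroElim := Subsingleton.elim _ _
    rw [Pi.bot_apply, eq_bot_iff]
    intro ξ hξ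
    let l : Z.space p →ₗ[ℂ] ℂ :=
      { toFun s := slice ξ s finZeroElim
        map_add' s t := by rw [map_add, add_apply]
        map_smul' c s := by rw [map_smul, smul_apply]; rfl }
    let x := (InnerProductSpace.toDual ℂ (Z.space p)).symm (LinearMap.toContinuousLinearMap l)
    have hx : ξ = simple (consVec x finZeroElim) := form_ext fun s y => by
      obtain rfl : y = finZeroElim := Subsingleton.elim _ _
      rw [simple_apply, Fin.prod_univ_succ, Fin.prod_univ_zero, mul_one]
      exact (InnerProductSpace.toDual_symm_apply (𝕜 := ℂ) (x := s)
        (y := LinearMap.toContinuousLinearMap l)).symm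
    rw [hx] at hξ
    have h0 := h p x ((key p x).1 hξ)
    rw [Submodule.mem_bot, hx, h0]
    refine form_ext fun s y => ?_
    rw [simple_apply, Fin.prod_univ_succ]
    exact mul_eq_zero_of_left (inner_zero_left s) _

section

variable {n : ℕ} {X : Fin n → QSet.{u, v}} {Z Z' : QSet.{u, v}} {a : ∀ i, (X i).At}

/-- The contraction as a linear map. -/
def contractLin {p : Z.At} : Form (consAt (Z := Z) p (consAt (Z := Z.dual) p a)) →ₗ[ℂ] Form a where
  toFun := contract
  map_add' := contract_add
  map_smul' := contract_smul

theorem contractLin_contractLin_apply {p : Z.At} {q : Z'.At} (f : Form (consAt (Z := Z) p (consAt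
    (Z := Z.dual) p (consAt (Z := Z') q (consAt (Z := Z'.dual) q a)))))
    (y : ∀ i, (X i).space (a i)) :
    contractLin (contractLin f) y = ∑ j, ∑ i, f (consVec (stdOrthonormalBasis ℂ (Z.space p) i)
      (consVec (Z := Z.dual) (z := p) (InnerProductSpace.toDual ℂ (Z.space p)
        (stdOrthonormalBasis ℂ (Z.space p) i))
      (consVec (stdOrthonormalBasis ℂ (Z'.space q) j) (consVec (Z := Z'.dual) (z := q)
        (InnerProductSpace.toDual ℂ (Z'.space q) (stdOrthonormalBasis ℂ (Z'.space q) j)) y)))) := by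
  refine (contract_apply _ _).trans (Finset.sum_congr rfl fun j _ => ?_)
  exact contract_apply _ _

theorem interp_exDiag_exDiag_le_iff
    {φ : Formula (Fin.cons Z (Fin.cons Z.dual (Fin.cons Z' (Fin.cons Z'.dual X :
      Fin (n + 1) → QSet.{u, v}) : Fin (n + 2) → QSet.{u, v}) : Fin (n + 3) → QSet.{u, v}) :
      Fin (n + 4) → QSet.{u, v})} {T : Submodule ℂ (Form a)} :
    (exDiag Z' (exDiag Z φ)).interp a ≤ T ↔ ∀ (q : Z'.At) (p : Z.At),
      φ.interp (consAt p (consAt (Z := Z.dual) p (consAt q (consAt (Z := Z'.dual) q a)))) ≤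
        (T.comap contractLin).comap contractLin := by
  rw [interp_exDiag_le_iff]
  refine forall_congr' fun q => ?_
  exact interp_exDiag_le_iff (T := T.comap contractLin)

end

end Formula

namespace BinRel
open QSet.Rel QSet.Formula

variable {X Y : QSet.{u, v}} {F : BinRel X Y}

theorem totalitySentence_isTrue_iff : F.totalitySentence.IsTrue ↔
    ∀ (p : X.At) (x : X.space p), (∀ b, ∀ f ∈ F p b, f x = 0) → x = 0 := by
  refine isTrue_all_ex_iff.trans (forall_congr' fun p => forall_congr' fun x => ?_)
  refine imp_congr_left (forall_congr' fun b => ?_)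
  have hg (g : Form (consAt (Z := Y.dual) b (consAt p (finZeroElim : ∀ i, ((![] : Fin 0 → QSet) i).At)))) :=
    mem_interp_atom₂ (X := (Fin.cons Y.dual (Fin.cons X ![] : Fin 1 → QSet.{u, v}) :
      Fin 2 → QSet.{u, v})) (i := 1) (j := 0) F.bend (by decide) (f := g)
  constructor
  · intro h f hf
    refine eq_zero_of_forall_dual fun η => ?_
    let C : StrongDual ℂ (Y.space b) →ₗ[ℂ] X.space p →ₗ[ℂ] ℂ :=
      LinearMap.mk₂ ℂ (fun η x => η (f x)) (fun _ _ _ => rfl) (fun _ _ _ => rfl)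
        (fun η x y => by rw [map_add, map_add]) (fun c η x => by rw [map_smul, map_smul])
    refine (ofBil_apply (Y := Y.dual) (Z := X) (p := b) (q := p) C η x).symm.trans (h η _ ?_)
    refine (hg _).2 fun _ => ⟨C.flip, mem_bil_bend.2 ⟨f, hf, fun _ _ => rfl⟩, fun x' _ => ?_⟩
    obtain ⟨η, w, rfl⟩ := exists_consVec x'
    obtain ⟨x, w, rfl⟩ := exists_consVec w
    obtain rfl : w = finZeroElim := Subsingleton.elim _ _
    exact ofBil_apply (Y := Y.dual) (Z := X) (p := b) (q := p) C η x
  · intro h η g hg'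
    obtain ⟨B, hB, h1⟩ := (hg g).1 hg' (consVec (Z := Y.dual) η (consVec x finZeroElim))
    obtain ⟨f, hf, h2⟩ := mem_bil_bend.1 hB
    rw [h1 _ fun _ _ _ => rfl]
    refine (h2 _ _).trans ?_
    exact (congrArg (η : StrongDual ℂ (Y.space b)) (h f hf)).trans (map_zero _)

/-- The two sums are basis expansions of `v` and of `ζ`. Contracting against `E_Y(y₁, y₂)` therefore
substitutes `v` for `y₁` and `ζ` for `y₂`. -/
theorem sum_sum_contract (V : QSet.{u, v}) (q : V.At) (c : ℂ) (v : V.space q)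
    (ζ : StrongDual ℂ (V.space q)) :
    ∑ j, ∑ i, c * stdOrthonormalBasis ℂ (V.dual.space q) j (stdOrthonormalBasis ℂ (V.space q) i) *
      InnerProductSpace.toDual ℂ (V.space q) (stdOrthonormalBasis ℂ (V.space q) i) v *
      InnerProductSpace.toDual ℂ (V.dual.space q) (stdOrthonormalBasis ℂ (V.dual.space q) j) ζ =
    c * ζ v := by
  have h1 (η : StrongDual ℂ (V.space q)) : ∑ i, c * η (stdOrthonormalBasis ℂ (V.space q) i) *
      InnerProductSpace.toDual ℂ (V.space q) (stdOrthonormalBasis ℂ (V.space q) i) v = c * η v := by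
    refine Eq.trans ?_ (congrArg (c * ·) (sum_inner_mul_apply (η : V.space q →ₗ[ℂ] ℂ) v))
    rw [Finset.mul_sum]
    refine Finset.sum_congr rfl fun i _ => ?_
    rw [mul_assoc, mul_comm (η _)]
    rfl
  let ev : StrongDual ℂ (V.space q) →ₗ[ℂ] ℂ :=
    { toFun η := η v
      map_add' _ _ := rfl
      map_smul' _ _ := rfl }
  refine Eq.trans ?_ (congrArg (c * ·) (sum_inner_mul_apply (E := V.dual.space q) ev ζ))
  rw [Finset.mul_sum]
  refine Finset.sum_congr rfl fun j _ => ?_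
  rw [← Finset.sum_mul, h1, mul_assoc, mul_comm (stdOrthonormalBasis ℂ (V.dual.space q) j v)]
  rfl

end BinRel
end QSet

/-! ### The sentences for injectivity and surjectivity -/

namespace QSet
attribute [local instance] dualInnerProductSpace
namespace BinRel
open QSet.Rel QSet.Formula

variable {X Y : QSet.{u, v}} {F : BinRel X Y}

theorem contractLin_contractLin_eq {n : ℕ} {U : Fin n → QSet.{u, v}} {a : ∀ i, (U i).At} {b : Y.At}
    {f : Form (consAt (Z := Y) b (consAt (Z := Y.dual) b (consAt (Z := Y.dual) b
      (consAt (Z := Y.dual.dual) b a))))} {w : ∀ i, (U i).space (a i)} {c : ℂ} {v : Y.space b}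
    {ζ : StrongDual ℂ (Y.space b)}
    (hf : ∀ (y : Y.space b) (η : StrongDual ℂ (Y.space b)) (y₂ : StrongDual ℂ (Y.space b))
      (η₂ : StrongDual ℂ (StrongDual ℂ (Y.space b))),
      f (consVec y (consVec (Z := Y.dual) (z := b) η (consVec (Z := Y.dual) (z := b) y₂
        (consVec (Z := Y.dual.dual) (z := b) η₂ w)))) = c * y₂ y * η v * η₂ ζ) :
    contractLin (Z := Y.dual) (contractLin f) w = c * ζ v := by
  refine (contractLin_contractLin_apply (Z' := Y.dual) f w).trans ?_
  rw [← sum_sum_contract Y b c v ζ]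
  exact Finset.sum_congr rfl fun j _ => Finset.sum_congr rfl fun i _ => hf _ _ _ _

/-- The bilinear functional `(x, η) ↦ η (f x)`. -/
def bendBil {V W : Type*} [NormedAddCommGroup V] [InnerProductSpace ℂ V] [NormedAddCommGroup W]
    [InnerProductSpace ℂ W] (f : V →L[ℂ] W) : V →ₗ[ℂ] StrongDual ℂ W →ₗ[ℂ] ℂ :=
  LinearMap.mk₂ ℂ (fun x η => η (f x)) (fun x y η => by rw [map_add, map_add])
    (fun c x η => by rw [map_smul, map_smul]) (fun _ _ _ => rfl) (fun _ _ _ => rfl)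

theorem mem_bil_conjugate_bend {q : X.At} {b : Y.At}
    {B : StrongDual ℂ (X.space q) →ₗ[ℂ] StrongDual ℂ (StrongDual ℂ (Y.space b)) →ₗ[ℂ] ℂ} :
    B ∈ bil (Y := X.dual) (Z := Y.dual.dual) F.conjugate.bend q b ↔
      ∃ g ∈ F q b, ∀ ξ θ, B ξ θ = θ (ξ ∘L ContinuousLinearMap.adjoint g) := by
  refine (mem_bil_bend (X := X.dual) (Y := Y.dual)).trans ?_
  constructor
  · rintro ⟨g', hg', h⟩
    obtain ⟨g, hg, h'⟩ := mem_conjugate.1 hg'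
    exact ⟨g, hg, fun ξ θ => (h ξ θ).trans (congrArg θ (h' ξ))⟩
  · rintro ⟨g, hg, h⟩
    exact ⟨ContinuousLinearMap.precomp ℂ (ContinuousLinearMap.adjoint g),
      mem_conjugate.2 ⟨g, hg, fun _ => rfl⟩, h⟩

/-- The formula `E_Y(F(x), F_*(x_*))`, with the variables `x_*, x`. -/
abbrev kernelFormula (F : BinRel X Y) :
    Formula (Fin.cons X.dual (Fin.cons X ![] : Fin 1 → QSet.{u, v}) : Fin 2 → QSet.{u, v}) :=
  exDiag Y.dual (exDiag Y (conj (conj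
    (atom₂ (Rel.eq Y) 0 2 (by decide) rfl rfl)
    (atom₂ F.bend 5 1 (by decide) rfl rfl))
    (atom₂ F.conjugate.bend 4 3 (by decide) rfl rfl)))

/-- The index without entries. -/
abbrev nilAt : ∀ i, ((![] : Fin 0 → QSet.{u, v}) i).At := finZeroElim

/-- The vector without entries. -/
abbrev nilVec : ∀ i, ((![] : Fin 0 → QSet.{u, v}) i).space (nilAt i) := finZeroElim

/-- The contractions insert `f x` and `ξ ∘ g†` into the evaluation functional, which gives `ξ (g† f
x)`; the equality atom removes the terms with `b₁ ≠ b₂`. Thus the formula is the bent form of `F† ∘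
F`. -/
theorem interp_kernelFormula_le_iff {p q : X.At}
    {T : Submodule ℂ (Form (consAt (Z := X.dual) q (consAt p nilAt)))} :
    F.kernelFormula.interp (consAt (Z := X.dual) q (consAt p nilAt)) ≤ T ↔
      ∀ b, ∀ f ∈ F p b, ∀ g ∈ F q b, ∀ h : Form (consAt (Z := X.dual) q (consAt p nilAt)),
        (∀ (ξ : StrongDual ℂ (X.space q)) (x : X.space p),
          h (consVec (Z := X.dual) (z := q) ξ (consVec x nilVec)) =
            ξ (ContinuousLinearMap.adjoint g (f x))) → h ∈ T := by
  rw [interp_exDiag_exDiag_le_iff]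
  let U : Fin 6 → QSet.{u, v} := Fin.cons Y (Fin.cons Y.dual (Fin.cons Y.dual
    (Fin.cons Y.dual.dual (Fin.cons X.dual (Fin.cons X ![] : Fin 1 → QSet.{u, v}) :
      Fin 2 → QSet.{u, v}) : Fin 3 → QSet.{u, v}) : Fin 4 → QSet.{u, v}) : Fin 5 → QSet.{u, v})
  have key (q' b : Y.At) (T) := interp_conj_atoms_le_iff (X := U) (T := T)
    (a := consAt b (consAt (Z := Y.dual) b (consAt (Z := Y.dual) q' (consAt (Z := Y.dual.dual) q'
      (consAt (Z := X.dual) q (consAt p nilAt))))))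
    (i₁ := 0) (j₁ := 2) (i₂ := 5) (j₂ := 1) (i₃ := 4) (j₃ := 3) (by decide) (by decide)
    (h₁ := by decide) (h₂ := by decide) (h₃ := by decide)
    (R₁ := Rel.eq Y) (R₂ := F.bend) (R₃ := F.conjugate.bend)
  constructor
  · intro h b f hf g hg k hk
    obtain ⟨u, hu⟩ := exists_prod_form (X := U)
      (a := consAt b (consAt (Z := Y.dual) b (consAt (Z := Y.dual) b (consAt (Z := Y.dual.dual) b
        (consAt (Z := X.dual) q (consAt p nilAt))))))
      (i₁ := 0) (j₁ := 2) (i₂ := 5) (j₂ := 1) (i₃ := 4) (j₃ := 3) (by decide) (by decide)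
      (evalBil b) (bendBil (V := X.space p) (W := Y.space b) f)
      (bendBil (V := StrongDual ℂ (X.space q)) (W := StrongDual ℂ (Y.space b))
        (ContinuousLinearMap.precomp ℂ (ContinuousLinearMap.adjoint g)))
    have := (key b b _).1 (h b b) _ (mem_bil_eq_self.2 ⟨1, fun _ _ => (one_mul _).symm⟩) _
      (mem_bil_bend.2 ⟨f, hf, fun _ _ => rfl⟩) _
      (mem_bil_conjugate_bend.2 ⟨g, hg, fun _ _ => rfl⟩) u hu
    have hku : contractLin (Z := Y.dual) (contractLin u) = k := form_ext fun ξ w => by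
      obtain ⟨x, w, rfl⟩ := exists_consVec w
      obtain rfl : w = nilVec := Subsingleton.elim _ _
      rw [hk, ← one_mul (ξ _)]
      refine contractLin_contractLin_eq (v := f x) (ζ := ξ ∘L ContinuousLinearMap.adjoint g) ?_
      intro y η y₂ η₂
      rw [one_mul]
      exact hu _
    rw [← hku]
    exact this
  · intro h b₂ b₁
    refine (key b₂ b₁ _).2 fun B₁ hB₁ B₂ hB₂ B₃ hB₃ u hu => ?_
    by_cases hb : b₁ = b₂
    · subst hb
      obtain ⟨c, hc⟩ := mem_bil_eq_self.1 hB₁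
      obtain ⟨f, hf, h₂⟩ := (mem_bil_bend (p := p) (q := b₁)).1 hB₂
      obtain ⟨g, hg, h₃⟩ := (mem_bil_conjugate_bend (q := q) (b := b₁)).1 hB₃
      -- The scalar from the equality atom is absorbed into `f`.
      refine h b₁ (c • f) (Submodule.smul_mem _ c hf) g hg _ fun ξ x => ?_
      refine (contractLin_contractLin_eq (c := c) (v := f x)
        (ζ := ξ ∘L ContinuousLinearMap.adjoint g) ?_).trans ?_
      · intro y η y₂ η₂
        refine (hu _).trans ?_
        exact congrArg₂ (· * ·) (congrArg₂ (· * ·) (hc y y₂) (h₂ x η)) (h₃ ξ η₂)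
      · rw [smul_apply, map_smul, map_smul]
        rfl
    · have : u = 0 := MultilinearMap.ext fun x => by
        rw [hu, eq_zero_of_mem_bil_eq hb hB₁]
        exact mul_eq_zero_of_left (zero_mul _) _
      rw [this]
      exact Submodule.zero_mem _

theorem injectivitySentence_isTrue_iff :
    F.injectivitySentence.IsTrue ↔ comp F.dagger F ≤ id X := by
  have hE (p q : X.At) (g : Form (consAt (Z := X.dual) q (consAt p nilAt))) :=
    mem_interp_atom₂ (X := (Fin.cons X.dual (Fin.cons X ![] : Fin 1 → QSet.{u, v}) :
      Fin 2 → QSet.{u, v})) (i := 1) (j := 0) (Rel.eq X) (by decide) (f := g)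
  have h0 : F.injectivitySentence.IsTrue ↔ F.kernelFormula.interp ≤
      (atom₂ (Rel.eq X) 1 0 (by decide) rfl rfl : Formula (Fin.cons X.dual (Fin.cons X ![] :
        Fin 1 → QSet.{u, v}) : Fin 2 → QSet.{u, v})).interp := by
    rw [IsTrue, injectivitySentence, interp_all_eq_top, interp_all_eq_top, interp_imp_eq_top]
  rw [h0, dagger_comp_le_id_iff]
  constructor
  · intro h p q b f hf g hg
    let C := bendBil (ContinuousLinearMap.adjoint g ∘L f)
    have hm := interp_kernelFormula_le_iff.1 (h (consAt (Z := X.dual) q (consAt p nilAt)))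
      b f hf g hg (ofBil (Y := X.dual) (Z := X) (p := q) (q := p) C.flip)
      (fun ξ x => ofBil_apply (Y := X.dual) (Z := X) (p := q) (q := p) C.flip ξ x)
    obtain ⟨B, hB, h1⟩ := (hE p q _).1 hm 0
    refine mem_id_iff_bil.2 ⟨B, hB, fun x ξ => ?_⟩
    refine (h1 (consVec (Z := X.dual) (z := q) ξ (consVec x nilVec)) ?_).symm.trans
      (ofBil_apply (Y := X.dual) (Z := X) (p := q) (q := p) C.flip ξ x)
    intro k
    fin_cases k
    · exact fun _ h => absurd rfl h
    · exact fun h => absurd rfl h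
  · intro h a
    obtain ⟨q, a, rfl⟩ := exists_consAt a
    obtain ⟨p, a, rfl⟩ := exists_consAt a
    obtain rfl : a = nilAt := Subsingleton.elim _ _
    refine interp_kernelFormula_le_iff.2 fun b f hf g hg k hk => ?_
    obtain ⟨B, hB, h1⟩ := mem_id_iff_bil.1 (h p q b f hf g hg)
    refine (hE p q _).2 fun _ => ⟨B, hB, fun w _ => ?_⟩
    obtain ⟨ξ, w, rfl⟩ := exists_consVec w
    obtain ⟨x, w, rfl⟩ := exists_consVec w
    obtain rfl : w = nilVec := Subsingleton.elim _ _
    exact (hk ξ x).trans (h1 x ξ).symm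

/-- The formula `E_Y(F(x), y_*)`, with the variables `x, y_*`. -/
abbrev graphFormula (F : BinRel X Y) :
    Formula (Fin.cons X (Fin.cons Y.dual ![] : Fin 1 → QSet.{u, v}) : Fin 2 → QSet.{u, v}) :=
  exDiag Y.dual (exDiag Y (conj (conj
    (atom₂ (Rel.eq Y) 0 2 (by decide) rfl rfl)
    (atom₂ F.bend 4 1 (by decide) rfl rfl))
    (atom₂ (Rel.eq Y.dual) 5 3 (by decide) rfl rfl)))

/-- Both auxiliary pairs are contracted against equality relations, so the formula reduces to `F˘(x,
y_*)`. -/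
theorem interp_graphFormula_le_iff {p : X.At} {q : Y.At}
    {T : Submodule ℂ (Form (consAt p (consAt (Z := Y.dual) q nilAt)))} :
    F.graphFormula.interp (consAt p (consAt (Z := Y.dual) q nilAt)) ≤ T ↔
      ∀ f ∈ F p q, ∀ h : Form (consAt p (consAt (Z := Y.dual) q nilAt)),
        (∀ (x : X.space p) (η : StrongDual ℂ (Y.space q)),
          h (consVec x (consVec (Z := Y.dual) (z := q) η nilVec)) = η (f x)) → h ∈ T := by
  rw [interp_exDiag_exDiag_le_iff]
  let U : Fin 6 → QSet.{u, v} := Fin.cons Y (Fin.cons Y.dual (Fin.cons Y.dual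
    (Fin.cons Y.dual.dual (Fin.cons X (Fin.cons Y.dual ![] : Fin 1 → QSet.{u, v}) :
      Fin 2 → QSet.{u, v}) : Fin 3 → QSet.{u, v}) : Fin 4 → QSet.{u, v}) : Fin 5 → QSet.{u, v})
  have key (q' b : Y.At) (T) := interp_conj_atoms_le_iff (X := U) (T := T)
    (a := consAt b (consAt (Z := Y.dual) b (consAt (Z := Y.dual) q' (consAt (Z := Y.dual.dual) q'
      (consAt p (consAt (Z := Y.dual) q nilAt))))))
    (i₁ := 0) (j₁ := 2) (i₂ := 4) (j₂ := 1) (i₃ := 5) (j₃ := 3) (by decide) (by decide)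
    (h₁ := by decide) (h₂ := by decide) (h₃ := by decide)
    (R₁ := Rel.eq Y) (R₂ := F.bend) (R₃ := Rel.eq Y.dual)
  constructor
  · intro h f hf k hk
    obtain ⟨u, hu⟩ := exists_prod_form (X := U)
      (a := consAt q (consAt (Z := Y.dual) q (consAt (Z := Y.dual) q (consAt (Z := Y.dual.dual) q
        (consAt p (consAt (Z := Y.dual) q nilAt))))))
      (i₁ := 0) (j₁ := 2) (i₂ := 4) (j₂ := 1) (i₃ := 5) (j₃ := 3) (by decide) (by decide)
      (evalBil q) (bendBil (V := X.space p) (W := Y.space q) f) (evalBil (Z := Y.dual) q)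
    have := (key q q _).1 (h q q) _ (mem_bil_eq_self.2 ⟨1, fun _ _ => (one_mul _).symm⟩) _
      (mem_bil_bend.2 ⟨f, hf, fun _ _ => rfl⟩) _
      ((mem_bil_eq_self (Z := Y.dual)).2 ⟨1, fun _ _ => (one_mul _).symm⟩) u hu
    have hku : contractLin (Z := Y.dual) (contractLin u) = k := form_ext fun x w => by
      obtain ⟨η', w, rfl⟩ := exists_consVec w
      obtain rfl : w = nilVec := Subsingleton.elim _ _
      refine Eq.trans ?_ ((one_mul _).trans (hk x η').symm)
      refine contractLin_contractLin_eq (v := f x) (ζ := η') ?_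
      intro y η y₂ η₂
      rw [one_mul]
      exact hu _
    rw [← hku]
    exact this
  · intro h b₂ b₁
    refine (key b₂ b₁ _).2 fun B₁ hB₁ B₂ hB₂ B₃ hB₃ u hu => ?_
    by_cases hb : b₁ = b₂ ∧ q = b₂
    · obtain ⟨rfl, rfl⟩ := hb
      obtain ⟨c, hc⟩ := mem_bil_eq_self.1 hB₁
      obtain ⟨f, hf, h₂⟩ := (mem_bil_bend (p := p) (q := q)).1 hB₂
      obtain ⟨d, hd⟩ := (mem_bil_eq_self (Z := Y.dual)).1 hB₃
      refine h ((c * d) • f) (Submodule.smul_mem _ _ hf) _ fun x η' => ?_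
      refine (contractLin_contractLin_eq (c := c * d) (v := f x) (ζ := η') ?_).trans ?_
      · intro y η y₂ η₂
        refine (hu _).trans ((congrArg₂ (· * ·) (congrArg₂ (· * ·) (hc y y₂) (h₂ x η))
          (hd η' η₂)).trans ?_)
        change c * y₂ y * η (f x) * (d * η₂ η') = c * d * y₂ y * η (f x) * η₂ η'
        ring
      · rw [smul_apply, map_smul]
        rfl
    · have : u = 0 := MultilinearMap.ext fun x => by
        rw [hu]
        by_cases hb' : b₁ = b₂
        · rw [eq_zero_of_mem_bil_eq (Z := Y.dual) (fun h => hb ⟨hb', h⟩) hB₃]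
          exact mul_zero _
        · rw [eq_zero_of_mem_bil_eq hb' hB₁]
          exact mul_eq_zero_of_left (zero_mul _) _
      rw [this]
      exact Submodule.zero_mem _

theorem surjectivitySentence_isTrue_iff : F.surjectivitySentence.IsTrue ↔
    ∀ (q : Y.At) (η : StrongDual ℂ (Y.space q)),
      (∀ p, ∀ f ∈ F p q, ∀ x, η (f x) = 0) → η = 0 := by
  refine isTrue_all_ex_iff.trans (forall_congr' fun q => forall_congr' fun η => ?_)
  refine imp_congr_left (forall_congr' fun p => ?_)
  have key (x : X.space p) := interp_graphFormula_le_iff (F := F) (p := p) (q := q) (T :=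
    { carrier := {g | g (consVec x (consVec (Z := Y.dual) (z := q) η nilVec)) = 0}
      add_mem' := fun {g h} hg hh => (congrArg₂ (· + ·) hg hh).trans (add_zero 0)
      zero_mem' := rfl
      smul_mem' := fun c g hg => (congrArg (c * ·) hg).trans (mul_zero c) })
  constructor
  · intro h f hf x
    let C := bendBil f
    refine (ofBil_apply (Y := X) (Z := Y.dual) (p := p) (q := q) C x η).symm.trans
      ((key x).1 (fun g hg => h x g hg) f hf _ fun x η => ?_)
    exact ofBil_apply (Y := X) (Z := Y.dual) (p := p) (q := q) C x η
  · intro h x g hg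
    exact (key x).2 (fun f hf k hk => (hk x η).trans (h f hf x)) hg

end BinRel
end QSet

/-! ### The sentence for univalence -/

namespace QSet
attribute [local instance] dualInnerProductSpace
namespace BinRel
open QSet.Rel QSet.Formula

variable {X Y : QSet.{u, v}} {F : BinRel X Y}

/-- This allows a vacuous third atom on the two unused variables of `F˘(x, y₁_*) ∧ F˘_*(x_*, y₂)`,
so that the description of triple conjunctions applies to it. -/
theorem mem_interp_atom₂_top {n : ℕ} {U : Fin n → QSet.{u, v}} {i j : Fin n} (hij : i ≠ j)
    {a : ∀ i, (U i).At} (f : Form a) :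
    f ∈ (atom₂ (⊤ : Rel ![U i, U j]) i j hij rfl rfl).interp a := by
  refine (mem_interp_atom₂ _ hij).2 fun x => ?_
  refine ⟨LinearMap.mk₂ ℂ (fun s t => f (Function.update (Function.update x i s) j t)) ?_ ?_ ?_ ?_,
    ofBil_mem_bil trivial, fun y hy => ?_⟩
  · intro s s' t
    simp only [Function.update_comm hij, f.map_update_add]
  · intro c s t
    simp only [Function.update_comm hij, f.map_update_smul]
  · intro s t t'
    rw [f.map_update_add]
  · intro c s t
    rw [f.map_update_smul]
  · rw [LinearMap.mk₂_apply]
    congr 1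
    funext k
    by_cases hj : k = j
    · subst hj
      rw [Function.update_self]
    by_cases hi : k = i
    · subst hi
      rw [Function.update_of_ne hj, Function.update_self]
    · rw [Function.update_of_ne hj, Function.update_of_ne hi, hy k hi hj]

/-- The context of the variables `y₂, y₂_*, y₁, y₁_*, x, x_*`. -/
abbrev sixCtx (X Y : QSet.{u, v}) : Fin 6 → QSet.{u, v} :=
  Fin.cons Y (Fin.cons Y.dual (Fin.cons Y (Fin.cons Y.dual (Fin.cons X
    (Fin.cons X.dual ![] : Fin 1 → QSet.{u, v}) : Fin 2 → QSet.{u, v}) : Fin 3 → QSet.{u, v}) :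
      Fin 4 → QSet.{u, v}) : Fin 5 → QSet.{u, v})

/-- The index `(b₂, b₂, b₁, b₁, p, p)`. -/
abbrev sixAt (p : X.At) (b₁ b₂ : Y.At) : ∀ i, (sixCtx X Y i).At :=
  consAt b₂ (consAt (Z := Y.dual) b₂ (consAt b₁ (consAt (Z := Y.dual) b₁ (consAt p
    (consAt (Z := X.dual) p nilAt)))))

/-- The vector `(y₂, y₂_*, y₁, y₁_*, x, x_*)`. -/
abbrev sixVec {p : X.At} {b₁ b₂ : Y.At} (y₂ : Y.space b₂) (η₂ : StrongDual ℂ (Y.space b₂))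
    (y₁ : Y.space b₁) (η₁ : StrongDual ℂ (Y.space b₁)) (x : X.space p)
    (ξ : StrongDual ℂ (X.space p)) : ∀ i, (sixCtx X Y i).space (sixAt p b₁ b₂ i) :=
  consVec y₂ (consVec (Z := Y.dual) (z := b₂) η₂ (consVec y₁ (consVec (Z := Y.dual) (z := b₁) η₁
    (consVec x (consVec (Z := X.dual) (z := p) ξ nilVec)))))

theorem exists_sixVec {p : X.At} {b₁ b₂ : Y.At}
    (w : ∀ i, (sixCtx X Y i).space (sixAt p b₁ b₂ i)) :
    ∃ y₂ η₂ y₁ η₁ x ξ, w = sixVec (p := p) (b₁ := b₁) (b₂ := b₂) y₂ η₂ y₁ η₁ x ξ := by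
  obtain ⟨y₂, w, rfl⟩ := exists_consVec w
  obtain ⟨η₂, w, rfl⟩ := exists_consVec w
  obtain ⟨y₁, w, rfl⟩ := exists_consVec w
  obtain ⟨η₁, w, rfl⟩ := exists_consVec w
  obtain ⟨x, w, rfl⟩ := exists_consVec w
  obtain ⟨ξ, w, rfl⟩ := exists_consVec w
  obtain rfl : w = nilVec := Subsingleton.elim _ _
  exact ⟨y₂, η₂, y₁, η₁, x, ξ, rfl⟩

/-- The contraction of all six variables in pairs. -/
def contractAll {p : X.At} {b₁ b₂ : Y.At} : Form (sixAt p b₁ b₂) →ₗ[ℂ] ℂ where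
  toFun u := contract (Z := X) (contract (Z := Y) (contract (Z := Y) u)) nilVec
  map_add' f g := by rw [contract_add, contract_add, contract_add]; rfl
  map_smul' c f := by rw [contract_smul, contract_smul, contract_smul]; rfl

/-- The product of three bilinear functionals. -/
def IsProd {p : X.At} {b₁ b₂ : Y.At} (u : Form (sixAt p b₁ b₂))
    (C₁ : X.space p →ₗ[ℂ] StrongDual ℂ (Y.space b₁) →ₗ[ℂ] ℂ)
    (C₂ : StrongDual ℂ (X.space p) →ₗ[ℂ] Y.space b₂ →ₗ[ℂ] ℂ)
    (C₃ : Y.space b₁ →ₗ[ℂ] StrongDual ℂ (Y.space b₂) →ₗ[ℂ] ℂ) : Prop :=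
  ∀ y₂ η₂ y₁ η₁ x ξ, u (sixVec y₂ η₂ y₁ η₁ x ξ) = C₁ x η₁ * C₂ ξ y₂ * C₃ y₁ η₂

theorem exists_isProd {p : X.At} {b₁ b₂ : Y.At}
    (C₁ : X.space p →ₗ[ℂ] StrongDual ℂ (Y.space b₁) →ₗ[ℂ] ℂ)
    (C₂ : StrongDual ℂ (X.space p) →ₗ[ℂ] Y.space b₂ →ₗ[ℂ] ℂ)
    (C₃ : Y.space b₁ →ₗ[ℂ] StrongDual ℂ (Y.space b₂) →ₗ[ℂ] ℂ) :
    ∃ u : Form (sixAt p b₁ b₂), IsProd u C₁ C₂ C₃ := by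
  obtain ⟨u, hu⟩ := exists_prod_form (X := sixCtx X Y) (a := sixAt p b₁ b₂)
    (i₁ := 4) (j₁ := 3) (i₂ := 5) (j₂ := 0) (i₃ := 2) (j₃ := 1) (by decide) (by decide) C₁ C₂ C₃
  exact ⟨u, fun _ _ _ _ _ _ => hu _⟩

/-- The formula `F˘(x, y₁_*) ∧ F˘_*(x_*, y₂)`. -/
abbrev pairFormula (F : BinRel X Y) : Formula (sixCtx X Y) :=
  conj (atom₂ F.bend 4 3 (by decide) rfl rfl) (atom₂ F.bend.conjugate 5 0 (by decide) rfl rfl)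

/-- The formula `E_Y(y₁, y₂_*)`. -/
abbrev equalFormula (X Y : QSet.{u, v}) : Formula (sixCtx X Y) :=
  atom₂ (Rel.eq Y) 2 1 (by decide) rfl rfl

theorem pairFormula_le_iff {p : X.At} {b₁ b₂ : Y.At} {T : Submodule ℂ (Form (sixAt p b₁ b₂))} :
    F.pairFormula.interp (sixAt p b₁ b₂) ≤ T ↔
      ∀ C₁ ∈ bil (Y := X) (Z := Y.dual) F.bend p b₁,
      ∀ C₂ ∈ bil (Y := X.dual) (Z := Y) F.bend.conjugate p b₂, ∀ C₃ u, IsProd u C₁ C₂ C₃ → u ∈ T := by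
  have key := interp_conj_atoms_le_iff (X := sixCtx X Y) (T := T) (a := sixAt p b₁ b₂)
    (i₁ := 4) (j₁ := 3) (i₂ := 5) (j₂ := 0) (i₃ := 2) (j₃ := 1) (by decide) (by decide)
    (h₁ := by decide) (h₂ := by decide) (h₃ := by decide)
    (R₁ := F.bend) (R₂ := F.bend.conjugate) (R₃ := ⊤)
  constructor
  · intro h C₁ hC₁ C₂ hC₂ C₃ u hu
    refine key.1 (fun u hu => h hu.1) C₁ hC₁ C₂ hC₂ C₃ (ofBil_mem_bil (Z := Y.dual) trivial) u ?_
    intro w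
    obtain ⟨y₂, η₂, y₁, η₁, x, ξ, rfl⟩ := exists_sixVec w
    exact hu _ _ _ _ _ _
  · intro h u hu
    exact key.2 (fun C₁ hC₁ C₂ hC₂ C₃ _ u hu => h C₁ hC₁ C₂ hC₂ C₃ u
      fun _ _ _ _ _ _ => hu _) ⟨hu, mem_interp_atom₂_top _ u⟩

theorem conj_pairFormula_le_iff {p : X.At} {b₁ b₂ : Y.At}
    {T : Submodule ℂ (Form (sixAt p b₁ b₂))} :
    (conj F.pairFormula (equalFormula X Y)).interp (sixAt p b₁ b₂) ≤ T ↔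
      ∀ C₁ ∈ bil (Y := X) (Z := Y.dual) F.bend p b₁,
      ∀ C₂ ∈ bil (Y := X.dual) (Z := Y) F.bend.conjugate p b₂,
      ∀ C₃ ∈ bil (Y := Y) (Z := Y.dual) (Rel.eq Y) b₁ b₂, ∀ u, IsProd u C₁ C₂ C₃ → u ∈ T := by
  have key := interp_conj_atoms_le_iff (X := sixCtx X Y) (T := T) (a := sixAt p b₁ b₂)
    (i₁ := 4) (j₁ := 3) (i₂ := 5) (j₂ := 0) (i₃ := 2) (j₃ := 1) (by decide) (by decide)
    (h₁ := by decide) (h₂ := by decide) (h₃ := by decide)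
    (R₁ := F.bend) (R₂ := F.bend.conjugate) (R₃ := Rel.eq Y)
  refine key.trans ?_
  constructor
  · intro h C₁ hC₁ C₂ hC₂ C₃ hC₃ u hu
    refine h C₁ hC₁ C₂ hC₂ C₃ hC₃ u fun w => ?_
    obtain ⟨y₂, η₂, y₁, η₁, x, ξ, rfl⟩ := exists_sixVec w
    exact hu _ _ _ _ _ _
  · intro h C₁ hC₁ C₂ hC₂ C₃ hC₃ u hu
    exact h C₁ hC₁ C₂ hC₂ C₃ hC₃ u fun _ _ _ _ _ _ => hu _

/-- The three quantifiers ask that `e ⊗ e ⊗ e` lie in the Sasaki arrow, that is, be orthogonal to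
the part of the premise orthogonal to premise and conclusion together. Pairing with `e ⊗ e ⊗ e` is
the full contraction. -/
theorem univalenceSentence_isTrue_iff_contractAll : F.univalenceSentence.IsTrue ↔
    ∀ (p : X.At) (b₁ b₂ : Y.At), ∀ u ∈ F.pairFormula.interp (sixAt p b₁ b₂),
      (∀ k ∈ (conj F.pairFormula (equalFormula X Y)).interp (sixAt p b₁ b₂), ip k u = 0) →
        contractAll u = 0 := by
  have h0 : F.univalenceSentence.IsTrue ↔ ∀ ξ : Form (X := ![]) nilAt, ∀ (p : X.At) (b₁ b₂ : Y.At),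
      evalProd b₂ (evalProd b₁ (evalProd p ξ)) ∈
        (imp F.pairFormula (equalFormula X Y)).interp (sixAt p b₁ b₂) := by
    constructor
    · intro h ξ p b₁ b₂
      have : ξ ∈ F.univalenceSentence.interp nilAt := by
        rw [show F.univalenceSentence.interp = ⊤ from h]
        trivial
      exact mem_interp_allDiag.1 (mem_interp_allDiag.1 (mem_interp_allDiag.1 this p) b₁) b₂
    · intro h
      refine funext fun a => ?_
      obtain rfl : a = nilAt := Subsingleton.elim _ _
      rw [Pi.top_apply, eq_top_iff]
      intro ξ _
      exact mem_interp_allDiag.2 fun p => mem_interp_allDiag.2 fun b₁ =>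
        mem_interp_allDiag.2 fun b₂ => h ξ p b₁ b₂
  have h1 (ξ : Form (X := ![]) nilAt) {p : X.At} {b₁ b₂ : Y.At} (u : Form (sixAt p b₁ b₂)) :
      ip (evalProd b₂ (evalProd b₁ (evalProd p ξ))) u =
        ip ξ (contract (Z := X) (contract (Z := Y) (contract (Z := Y) u))) := by
    rw [← ip_evalProd, ← ip_evalProd, ← ip_evalProd]
  rw [h0]
  constructor
  · intro h p b₁ b₂ u hu hk
    have h2 := mem_interp_imp.1 (h (simple nilVec) p b₁ b₂) u hu fun k h1 h2 => hk k ⟨h1, h2⟩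
    rw [ip_eq_zero_comm, h1, ip_simple_left] at h2
    exact h2
  · intro h ξ p b₁ b₂
    refine mem_interp_imp.2 fun u hu hk => ?_
    have h2 := h p b₁ b₂ u hu fun k hk' => hk k hk'.1 hk'.2
    rw [ip_eq_zero_comm, h1]
    convert ip_zero_right ξ
    ext w
    obtain rfl : w = nilVec := Subsingleton.elim _ _
    exact h2

/-- Summing over the bases of `X_p` and `Y_{b₁}` composes `f` with `g†`; only the pairing of `C₃`
with `f g†` over the basis of `Y_{b₂}` is left. -/
theorem contractAll_of_isProd {p : X.At} {b₁ b₂ : Y.At} {u : Form (sixAt p b₁ b₂)}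
    {C₁ : X.space p →ₗ[ℂ] StrongDual ℂ (Y.space b₁) →ₗ[ℂ] ℂ}
    {C₂ : StrongDual ℂ (X.space p) →ₗ[ℂ] Y.space b₂ →ₗ[ℂ] ℂ}
    {C₃ : Y.space b₁ →ₗ[ℂ] StrongDual ℂ (Y.space b₂) →ₗ[ℂ] ℂ} (hu : IsProd u C₁ C₂ C₃)
    {f : X.space p →L[ℂ] Y.space b₁} (hf : ∀ x η, C₁ x η = η (f x))
    {g : X.space p →L[ℂ] Y.space b₂} (hg : ∀ ξ y, C₂ ξ y = ξ (ContinuousLinearMap.adjoint g y)) :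
    contractAll u = ∑ j, C₃ ((f ∘L ContinuousLinearMap.adjoint g)
      (stdOrthonormalBasis ℂ (Y.space b₂) j))
      (InnerProductSpace.toDual ℂ (Y.space b₂) (stdOrthonormalBasis ℂ (Y.space b₂) j)) := by
  have h1 : contractAll u = ∑ k, ∑ i, ∑ j, u (sixVec (stdOrthonormalBasis ℂ (Y.space b₂) j)
      (InnerProductSpace.toDual ℂ _ (stdOrthonormalBasis ℂ (Y.space b₂) j))
      (stdOrthonormalBasis ℂ (Y.space b₁) i)
      (InnerProductSpace.toDual ℂ _ (stdOrthonormalBasis ℂ (Y.space b₁) i))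
      (stdOrthonormalBasis ℂ (X.space p) k)
      (InnerProductSpace.toDual ℂ _ (stdOrthonormalBasis ℂ (X.space p) k))) := by
    refine (contract_apply _ _).trans (Finset.sum_congr rfl fun k _ => ?_)
    refine (contract_apply _ _).trans (Finset.sum_congr rfl fun i _ => ?_)
    exact contract_apply _ _
  rw [h1, Finset.sum_congr rfl fun k _ => Finset.sum_comm, Finset.sum_comm]
  refine Finset.sum_congr rfl fun j _ => ?_
  have h2 (η : StrongDual ℂ (Y.space b₂)) (y : Y.space b₁) :
      ∑ i, inner ℂ (stdOrthonormalBasis ℂ (Y.space b₁) i) y *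
        C₃ (stdOrthonormalBasis ℂ (Y.space b₁) i) η = C₃ y η :=
    sum_inner_mul_apply (C₃.flip η) y
  have h3 (η : StrongDual ℂ (Y.space b₂)) (x : X.space p) :
      ∑ k, inner ℂ (stdOrthonormalBasis ℂ (X.space p) k) x *
        C₃ (f (stdOrthonormalBasis ℂ (X.space p) k)) η = C₃ (f x) η :=
    sum_inner_mul_apply (C₃.flip η ∘ₗ f.toLinearMap) x
  rw [ContinuousLinearMap.comp_apply, ← h3]
  refine Finset.sum_congr rfl fun k _ => ?_
  rw [← h2, Finset.mul_sum]
  refine Finset.sum_congr rfl fun i _ => ?_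
  rw [hu, hf, hg, InnerProductSpace.toDual_apply_apply, InnerProductSpace.toDual_apply_apply]
  ring

/-- The last six factors on the right stand in the order of the six variables, so each summand is a
multiple of the value of a simple tensor. -/
theorem sum_factor {α β γ δ ε : Type*} [Fintype α] [Fintype β] [Fintype γ] [Fintype δ] [Fintype ε]
    (b : α → β → ℂ) (d : γ → δ → ℂ) (c : ℂ) (x : α → ℂ) (y : β → ℂ) (z : γ → ℂ) (t : δ → ℂ)
    (r s : ε → ℂ) :
    (∑ k, ∑ l, b k l * (x k * y l)) * (∑ m, ∑ n, d m n * (z m * t n)) * (c * ∑ i, r i * s i) =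
      ∑ k, ∑ l, ∑ m, ∑ n, ∑ i, (b k l * d m n * c) *
        (t n * (s i * (r i * (y l * (x k * z m))))) := by
  rw [Finset.sum_mul, Finset.sum_mul]
  refine Finset.sum_congr rfl fun k _ => ?_
  rw [Finset.sum_mul, Finset.sum_mul]
  refine Finset.sum_congr rfl fun l _ => ?_
  rw [Finset.mul_sum, Finset.sum_mul]
  refine Finset.sum_congr rfl fun m _ => ?_
  rw [Finset.mul_sum, Finset.sum_mul]
  refine Finset.sum_congr rfl fun n _ => ?_
  rw [Finset.mul_sum, Finset.mul_sum]
  refine Finset.sum_congr rfl fun i _ => ?_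
  ring

/-- The trace of a bilinear functional on an atom and its dual. -/
def trace {b : Y.At} (C : Y.space b →ₗ[ℂ] StrongDual ℂ (Y.space b) →ₗ[ℂ] ℂ) : ℂ :=
  ∑ j, C (stdOrthonormalBasis ℂ (Y.space b) j)
    (InnerProductSpace.toDual ℂ (Y.space b) (stdOrthonormalBasis ℂ (Y.space b) j))

theorem trace_evalBil (b : Y.At) : trace (evalBil b) = (Module.finrank ℂ (Y.space b) : ℂ) := by
  simp only [trace, evalBil_apply, InnerProductSpace.toDual_apply_apply,
    inner_self_eq_norm_sq_to_K, OrthonormalBasis.norm_eq_one]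
  simp

theorem sum_smul_one {b : Y.At} (C : Y.space b →ₗ[ℂ] StrongDual ℂ (Y.space b) →ₗ[ℂ] ℂ) (c : ℂ) :
    ∑ j, C ((c • (1 : Y.space b →L[ℂ] Y.space b)) (stdOrthonormalBasis ℂ (Y.space b) j))
      (InnerProductSpace.toDual ℂ (Y.space b) (stdOrthonormalBasis ℂ (Y.space b) j)) =
        c * trace C := by
  rw [trace, Finset.mul_sum]
  refine Finset.sum_congr rfl fun j _ => ?_
  rw [smul_apply, map_smul]
  rfl

theorem trace_sub_trace_smul {b : Y.At}
    (C : Y.space b →ₗ[ℂ] StrongDual ℂ (Y.space b) →ₗ[ℂ] ℂ) :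
    trace (C - (trace C / Module.finrank ℂ (Y.space b)) • evalBil b) = 0 := by
  have hd : (Module.finrank ℂ (Y.space b) : ℂ) ≠ 0 := Nat.cast_ne_zero.2 Module.finrank_pos.ne'
  have h (c : ℂ) : trace (C - c • evalBil b) = trace C - c * trace (evalBil b) := by
    simp only [trace, LinearMap.sub_apply, LinearMap.smul_apply, Finset.sum_sub_distrib,
      Finset.mul_sum, smul_eq_mul]
  rw [h, trace_evalBil, div_mul_cancel₀ _ hd, sub_self]

/-- The inner product of two products factors, and a multiple of evaluation paired with `C₃`
contributes a multiple of the trace of `C₃`. -/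
theorem ip_eq_zero_of_trace_eq_zero {p : X.At} {b : Y.At} {u k : Form (sixAt p b b)}
    {C₁ D₁ : X.space p →ₗ[ℂ] StrongDual ℂ (Y.space b) →ₗ[ℂ] ℂ}
    {C₂ D₂ : StrongDual ℂ (X.space p) →ₗ[ℂ] Y.space b →ₗ[ℂ] ℂ}
    {C₃ D₃ : Y.space b →ₗ[ℂ] StrongDual ℂ (Y.space b) →ₗ[ℂ] ℂ} (hu : IsProd u C₁ C₂ C₃)
    (hk : IsProd k D₁ D₂ D₃) (hC : trace C₃ = 0) {c : ℂ} (hD : ∀ y η, D₃ y η = c * η y) :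
    ip k u = 0 := by
  let e := stdOrthonormalBasis ℂ (Y.space b)
  let x := stdOrthonormalBasis ℂ (X.space p)
  let η := stdOrthonormalBasis ℂ (StrongDual ℂ (Y.space b))
  let ξ := stdOrthonormalBasis ℂ (StrongDual ℂ (X.space p))
  have h : k = ∑ l, ∑ m, ∑ r, ∑ s, ∑ i, (D₁ (x l) (η m) * D₂ (ξ r) (e s) * c) •
      simple (a := sixAt p b b) (sixVec (e s) (InnerProductSpace.toDual ℂ (Y.space b) (e i)) (e i)
        (η m) (x l) (ξ r)) := by
    ext w
    obtain ⟨y₂, η₂, y₁, η₁, x', ξ', rfl⟩ := exists_sixVec w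
    rw [hk, hD, bilinear_eq_sum D₁, bilinear_eq_sum D₂,
      show η₂ y₁ = ∑ i, inner ℂ (e i) y₁ * η₂ (e i) from
        (sum_inner_mul_apply (η₂ : Y.space b →ₗ[ℂ] ℂ) y₁).symm, sum_factor]
    simp only [sum_apply]
    refine Finset.sum_congr rfl fun l _ => Finset.sum_congr rfl fun m _ =>
      Finset.sum_congr rfl fun r _ => Finset.sum_congr rfl fun s _ =>
      Finset.sum_congr rfl fun i _ => ?_
    rw [smul_apply, simple_apply, smul_eq_mul]
    congr 1
    simp only [Fin.prod_univ_succ, Fin.prod_univ_zero, mul_one]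
    rw [← inner_toDual (e i) η₂]
    rfl
  rw [h]
  simp only [ip_sum_left, ip_smul_left, ip_simple_left]
  refine Finset.sum_eq_zero fun l _ => Finset.sum_eq_zero fun m _ =>
    Finset.sum_eq_zero fun r _ => Finset.sum_eq_zero fun s _ => ?_
  simp only [hu _ _ _ _ _ _]
  rw [← Finset.mul_sum, ← Finset.mul_sum]
  exact mul_eq_zero_of_right _ (mul_eq_zero_of_right _ hC)

theorem interp_conj_pairFormula_eq_bot {p : X.At} {b₁ b₂ : Y.At} (hb : b₁ ≠ b₂)
    {k : Form (sixAt p b₁ b₂)}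
    (hk : k ∈ (conj F.pairFormula (equalFormula X Y)).interp (sixAt p b₁ b₂)) : k = 0 := by
  refine (Submodule.mem_bot ℂ).1 (conj_pairFormula_le_iff.2 ?_ hk)
  intro C₁ _ C₂ _ C₃ hC₃ u hu
  rw [Submodule.mem_bot]
  ext w
  obtain ⟨y₂, η₂, y₁, η₁, x', ξ', rfl⟩ := exists_sixVec w
  rw [hu, eq_zero_of_mem_bil_eq hb hC₃]
  exact mul_zero _

theorem ip_eq_zero_of_mem_conj {p : X.At} {b : Y.At} {u k : Form (sixAt p b b)}
    {C₁ : X.space p →ₗ[ℂ] StrongDual ℂ (Y.space b) →ₗ[ℂ] ℂ}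
    {C₂ : StrongDual ℂ (X.space p) →ₗ[ℂ] Y.space b →ₗ[ℂ] ℂ}
    {C₃ : Y.space b →ₗ[ℂ] StrongDual ℂ (Y.space b) →ₗ[ℂ] ℂ} (hu : IsProd u C₁ C₂ C₃)
    (hC : trace C₃ = 0)
    (hk : k ∈ (conj F.pairFormula (equalFormula X Y)).interp (sixAt p b b)) : ip k u = 0 := by
  let T : Submodule ℂ (Form (sixAt p b b)) :=
    { carrier := {k | ip u k = 0}
      add_mem' := fun {f g} hf hg => by
        exact (ip_add_right _ _ _).trans ((congrArg₂ (· + ·) hf hg).trans (add_zero 0))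
      zero_mem' := ip_zero_right u
      smul_mem' := fun c f hf =>
        (ip_smul_right _ _ _).trans ((congrArg (c * ·) hf).trans (mul_zero c)) }
  rw [ip_eq_zero_comm]
  refine (conj_pairFormula_le_iff (T := T)).2 (fun D₁ _ D₂ _ D₃ hD₃ k hk => ?_) hk
  obtain ⟨c, hc⟩ := mem_bil_eq_self.1 hD₃
  exact ip_eq_zero_comm.1 (ip_eq_zero_of_trace_eq_zero hu hk hC hc)

/-- The bilinear functional `(y, η) ↦ l(y) η(y₀)`. -/
def rankOneBil {b₁ b₂ : Y.At} (l : StrongDual ℂ (Y.space b₁)) (y₀ : Y.space b₂) :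
    Y.space b₁ →ₗ[ℂ] StrongDual ℂ (Y.space b₂) →ₗ[ℂ] ℂ :=
  LinearMap.mk₂ ℂ (fun y η => l y * η y₀) (fun y z η => by rw [map_add, add_mul])
    (fun c y η => by rw [map_smul, smul_eq_mul, smul_eq_mul, mul_assoc])
    (fun y η ζ => by rw [add_apply, mul_add])
    (fun c y η => by rw [smul_apply, smul_eq_mul, smul_eq_mul, mul_left_comm])

theorem sum_rankOneBil {b₁ b₂ : Y.At} (l : StrongDual ℂ (Y.space b₁)) (y₀ : Y.space b₂)
    (h : Y.space b₂ →L[ℂ] Y.space b₁) :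
    ∑ j, rankOneBil l y₀ (h (stdOrthonormalBasis ℂ (Y.space b₂) j))
      (InnerProductSpace.toDual ℂ (Y.space b₂) (stdOrthonormalBasis ℂ (Y.space b₂) j)) =
        l (h y₀) := by
  refine (Finset.sum_congr rfl fun j _ => mul_comm _ _).trans
    (sum_inner_mul_apply (l ∘L h : Y.space b₂ →L[ℂ] ℂ).toLinearMap y₀)

/-- For `b₁ = b₂`, splitting `C₃` into a multiple of evaluation and a traceless part separates `u`
into its component in premise and conclusion and the component orthogonal to it. The sentence thus
says that `f g†` pairs to zero with every traceless `C₃`, so it is a scalar. For `b₁ ≠ b₂` there is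
no restriction on `C₃`, so `f g† = 0`. -/
theorem univalenceSentence_isTrue_iff :
    F.univalenceSentence.IsTrue ↔ comp F F.dagger ≤ id Y := by
  rw [univalenceSentence_isTrue_iff_contractAll, comp_dagger_le_id_iff]
  constructor
  · intro H p b c f hf g hg
    have hC₂ : ∃ C₂ : StrongDual ℂ (X.space p) →ₗ[ℂ] Y.space b →ₗ[ℂ] ℂ,
        ∀ ξ y, C₂ ξ y = ξ (ContinuousLinearMap.adjoint g y) :=
      ⟨(bendBil (ContinuousLinearMap.adjoint g)).flip, fun _ _ => rfl⟩
    obtain ⟨C₂, hC₂⟩ := hC₂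
    have hmem (C₃ u) (hu : IsProd (b₁ := c) u (bendBil f) C₂ C₃) :
        u ∈ F.pairFormula.interp (sixAt p c b) :=
      pairFormula_le_iff.1 le_rfl _ (mem_bil_bend.2 ⟨f, hf, fun _ _ => rfl⟩) _
        (mem_bil_bend_conjugate.2 ⟨g, hg, hC₂⟩) C₃ u hu
    by_cases hcb : c = b
    · subst hcb
      set h := f ∘L ContinuousLinearMap.adjoint g with hh
      have hd : (Module.finrank ℂ (Y.space c) : ℂ) ≠ 0 :=
        Nat.cast_ne_zero.2 Module.finrank_pos.ne'
      rw [mem_id_self]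
      let t : ℂ := ∑ j, InnerProductSpace.toDual ℂ (Y.space c)
        (stdOrthonormalBasis ℂ (Y.space c) j) (h (stdOrthonormalBasis ℂ (Y.space c) j))
      refine ⟨t / Module.finrank ℂ (Y.space c), ContinuousLinearMap.ext fun y₀ => ?_⟩
      refine sub_eq_zero.1 (eq_zero_of_forall_dual fun l => ?_)
      -- With the traceless part of `l ⊗ y₀` as third factor, the vanishing contraction reads `l (h
      -- y₀) = (tr h / dim) · l y₀`.
      obtain ⟨u, hu⟩ := exists_isProd (bendBil f) C₂ (rankOneBil l y₀ -
        (trace (rankOneBil l y₀) / Module.finrank ℂ (Y.space c)) • evalBil c)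
      have h0 := H p c c u (hmem _ u hu) fun k hk =>
        ip_eq_zero_of_mem_conj hu (trace_sub_trace_smul _) hk
      rw [contractAll_of_isProd hu (f := f) (fun _ _ => rfl) hC₂, ← hh] at h0
      have ht : trace (rankOneBil l y₀) = l y₀ := sum_rankOneBil l y₀ 1
      simp only [LinearMap.sub_apply, LinearMap.smul_apply, Finset.sum_sub_distrib, smul_eq_mul,
        ← Finset.mul_sum, sum_rankOneBil, evalBil_apply, ht] at h0
      rw [map_sub, ← h0]
      congr 1
      rw [smul_apply, map_smul, smul_eq_mul]
      change t / _ * l y₀ = l y₀ / _ * t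
      ring
    · rw [mem_id_of_ne (Ne.symm hcb)]
      refine ContinuousLinearMap.ext fun y₀ => eq_zero_of_forall_dual fun l => ?_
      obtain ⟨u, hu⟩ := exists_isProd (bendBil f) C₂ (rankOneBil l y₀)
      have h0 := H p c b u (hmem _ u hu) fun k hk => by
        rw [interp_conj_pairFormula_eq_bot hcb hk, ip_zero_left]
      rwa [contractAll_of_isProd hu (f := f) (fun _ _ => rfl) hC₂, sum_rankOneBil] at h0
  · intro H p b₁ b₂ u hu hk
    let A := (conj F.pairFormula (equalFormula X Y)).interp (sixAt p b₁ b₂)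
    -- `T` collects the functionals whose component orthogonal to `A` has zero contraction. This is
    -- a linear condition, so it can be checked on products.
    let T : Submodule ℂ (Form (sixAt p b₁ b₂)) :=
      { carrier := {u | ∃ u₁ ∈ A, (∀ k ∈ A, ip k (u - u₁) = 0) ∧ contractAll (u - u₁) = 0}
        add_mem' := by
          rintro u u' ⟨w, hw, h1, h2⟩ ⟨w', hw', h1', h2'⟩
          refine ⟨w + w', Submodule.add_mem _ hw hw', fun k hk => ?_, ?_⟩
          · rw [add_sub_add_comm, ip_add_right, h1 k hk, h1' k hk, add_zero]
          · rw [add_sub_add_comm, map_add, h2, h2', add_zero]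
        zero_mem' := ⟨0, Submodule.zero_mem _, fun k _ => by rw [sub_zero, ip_zero_right], by
          rw [sub_zero, map_zero]⟩
        smul_mem' := by
          rintro c u ⟨w, hw, h1, h2⟩
          refine ⟨c • w, Submodule.smul_mem _ c hw, fun k hk => ?_, ?_⟩
          · rw [← smul_sub, ip_smul_right, h1 k hk, mul_zero]
          · rw [← smul_sub, map_smul, h2, smul_zero] }
    have hT : F.pairFormula.interp (sixAt p b₁ b₂) ≤ T := by
      refine pairFormula_le_iff.2 fun C₁ hC₁ C₂ hC₂ C₃ u hu => ?_
      obtain ⟨f, hf, h₁⟩ := mem_bil_bend.1 hC₁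
      obtain ⟨g, hg, h₂⟩ := mem_bil_bend_conjugate.1 hC₂
      have hfg := H p b₂ b₁ f hf g hg
      by_cases hb : b₁ = b₂
      · subst hb
        obtain ⟨c, hc⟩ := mem_id_self.1 hfg
        obtain ⟨u₁, hu₁⟩ := exists_isProd C₁ C₂
          ((trace C₃ / Module.finrank ℂ (Y.space b₁)) • evalBil b₁)
        have hu₂ : IsProd (u - u₁) C₁ C₂
            (C₃ - (trace C₃ / Module.finrank ℂ (Y.space b₁)) • evalBil b₁) := by
          intro y₂ η₂ y₁ η₁ x ξ
          rw [sub_apply, hu, hu₁, LinearMap.sub_apply, LinearMap.sub_apply, mul_sub]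
        have ht := trace_sub_trace_smul C₃
        refine ⟨u₁, conj_pairFormula_le_iff.1 le_rfl C₁ hC₁ C₂ hC₂ _
          (mem_bil_eq_self.2 ⟨_, fun _ _ => rfl⟩) u₁ hu₁,
          fun k hk => ip_eq_zero_of_mem_conj hu₂ ht hk, ?_⟩
        rw [contractAll_of_isProd hu₂ h₁ h₂, hc]
        exact (sum_smul_one _ c).trans (mul_eq_zero_of_right c ht)
      · refine ⟨0, Submodule.zero_mem _, fun k hk => ?_, ?_⟩
        · rw [interp_conj_pairFormula_eq_bot hb hk, ip_zero_left]
        · rw [sub_zero, contractAll_of_isProd hu h₁ h₂, (mem_id_of_ne (Ne.symm hb)).1 hfg]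
          refine Finset.sum_eq_zero fun j _ => ?_
          rw [zero_apply, map_zero]
          rfl
    obtain ⟨u₁, hu₁, h1, h2⟩ := hT hu
    have h3 : ip u₁ u₁ = 0 := by
      have := h1 u₁ hu₁
      rwa [ip_sub_right, hk u₁ hu₁, zero_sub, neg_eq_zero] at this
    rwa [ip_self_eq_zero.1 h3, sub_zero] at h2

end BinRel
end QSet

namespace QSet
open ContinuousLinearMap (adjoint)

/-! ### Elements of `ℓ^∞` -/

namespace Linfty

variable {X : QSet.{u, v}}

theorem add_apply (c d : X.Linfty) (p : X.At) : (c + d) p = c p + d p := rfl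

theorem sub_apply (c d : X.Linfty) (p : X.At) : (c - d) p = c p - d p := rfl

theorem smul_apply (r : ℂ) (c : X.Linfty) (p : X.At) : (r • c) p = r • c p := rfl

theorem mul_apply (c d : X.Linfty) (p : X.At) : (c * d) p = c p * d p := rfl

theorem one_apply (p : X.At) : (1 : X.Linfty) p = 1 := rfl

theorem zero_apply (p : X.At) : (0 : X.Linfty) p = 0 := rfl

theorem star_apply (c : X.Linfty) (p : X.At) : (star c) p = adjoint (c p) := rfl

open Classical in
/-- The element with one given component, extended by `0`. -/
def single (p : X.At) (t : X.space p →L[ℂ] X.space p) : X.Linfty := lp.single ∞ p t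

theorem single_self (p : X.At) (t : X.space p →L[ℂ] X.space p) : single p t p = t := by
  classical exact lp.single_apply_self _ _ _

theorem single_of_ne {p q : X.At} (h : q ≠ p) (t : X.space p →L[ℂ] X.space p) :
    single p t q = 0 := by
  classical exact lp.single_apply_ne _ _ _ h

theorem norm_apply_le (c : X.Linfty) (p : X.At) : ‖c p‖ ≤ ‖c‖ :=
  lp.norm_apply_le_norm (by simp) c p

/-- A uniformly bounded family of operators. -/
def ofBounded (t : ∀ p, X.space p →L[ℂ] X.space p) (C : ℝ) (h : ∀ p, ‖t p‖ ≤ C) : X.Linfty :=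
  ⟨t, memℓp_infty ⟨C, by rintro _ ⟨p, rfl⟩; exact h p⟩⟩

theorem ext {c d : X.Linfty} (h : ∀ p, c p = d p) : c = d := lp.ext (funext h)

end Linfty

/-! ### Functions as total relations with `F ∘ F† ≤ I` -/

namespace BinRel

variable {X Y : QSet.{u, v}} {F : BinRel X Y}

/-- Schur's lemma. On one atom, the operators `|y⟩⟨e|` applied at `e` give `⟪e, e⟫ t y = ⟪e, t e⟫
y`; for distinct atoms the unit of the first atom kills `t`. -/
theorem mem_id_of_intertwines {b b' : Y.At} {t : Y.space b →L[ℂ] Y.space b'}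
    (h : ∀ c : Y.Linfty, c b' ∘L t = t ∘L c b) : t ∈ id Y b b' := by
  by_cases hb : b = b'
  · subst hb
    rw [mem_id_self]
    obtain ⟨e, he⟩ := exists_ne (0 : Y.space b)
    refine ⟨inner ℂ e (t e) / inner ℂ e e, ContinuousLinearMap.ext fun y => ?_⟩
    have h1 := DFunLike.congr_fun
      (h (Linfty.single b ((innerSL ℂ e : Y.space b →L[ℂ] ℂ).smulRight y))) e
    rw [Linfty.single_self] at h1
    simp only [ContinuousLinearMap.comp_apply, ContinuousLinearMap.smulRight_apply,
      innerSL_apply_apply, map_smul] at h1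
    have he' : (inner ℂ e e : ℂ) ≠ 0 := inner_self_ne_zero.2 he
    change t y = (inner ℂ e (t e) / inner ℂ e e : ℂ) • y
    rw [div_eq_inv_mul, mul_smul, h1, smul_smul, inv_mul_cancel₀ he', one_smul]
  · rw [mem_id_of_ne hb]
    have h1 := h (Linfty.single b 1)
    rw [Linfty.single_self, Linfty.single_of_ne (Ne.symm hb)] at h1
    exact h1.symm.trans (ContinuousLinearMap.zero_comp t)

/-- The relation has trivial common kernel at each atom. -/
def IsTotal (F : BinRel X Y) : Prop :=
  ∀ (p : X.At) (x : X.space p), (∀ b, ∀ f ∈ F p b, f x = 0) → x = 0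

/-- In `f g† k` the factor `f g†` is a scalar or zero, so what remains is a multiple of `k ∈ F` or
zero. -/
theorem comp_comp_mem (hF : comp F F.dagger ≤ id Y) {p : X.At} {b : Y.At}
    {f : X.space p →L[ℂ] Y.space b} (hf : f ∈ F p b) {h : X.space p →L[ℂ] X.space p}
    (hh : h ∈ comp F.dagger F p p) : f ∘L h ∈ F p b := by
  induction hh using Submodule.span_induction with
  | mem h hh =>
    obtain ⟨b', _, hg', k, hk, rfl⟩ := hh
    obtain ⟨g, hg, rfl⟩ := mem_dagger.1 hg'
    have h1 := comp_dagger_le_id_iff.1 hF p b' b f hf g hg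
    rw [← ContinuousLinearMap.comp_assoc]
    by_cases hb : b' = b
    · subst hb
      obtain ⟨c, hc⟩ := mem_id_self.1 h1
      rw [hc]
      exact Submodule.smul_mem _ c hk
    · rw [(mem_id_of_ne hb).1 h1, ContinuousLinearMap.zero_comp]
      exact Submodule.zero_mem _
  | zero => rw [ContinuousLinearMap.comp_zero]; exact Submodule.zero_mem _
  | add h k _ _ h1 h2 => rw [ContinuousLinearMap.comp_add]; exact Submodule.add_mem _ h1 h2
  | smul c h _ h1 => rw [ContinuousLinearMap.comp_smul]; exact Submodule.smul_mem _ c h1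

theorem mul_mem_dagger_comp (hF : comp F F.dagger ≤ id Y) {p : X.At}
    {h k : X.space p →L[ℂ] X.space p} (hh : h ∈ comp F.dagger F p p)
    (hk : k ∈ comp F.dagger F p p) : h ∘L k ∈ comp F.dagger F p p := by
  induction hh using Submodule.span_induction with
  | mem h hh =>
    obtain ⟨b, g, hg, f, hf, rfl⟩ := hh
    exact Submodule.subset_span ⟨b, g, hg, f ∘L k, comp_comp_mem hF hf hk, rfl⟩
  | zero => rw [ContinuousLinearMap.zero_comp]; exact Submodule.zero_mem _
  | add h k _ _ h1 h2 => rw [ContinuousLinearMap.add_comp]; exact Submodule.add_mem _ h1 h2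
  | smul c h _ h1 => rw [ContinuousLinearMap.smul_comp]; exact Submodule.smul_mem _ c h1

/-- Choose a positive-type element with minimal kernel. If some `f ∈ F` did not vanish on this
kernel, adding `f†f` would make the kernel strictly smaller. -/
theorem exists_injective_mem (ht : F.IsTotal) (p : X.At) :
    ∃ Q ∈ comp F.dagger F p p, ∀ x, Q x = 0 → x = 0 := by
  -- This substitute for positivity survives the addition of `f†f` and makes the kernel of the sum
  -- the intersection of the kernels.
  let A : Set (X.space p →L[ℂ] X.space p) := {Q | Q ∈ comp F.dagger F p p ∧
    ∀ x, 0 ≤ (inner ℂ x (Q x)).re ∧ ((inner ℂ x (Q x)).re = 0 → Q x = 0)}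
  have h0 : (0 : X.space p →L[ℂ] X.space p) ∈ A :=
    ⟨Submodule.zero_mem _, fun x => ⟨by simp, fun _ => rfl⟩⟩
  obtain ⟨K, ⟨Q, hQ, rfl⟩, hmin⟩ := (wellFounded_lt (α := Submodule ℂ (X.space p))).has_min
    ((fun Q => LinearMap.ker Q.toLinearMap) '' A) ⟨_, 0, h0, rfl⟩
  refine ⟨Q, hQ.1, fun x hx => ht p x fun b f hf => ?_⟩
  by_contra hfx
  have hre (y : X.space p) : (inner ℂ y ((Q + adjoint f ∘L f) y)).re =
      (inner ℂ y (Q y)).re + ‖f y‖ ^ 2 := by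
    rw [_root_.add_apply, inner_add_right, Complex.add_re, ContinuousLinearMap.comp_apply,
      ContinuousLinearMap.adjoint_inner_right]
    congr 1
    exact inner_self_eq_norm_sq (𝕜 := ℂ) _
  have hzero (y : X.space p) (hy : (inner ℂ y ((Q + adjoint f ∘L f) y)).re = 0) :
      Q y = 0 ∧ f y = 0 := by
    rw [hre] at hy
    have h1 := (hQ.2 y).1
    have h2 := sq_nonneg ‖f y‖
    refine ⟨(hQ.2 y).2 (by linarith), norm_eq_zero.1 (pow_eq_zero_iff two_ne_zero |>.1 ?_)⟩
    linarith
  have hQ' : Q + adjoint f ∘L f ∈ A := by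
    refine ⟨Submodule.add_mem _ hQ.1
      (Submodule.subset_span ⟨b, _, mem_dagger.2 ⟨f, hf, rfl⟩, f, hf, rfl⟩), fun y => ⟨?_, ?_⟩⟩
    · rw [hre]
      exact add_nonneg (hQ.2 y).1 (sq_nonneg _)
    · intro hy
      obtain ⟨h1, h2⟩ := hzero y hy
      rw [_root_.add_apply, h1, ContinuousLinearMap.comp_apply, h2, map_zero, add_zero]
  have hker (y : X.space p) (hy : (Q + adjoint f ∘L f) y = 0) : Q y = 0 ∧ f y = 0 :=
    hzero y (by rw [hy, inner_zero_right, Complex.zero_re])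
  refine hmin _ ⟨_, hQ', rfl⟩ (lt_of_le_of_ne (fun y hy => (hker y hy).1) fun heq => hfx ?_)
  have : x ∈ LinearMap.ker (Q + adjoint f ∘L f).toLinearMap := (le_of_eq heq.symm) hx
  exact (hker x this).2

/-- Left multiplication by an injective `Q` is an injective endomorphism of a finite-dimensional
space, hence surjective. A solution of `QR = Q` must be `R = 1`. -/
theorem one_mem_dagger_comp (ht : F.IsTotal) (hF : comp F F.dagger ≤ id Y) (p : X.At) :
    (1 : X.space p →L[ℂ] X.space p) ∈ comp F.dagger F p p := by
  obtain ⟨Q, hQ, hinj⟩ := exists_injective_mem ht p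
  let L : comp F.dagger F p p →ₗ[ℂ] comp F.dagger F p p :=
    { toFun h := ⟨Q ∘L h.1, mul_mem_dagger_comp hF hQ h.2⟩
      map_add' h k := Subtype.ext (ContinuousLinearMap.comp_add _ _ _)
      map_smul' c h := Subtype.ext (ContinuousLinearMap.comp_smul _ _ _) }
  have hL : Function.Injective L := by
    rw [injective_iff_map_eq_zero]
    intro h hh
    refine Subtype.ext (ContinuousLinearMap.ext fun x => hinj _ ?_)
    exact DFunLike.congr_fun (congrArg Subtype.val hh) x
  obtain ⟨R, hR⟩ := LinearMap.injective_iff_surjective.1 hL ⟨Q, hQ⟩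
  have : R.1 = 1 := by
    refine ContinuousLinearMap.ext fun x => sub_eq_zero.1 (hinj _ ?_)
    rw [map_sub, sub_eq_zero]
    exact DFunLike.congr_fun (congrArg Subtype.val hR) x
  rw [← this]
  exact R.2

theorem isFunction_iff : F.IsFunction ↔ F.IsTotal ∧ comp F F.dagger ≤ id Y := by
  constructor
  · rintro ⟨h1, h2⟩
    refine ⟨fun p x hx => ?_, h2⟩
    have hone : (1 : X.space p →L[ℂ] X.space p) ∈ comp F.dagger F p p :=
      h1 p p (mem_id_self.2 ⟨1, (one_smul ℂ _).symm⟩)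
    have key : ∀ h ∈ comp F.dagger F p p, h x = 0 := by
      intro h hh
      induction hh using Submodule.span_induction with
      | mem h hh =>
        obtain ⟨b, g, hg, f, hf, rfl⟩ := hh
        rw [ContinuousLinearMap.comp_apply, hx b f hf, map_zero]
      | zero => rfl
      | add h k _ _ h1 h2 => rw [_root_.add_apply, h1, h2, add_zero]
      | smul c h _ h1 => rw [_root_.smul_apply, h1, smul_zero]
    exact key 1 hone
  · rintro ⟨ht, h2⟩
    refine ⟨fun p q f hf => ?_, h2⟩
    by_cases hpq : p = q
    · subst hpq
      obtain ⟨c, rfl⟩ := mem_id_self.1 hf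
      exact Submodule.smul_mem _ c (one_mem_dagger_comp ht h2 p)
    · rw [(mem_id_of_ne hpq).1 hf]
      exact Submodule.zero_mem _

/-! ### The homomorphism of a function -/

theorem IsTotal.ext (ht : F.IsTotal) {p : X.At} {V : Type*} [NormedAddCommGroup V]
    [InnerProductSpace ℂ V] {s t : V →L[ℂ] X.space p} (h : ∀ b, ∀ f ∈ F p b, f ∘L s = f ∘L t) :
    s = t :=
  ContinuousLinearMap.ext fun x => sub_eq_zero.1 (ht p _ fun b f hf => by
    rw [map_sub, sub_eq_zero]
    exact DFunLike.congr_fun (h b f hf) x)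

theorem exists_pullback (ht : F.IsTotal) (hF : comp F F.dagger ≤ id Y) (c : Y.Linfty) (p : X.At) :
    ∃ T : X.space p →L[ℂ] X.space p, ∀ b, ∀ f ∈ F p b, c b ∘L f = f ∘L T := by
  have key : ∀ h ∈ comp F.dagger F p p, ∃ T : X.space p →L[ℂ] X.space p,
      ∀ b, ∀ f ∈ F p b, (c b ∘L f) ∘L h = f ∘L T := by
    intro h hh
    induction hh using Submodule.span_induction with
    | mem h hh =>
      obtain ⟨b', _, hg', k, hk, rfl⟩ := hh
      obtain ⟨g, hg, rfl⟩ := mem_dagger.1 hg'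
      -- As `f g†` is a scalar or vanishes, `c` can be moved past it: `c f g† k = f g† c k`.
      refine ⟨adjoint g ∘L c b' ∘L k, fun b f hf => ?_⟩
      have h1 := comp_dagger_le_id_iff.1 hF p b' b f hf g hg
      have h2 : (c b ∘L f) ∘L adjoint g ∘L k = c b ∘L (f ∘L adjoint g) ∘L k := rfl
      have h3 : f ∘L adjoint g ∘L c b' ∘L k = (f ∘L adjoint g) ∘L c b' ∘L k := rfl
      rw [h2, h3]
      by_cases hb : b' = b
      · subst hb
        obtain ⟨r, hr⟩ := mem_id_self.1 h1
        rw [hr, ContinuousLinearMap.smul_comp, ContinuousLinearMap.smul_comp,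
          ContinuousLinearMap.comp_smul]
        rfl
      · rw [(mem_id_of_ne hb).1 h1, ContinuousLinearMap.zero_comp, ContinuousLinearMap.zero_comp,
          ContinuousLinearMap.comp_zero]
    | zero => exact ⟨0, fun b f _ => by
        rw [ContinuousLinearMap.comp_zero, ContinuousLinearMap.comp_zero]⟩
    | add h k _ _ h1 h2 =>
      obtain ⟨T, hT⟩ := h1
      obtain ⟨T', hT'⟩ := h2
      exact ⟨T + T', fun b f hf => by
        rw [ContinuousLinearMap.comp_add, ContinuousLinearMap.comp_add, hT b f hf, hT' b f hf]⟩
    | smul r h _ h1 =>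
      obtain ⟨T, hT⟩ := h1
      exact ⟨r • T, fun b f hf => by
        rw [ContinuousLinearMap.comp_smul, ContinuousLinearMap.comp_smul, hT b f hf]⟩
  exact key 1 (one_mem_dagger_comp ht hF p)

/-- For `h = g†f` both sides equal `g† c f`. With `h = 1` this shows that the pullback of `star c`
is the adjoint of that of `c`. -/
theorem adjoint_comp_comm {c : Y.Linfty} {p : X.At} {T T' : X.space p →L[ℂ] X.space p}
    (hT : ∀ b, ∀ f ∈ F p b, c b ∘L f = f ∘L T)
    (hT' : ∀ b, ∀ f ∈ F p b, (star c) b ∘L f = f ∘L T') {h : X.space p →L[ℂ] X.space p}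
    (hh : h ∈ comp F.dagger F p p) : h ∘L T = adjoint T' ∘L h := by
  induction hh using Submodule.span_induction with
  | mem h hh =>
    obtain ⟨b, _, hg', f, hf, rfl⟩ := hh
    obtain ⟨g, hg, rfl⟩ := mem_dagger.1 hg'
    have h1 : adjoint T' ∘L adjoint g = adjoint g ∘L c b := by
      rw [← ContinuousLinearMap.adjoint_comp, ← hT' b g hg, Linfty.star_apply,
        ContinuousLinearMap.adjoint_comp, ContinuousLinearMap.adjoint_adjoint]
    rw [← ContinuousLinearMap.comp_assoc, h1, ContinuousLinearMap.comp_assoc, ← hT b f hf]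
    rfl
  | zero => rw [ContinuousLinearMap.zero_comp, ContinuousLinearMap.comp_zero]
  | add h k _ _ h1 h2 =>
    rw [ContinuousLinearMap.add_comp, ContinuousLinearMap.comp_add, h1, h2]
  | smul r h _ h1 => rw [ContinuousLinearMap.smul_comp, ContinuousLinearMap.comp_smul, h1]

/-- The component at an atom of the homomorphism of a function. -/
def starComponent (ht : F.IsTotal) (hF : comp F F.dagger ≤ id Y) (p : X.At) :
    Y.Linfty →⋆ₐ[ℂ] (X.space p →L[ℂ] X.space p) where
  toFun c := (exists_pullback ht hF c p).choose
  map_one' := ht.ext fun b f hf => by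
    rw [← (exists_pullback ht hF 1 p).choose_spec b f hf]
    rfl
  map_mul' c d := ht.ext fun b f hf => by
    rw [← (exists_pullback ht hF (c * d) p).choose_spec b f hf, ContinuousLinearMap.mul_def,
      ← ContinuousLinearMap.comp_assoc, ← (exists_pullback ht hF c p).choose_spec b f hf,
      ContinuousLinearMap.comp_assoc, ← (exists_pullback ht hF d p).choose_spec b f hf]
    rfl
  map_zero' := ht.ext fun b f hf => by
    rw [← (exists_pullback ht hF 0 p).choose_spec b f hf, ContinuousLinearMap.comp_zero]
    exact ContinuousLinearMap.zero_comp f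
  map_add' c d := ht.ext fun b f hf => by
    rw [← (exists_pullback ht hF (c + d) p).choose_spec b f hf, ContinuousLinearMap.comp_add,
      ← (exists_pullback ht hF c p).choose_spec b f hf,
      ← (exists_pullback ht hF d p).choose_spec b f hf]
    exact ContinuousLinearMap.add_comp _ _ _
  commutes' r := ht.ext fun b f hf => by
    rw [← (exists_pullback ht hF _ p).choose_spec b f hf, Algebra.algebraMap_eq_smul_one,
      Algebra.algebraMap_eq_smul_one, ContinuousLinearMap.comp_smul]
    rfl
  map_star' c := by
    have := adjoint_comp_comm (exists_pullback ht hF c p).choose_spec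
      (exists_pullback ht hF (star c) p).choose_spec (one_mem_dagger_comp ht hF p)
    have h2 : (exists_pullback ht hF c p).choose =
      adjoint (exists_pullback ht hF (star c) p).choose := this
    rw [h2, ContinuousLinearMap.star_eq_adjoint, ContinuousLinearMap.adjoint_adjoint]

theorem starComponent_spec (ht : F.IsTotal) (hF : comp F F.dagger ≤ id Y) {p : X.At} {b : Y.At}
    {f : X.space p →L[ℂ] Y.space b} (hf : f ∈ F p b) (c : Y.Linfty) :
    c b ∘L f = f ∘L starComponent ht hF p c :=
  (exists_pullback ht hF c p).choose_spec b f hf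

/-- The homomorphism `F^⋆` of a function `F`. -/
def starHom (ht : F.IsTotal) (hF : comp F F.dagger ≤ id Y) : Y.Linfty →⋆ₐ[ℂ] X.Linfty where
  -- Every component is a `*`-homomorphism of C*-algebras, hence contractive, which bounds the
  -- family uniformly.
  toFun c := Linfty.ofBounded (fun p => starComponent ht hF p c) ‖c‖ fun p =>
    NonUnitalStarAlgHom.norm_apply_le (starComponent ht hF p) c
  map_one' := Linfty.ext fun p => map_one (starComponent ht hF p)
  map_mul' c d := Linfty.ext fun p => map_mul (starComponent ht hF p) c d
  map_zero' := Linfty.ext fun p => map_zero (starComponent ht hF p)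
  map_add' c d := Linfty.ext fun p => map_add (starComponent ht hF p) c d
  commutes' r := Linfty.ext fun p => AlgHomClass.commutes (starComponent ht hF p) r
  map_star' c := Linfty.ext fun p => map_star (starComponent ht hF p) c

theorem isStar_starHom (ht : F.IsTotal) (hF : comp F F.dagger ≤ id Y) :
    F.IsStar (starHom ht hF) := fun _ _ _ hf c => starComponent_spec ht hF hf c

theorem IsStar.unique (ht : F.IsTotal) {φ ψ : Y.Linfty →⋆ₐ[ℂ] X.Linfty} (h : F.IsStar φ)
    (h' : F.IsStar ψ) : φ = ψ :=
  StarAlgHom.ext fun c => Linfty.ext fun p => ht.ext fun b f hf => by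
    rw [← h p b f hf c, h' p b f hf c]

end BinRel
end QSet

/-! ### Order, normality and the relation of a homomorphism -/

namespace QSet
open ContinuousLinearMap (adjoint)
open Filter Topology

variable {X Y : QSet.{u, v}}

theorem LoewnerLE.refl (b : X.Linfty) : LoewnerLE b b := fun a => by
  rw [sub_self]
  exact ContinuousLinearMap.isPositive_zero

theorem LoewnerLE.trans {b c d : X.Linfty} (h : LoewnerLE b c) (h' : LoewnerLE c d) :
    LoewnerLE b d := fun a => by
  rw [← sub_add_sub_cancel]
  exact (h' a).add (h a)

theorem LoewnerLE.exists_star_mul {b c : X.Linfty} (h : LoewnerLE b c) :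
    ∃ r : X.Linfty, c - b = star r * r := by
  let t (a : X.At) : X.space a →L[ℂ] X.space a := CFC.sqrt (c a - b a)
  have ht (a : X.At) : adjoint (t a) ∘L t a = c a - b a := by
    have h1 : 0 ≤ c a - b a := (ContinuousLinearMap.nonneg_iff_isPositive _).2 (h a)
    have h2 : adjoint (t a) = t a := (IsSelfAdjoint.of_nonneg (CFC.sqrt_nonneg (c a - b a))).star_eq
    rw [h2]
    exact CFC.sqrt_mul_sqrt_self _ h1
  -- The C*-identity bounds `‖t a‖ ^ 2` by `‖c - b‖`, and a number whose square is at most `N` is at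
  -- most `N + 1`.
  refine ⟨Linfty.ofBounded t (‖c - b‖ + 1) fun a => ?_, Linfty.ext fun a => (ht a).symm⟩
  have h1 : ‖t a‖ * ‖t a‖ = ‖(c - b) a‖ := by
    rw [← CStarRing.norm_star_mul_self]
    exact congrArg norm (ht a)
  have h2 := Linfty.norm_apply_le (c - b) a
  nlinarith [norm_nonneg (t a)]

theorem LoewnerLE.map (φ : Y.Linfty →⋆ₐ[ℂ] X.Linfty) {b c : Y.Linfty} (h : LoewnerLE b c) :
    LoewnerLE (φ b) (φ c) := by
  obtain ⟨r, hr⟩ := h.exists_star_mul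
  intro a
  have : φ c a - φ b a = adjoint (φ r a) ∘L φ r a := by
    rw [← Linfty.sub_apply, ← map_sub, hr, map_mul, map_star]
    rfl
  rw [this]
  exact ContinuousLinearMap.isPositive_adjoint_comp_self _

theorem isPositive_of_tendsto {E ι : Type*} [NormedAddCommGroup E] [InnerProductSpace ℂ E]
    [CompleteSpace E] {l : Filter ι} [l.NeBot] {t : ι → E →L[ℂ] E} {s : E →L[ℂ] E}
    (h : Tendsto t l (𝓝 s)) (ht : ∀ᶠ i in l, (t i).IsPositive) : s.IsPositive := by
  rw [← ContinuousLinearMap.nonneg_iff_isPositive]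
  exact ge_of_tendsto h (ht.mono fun i hi => (ContinuousLinearMap.nonneg_iff_isPositive _).2 hi)

theorem DirectedOn.exists_ultrafilter {S : Set Y.Linfty} (hS : S.Nonempty)
    (hdir : DirectedOn LoewnerLE S) :
    ∃ U : Ultrafilter S, ∀ c : S, ∀ᶠ d in (U : Filter S), LoewnerLE c.1 d.1 := by
  let _ : Preorder S :=
    { le c d := LoewnerLE c.1 d.1
      le_refl c := LoewnerLE.refl c.1
      le_trans _ _ _ h h' := LoewnerLE.trans h h' }
  have _ : Nonempty S := hS.to_subtype
  have _ : IsDirectedOrder S := ⟨fun c d => by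
    obtain ⟨e, he, h1, h2⟩ := hdir c.1 c.2 d.1 d.2
    exact ⟨⟨e, he⟩, h1, h2⟩⟩
  exact ⟨Ultrafilter.of atTop, fun c => Ultrafilter.of_le _ (eventually_ge_atTop c)⟩

theorem exists_tendsto_of_bounded {E ι : Type*} [NormedAddCommGroup E] [InnerProductSpace ℂ E]
    [FiniteDimensional ℂ E] [CompleteSpace E] (U : Ultrafilter ι) {t : ι → E →L[ℂ] E}
    {r s : E →L[ℂ] E} (h : ∀ᶠ i in (U : Filter ι), (t i - r).IsPositive ∧ (s - t i).IsPositive) :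
    ∃ l, Tendsto t U (𝓝 l) := by
  have _ : ProperSpace (E →L[ℂ] E) := FiniteDimensional.proper ℂ _
  have hbdd : ∀ᶠ i in (U : Filter ι), t i ∈ Metric.closedBall r ‖s - r‖ := by
    refine h.mono fun i hi => ?_
    rw [mem_closedBall_iff_norm]
    refine CStarAlgebra.norm_le_norm_of_nonneg_of_le
      ((ContinuousLinearMap.nonneg_iff_isPositive _).2 hi.1) ?_
    rw [ContinuousLinearMap.le_def, sub_sub_sub_cancel_right]
    exact hi.2
  obtain ⟨l, -, hl⟩ := (isCompact_closedBall r ‖s - r‖).ultrafilter_le_nhds' (U.map t) hbdd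
  exact ⟨l, hl⟩

/-- A directed set with a supremum converges to it along an ultrafilter, in each component. -/
theorem IsSup.exists_ultrafilter {S : Set Y.Linfty} {s : Y.Linfty} (hS : S.Nonempty)
    (hdir : DirectedOn LoewnerLE S) (hs : IsSup S s) :
    ∃ U : Ultrafilter S, ∀ b, Tendsto (fun c : S => c.1 b) U (𝓝 (s b)) := by
  obtain ⟨U, hU⟩ := DirectedOn.exists_ultrafilter hS hdir
  refine ⟨U, fun b => ?_⟩
  obtain ⟨c₀, hc₀⟩ := hS
  obtain ⟨t, ht⟩ := exists_tendsto_of_bounded U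
    ((hU ⟨c₀, hc₀⟩).mono fun c hc => ⟨hc b, hs.1 c.1 c.2 b⟩)
  have h1 (c : S) : (t - c.1 b).IsPositive :=
    isPositive_of_tendsto (ht.sub_const (c.1 b)) ((hU c).mono fun d hd => hd b)
  have h2 : (s b - t).IsPositive :=
    isPositive_of_tendsto (ht.const_sub (s b)) (Eventually.of_forall fun c => hs.1 c.1 c.2 b)
  have h3 : (t - s b).IsPositive := by
    -- Replacing the component of `s` at `b` by the limit `t` gives another upper bound, so `s b ≤
    -- t`.
    have := hs.2 (s + Linfty.single b (t - s b)) (fun c hc a => ?_) b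
    · rw [Linfty.add_apply, Linfty.single_self] at this
      simpa using this
    · by_cases hab : a = b
      · subst hab
        rw [Linfty.add_apply, Linfty.single_self, add_sub_cancel]
        exact h1 ⟨c, hc⟩
      · rw [Linfty.add_apply, Linfty.single_of_ne hab, add_zero]
        exact hs.1 c hc a
  have : t = s b := le_antisymm ((ContinuousLinearMap.le_def _ _).2 h2)
    ((ContinuousLinearMap.le_def _ _).2 h3)
  rw [← this]
  exact ht

namespace BinRel

variable {F : BinRel X Y}

/-- Since `1 = ∑ g†f`, the component of `φ(c)` at `p` is the finite sum `∑ g† c f` and depends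
continuously on finitely many components of `c`. So `φ(c)` converges to `φ(s)` in each component,
and upper bounds pass to the limit. -/
theorem isNormal_of_isStar (hF : F.IsFunction) {φ : Y.Linfty →⋆ₐ[ℂ] X.Linfty} (h : F.IsStar φ) :
    IsNormal φ := by
  obtain ⟨ht, hF⟩ := isFunction_iff.1 hF
  intro S s hS hdir _ hs
  obtain ⟨U, hU⟩ := hs.exists_ultrafilter hS hdir
  refine ⟨?_, fun d hd p => ?_⟩
  · rintro _ ⟨c, hc, rfl⟩
    exact LoewnerLE.map φ (hs.1 c hc)
  · have key : ∀ k ∈ comp F.dagger F p p,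
        Tendsto (fun c : S => k ∘L φ c.1 p) U (𝓝 (k ∘L φ s p)) := by
      intro k hk
      induction hk using Submodule.span_induction with
      | mem k hk =>
        obtain ⟨b, g, _, f, hf, rfl⟩ := hk
        have h1 (c : Y.Linfty) : (g ∘L f) ∘L φ c p = g ∘L c b ∘L f := by
          rw [ContinuousLinearMap.comp_assoc, ← h p b f hf]
        simp only [h1]
        have hc : Continuous fun t : Y.space b →L[ℂ] Y.space b => g ∘L t ∘L f := by fun_prop
        exact (hc.tendsto _).comp (hU b)
      | zero => simp only [ContinuousLinearMap.zero_comp]; exact tendsto_const_nhds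
      | add k l _ _ h1 h2 => simp only [ContinuousLinearMap.add_comp]; exact h1.add h2
      | smul r k _ h1 => simp only [ContinuousLinearMap.smul_comp]; exact h1.const_smul r
    have h1 : Tendsto (fun c : S => φ c.1 p) U (𝓝 (φ s p)) :=
      key 1 (one_mem_dagger_comp ht hF p)
    exact isPositive_of_tendsto (h1.const_sub (d p))
      (Eventually.of_forall fun c => hd _ ⟨c.1, c.2, rfl⟩ p)

/-- The relation of a homomorphism. -/
def ofHom (φ : Y.Linfty →⋆ₐ[ℂ] X.Linfty) : BinRel X Y := fun p b =>
  { carrier := {f | ∀ c : Y.Linfty, c b ∘L f = f ∘L φ c p}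
    add_mem' := fun {f g} hf hg c => by
      rw [ContinuousLinearMap.comp_add, ContinuousLinearMap.add_comp, hf c, hg c]
    zero_mem' := fun c => by rw [ContinuousLinearMap.comp_zero, ContinuousLinearMap.zero_comp]
    smul_mem' := fun r f hf c => by
      rw [ContinuousLinearMap.comp_smul, ContinuousLinearMap.smul_comp, hf c] }

theorem isStar_ofHom (φ : Y.Linfty →⋆ₐ[ℂ] X.Linfty) : (ofHom φ).IsStar φ :=
  fun _ _ _ hf c => hf c

theorem IsStar.adjoint_comp {φ : Y.Linfty →⋆ₐ[ℂ] X.Linfty} (h : F.IsStar φ) {p : X.At} {b : Y.At}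
    {f : X.space p →L[ℂ] Y.space b} (hf : f ∈ F p b) (c : Y.Linfty) :
    φ c p ∘L adjoint f = adjoint f ∘L c b := by
  have h1 := congrArg adjoint (h p b f hf (star c))
  rw [ContinuousLinearMap.adjoint_comp, ContinuousLinearMap.adjoint_comp, map_star,
    Linfty.star_apply, Linfty.star_apply, ContinuousLinearMap.adjoint_adjoint,
    ContinuousLinearMap.adjoint_adjoint] at h1
  exact h1.symm

theorem IsStar.comp_dagger_le {φ : Y.Linfty →⋆ₐ[ℂ] X.Linfty} (h : F.IsStar φ) :
    comp F F.dagger ≤ id Y :=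
  comp_dagger_le_id_iff.2 fun p b b' f hf g hg => mem_id_of_intertwines fun c => by
    rw [← ContinuousLinearMap.comp_assoc, h p b' f hf, ContinuousLinearMap.comp_assoc,
      h.adjoint_comp hg]
    rfl

/-- For an intertwiner `f`, write `f = ∑ f g† k` with `g, k ∈ F`. By Schur's lemma each `f g†` is a
scalar or zero, so `f` is a combination of elements of `F`. -/
theorem eq_ofHom_of_isStar (hF : F.IsFunction) {φ : Y.Linfty →⋆ₐ[ℂ] X.Linfty} (h : F.IsStar φ) :
    F = ofHom φ := by
  obtain ⟨ht, hF⟩ := isFunction_iff.1 hF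
  funext p b
  refine le_antisymm (fun f hf => h p b f hf) fun f hf => ?_
  have key : ∀ k ∈ comp F.dagger F p p, f ∘L k ∈ F p b := by
    intro k hk
    induction hk using Submodule.span_induction with
    | mem k hk =>
      obtain ⟨b', _, hg', k, hk, rfl⟩ := hk
      obtain ⟨g, hg, rfl⟩ := mem_dagger.1 hg'
      have h1 : f ∘L adjoint g ∈ id Y b' b := mem_id_of_intertwines fun c => by
        rw [← ContinuousLinearMap.comp_assoc, hf c, ContinuousLinearMap.comp_assoc,
          h.adjoint_comp hg]
        rfl
      rw [← ContinuousLinearMap.comp_assoc]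
      by_cases hb : b' = b
      · subst hb
        obtain ⟨c, hc⟩ := mem_id_self.1 h1
        rw [hc]
        exact Submodule.smul_mem _ c hk
      · rw [(mem_id_of_ne hb).1 h1, ContinuousLinearMap.zero_comp]
        exact Submodule.zero_mem _
    | zero => rw [ContinuousLinearMap.comp_zero]; exact Submodule.zero_mem _
    | add h k _ _ h1 h2 => rw [ContinuousLinearMap.comp_add]; exact Submodule.add_mem _ h1 h2
    | smul c h _ h1 => rw [ContinuousLinearMap.comp_smul]; exact Submodule.smul_mem _ c h1
  exact key 1 (one_mem_dagger_comp ht hF p)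

open Classical in
/-- The central projection onto finitely many atoms. -/
def centralProj (J : Finset Y.At) : Y.Linfty :=
  Linfty.ofBounded (fun b => if b ∈ J then 1 else 0) 1 fun b => by
    split_ifs
    · exact norm_one.le
    · rw [norm_zero]; exact zero_le_one

theorem centralProj_apply_of_mem {J : Finset Y.At} {b : Y.At} (h : b ∈ J) :
    centralProj J b = 1 := if_pos h

theorem centralProj_apply_of_notMem {J : Finset Y.At} {b : Y.At} (h : b ∉ J) :
    centralProj J b = 0 := if_neg h

theorem star_centralProj (J : Finset Y.At) : star (centralProj J) = centralProj J :=
  Linfty.ext fun b => by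
    rw [Linfty.star_apply]
    by_cases h : b ∈ J
    · rw [centralProj_apply_of_mem h]
      exact star_one _
    · rw [centralProj_apply_of_notMem h, map_zero]

theorem centralProj_mul_self (J : Finset Y.At) : centralProj J * centralProj J = centralProj J :=
  Linfty.ext fun b => by
    rw [Linfty.mul_apply]
    by_cases h : b ∈ J
    · rw [centralProj_apply_of_mem h, one_mul]
    · rw [centralProj_apply_of_notMem h, zero_mul]

theorem isSup_centralProj : IsSup (Set.range (centralProj (Y := Y))) 1 := by
  refine ⟨?_, fun c hc b => ?_⟩
  · rintro _ ⟨J, rfl⟩ b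
    rw [Linfty.one_apply]
    by_cases h : b ∈ J
    · rw [centralProj_apply_of_mem h, sub_self]
      exact ContinuousLinearMap.isPositive_zero
    · rw [centralProj_apply_of_notMem h, sub_zero]
      exact ContinuousLinearMap.isPositive_one
  · have := hc _ ⟨{b}, rfl⟩ b
    rwa [centralProj_apply_of_mem (Finset.mem_singleton_self b)] at this

theorem directedOn_centralProj : DirectedOn LoewnerLE (Set.range (centralProj (Y := Y))) := by
  classical
  have key {J K : Finset Y.At} (h : J ⊆ K) : LoewnerLE (centralProj J) (centralProj K) := by
    intro b
    by_cases hJ : b ∈ J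
    · rw [centralProj_apply_of_mem hJ, centralProj_apply_of_mem (h hJ), sub_self]
      exact ContinuousLinearMap.isPositive_zero
    · rw [centralProj_apply_of_notMem hJ, sub_zero]
      by_cases hK : b ∈ K
      · rw [centralProj_apply_of_mem hK]
        exact ContinuousLinearMap.isPositive_one
      · rw [centralProj_apply_of_notMem hK]
        exact ContinuousLinearMap.isPositive_zero
  rintro _ ⟨J, rfl⟩ _ ⟨K, rfl⟩
  exact ⟨_, ⟨J ∪ K, rfl⟩, key Finset.subset_union_left, key Finset.subset_union_right⟩

end BinRel
end QSet

/-! ### Totality of the relation of a normal homomorphism -/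

namespace QSet
open ContinuousLinearMap (adjoint)
open InnerProductSpace (rankOne)

variable {X Y : QSet.{u, v}}

namespace Linfty

theorem single_add (p : X.At) (s t : X.space p →L[ℂ] X.space p) :
    single p (s + t) = single p s + single p t :=
  ext fun q => by
    by_cases h : q = p
    · subst h
      rw [add_apply, single_self, single_self, single_self]
    · rw [add_apply, single_of_ne h, single_of_ne h, single_of_ne h, add_zero]

theorem single_smul (p : X.At) (r : ℂ) (t : X.space p →L[ℂ] X.space p) :
    single p (r • t) = r • single p t :=
  ext fun q => by
    by_cases h : q = p
    · subst h
      rw [smul_apply, single_self, single_self]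
    · rw [smul_apply, single_of_ne h, single_of_ne h, smul_zero]

theorem mul_single (c : X.Linfty) (p : X.At) (t : X.space p →L[ℂ] X.space p) :
    c * single p t = single p (c p * t) :=
  ext fun q => by
    by_cases h : q = p
    · subst h
      rw [mul_apply, single_self, single_self]
    · rw [mul_apply, single_of_ne h, single_of_ne h, mul_zero]

theorem star_single (p : X.At) (t : X.space p →L[ℂ] X.space p) :
    star (single p t) = single p (adjoint t) :=
  ext fun q => by
    by_cases h : q = p
    · subst h
      rw [star_apply, single_self, single_self]
    · rw [star_apply, single_of_ne h, single_of_ne h, map_zero]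

end Linfty

namespace BinRel

/-- The linear map `t ↦ φ(t)(X_p) x`, for operators `t` on one atom. -/
def singleEval (φ : Y.Linfty →⋆ₐ[ℂ] X.Linfty) (b : Y.At) (p : X.At) (x : X.space p) :
    (Y.space b →L[ℂ] Y.space b) →ₗ[ℂ] X.space p where
  toFun t := φ (Linfty.single b t) p x
  map_add' s t := by
    rw [Linfty.single_add, map_add]
    rfl
  map_smul' r t := by
    rw [Linfty.single_smul, map_smul]
    rfl

theorem singleEval_apply (φ : Y.Linfty →⋆ₐ[ℂ] X.Linfty) (b : Y.At) (p : X.At) (x : X.space p)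
    (t : Y.space b →L[ℂ] Y.space b) : singleEval φ b p x t = φ (Linfty.single b t) p x := rfl

theorem map_singleEval (φ : Y.Linfty →⋆ₐ[ℂ] X.Linfty) (b : Y.At) (p : X.At) (x : X.space p)
    (t : Y.space b →L[ℂ] Y.space b) (c : Y.Linfty) :
    φ c p (singleEval φ b p x t) = singleEval φ b p x (c b * t) := by
  rw [singleEval_apply, singleEval_apply, ← Linfty.mul_single, map_mul]
  rfl

/-- The operator `y ↦ φ(|y⟩⟨e|)(X_p) x`. -/
def singleIntertwiner (φ : Y.Linfty →⋆ₐ[ℂ] X.Linfty) (b : Y.At) (p : X.At) (x : X.space p)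
    (e : Y.space b) : Y.space b →L[ℂ] X.space p :=
  LinearMap.toContinuousLinearMap
    { toFun y := singleEval φ b p x (rankOne ℂ y e)
      map_add' y z := by rw [map_add, _root_.add_apply, map_add]
      map_smul' r y := by rw [map_smul, _root_.smul_apply, map_smul, RingHom.id_apply] }

theorem singleIntertwiner_apply (φ : Y.Linfty →⋆ₐ[ℂ] X.Linfty) (b : Y.At) (p : X.At)
    (x : X.space p) (e y : Y.space b) :
    singleIntertwiner φ b p x e y = φ (Linfty.single b (rankOne ℂ y e)) p x := rfl

/-- Multiplicativity of `φ` and `c |y⟩⟨e| = |c y⟩⟨e|`. The adjoints of these operators supply enough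
elements of the relation of `φ`. -/
theorem comp_singleIntertwiner (φ : Y.Linfty →⋆ₐ[ℂ] X.Linfty) (b : Y.At) (p : X.At)
    (x : X.space p) (e : Y.space b) (c : Y.Linfty) :
    φ c p ∘L singleIntertwiner φ b p x e = singleIntertwiner φ b p x e ∘L c b := by
  refine ContinuousLinearMap.ext fun y => ?_
  have h : c b * rankOne ℂ y e = rankOne ℂ (c b y) e := InnerProductSpace.comp_rankOne y e (c b)
  rw [ContinuousLinearMap.comp_apply, ContinuousLinearMap.comp_apply, singleIntertwiner_apply,
    singleIntertwiner_apply, ← singleEval_apply, map_singleEval, h, singleEval_apply]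

theorem adjoint_mem_ofHom (φ : Y.Linfty →⋆ₐ[ℂ] X.Linfty) (b : Y.At) (p : X.At) (x : X.space p)
    (e : Y.space b) : adjoint (singleIntertwiner φ b p x e) ∈ ofHom φ p b := by
  intro c
  have h := congrArg adjoint (comp_singleIntertwiner φ b p x e (star c))
  rw [ContinuousLinearMap.adjoint_comp, ContinuousLinearMap.adjoint_comp, map_star,
    Linfty.star_apply, Linfty.star_apply, ContinuousLinearMap.adjoint_adjoint,
    ContinuousLinearMap.adjoint_adjoint] at h
  exact h.symm

theorem map_single_eq_zero (φ : Y.Linfty →⋆ₐ[ℂ] X.Linfty) {p : X.At} {x : X.space p}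
    (hx : ∀ b, ∀ f ∈ ofHom φ p b, f x = 0) (b : Y.At) (t : Y.space b →L[ℂ] Y.space b) :
    φ (Linfty.single b t) p x = 0 := by
  have h1 (y e : Y.space b) : φ (Linfty.single b (rankOne ℂ y e)) p x = 0 := by
    refine ext_inner_right ℂ fun z => ?_
    have h2 := congrArg (fun v => (inner ℂ v e : ℂ)) (hx b _ (adjoint_mem_ofHom φ b p z y))
    simp only [ContinuousLinearMap.adjoint_inner_left, inner_zero_left] at h2
    -- Moving `φ(|y⟩⟨e|)` across the inner product turns it into `φ(|e⟩⟨y|) z`, a value of the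
    -- intertwiner whose adjoint kills `x`.
    rw [inner_zero_left, ← h2, ← ContinuousLinearMap.adjoint_inner_right, ← Linfty.star_apply,
      ← map_star, Linfty.star_single, InnerProductSpace.adjoint_rankOne, singleIntertwiner_apply]
  rw [← singleEval_apply, ← mul_one t, ContinuousLinearMap.one_def,
    ← (stdOrthonormalBasis ℂ (Y.space b)).sum_rankOne_eq_id, Finset.mul_sum, map_sum]
  refine Finset.sum_eq_zero fun i _ => ?_
  rw [singleEval_apply, ContinuousLinearMap.mul_def, InnerProductSpace.comp_rankOne, h1]

theorem map_centralProj_eq_zero (φ : Y.Linfty →⋆ₐ[ℂ] X.Linfty) {p : X.At} {x : X.space p}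
    (hx : ∀ b, ∀ f ∈ ofHom φ p b, f x = 0) (J : Finset Y.At) : φ (centralProj J) p x = 0 := by
  classical
  induction J using Finset.induction_on with
  | empty =>
    have : centralProj (∅ : Finset Y.At) = 0 :=
      Linfty.ext fun b => centralProj_apply_of_notMem (Finset.notMem_empty b)
    rw [this, map_zero]
    rfl
  | insert b J hb ih =>
    have : centralProj (insert b J) = Linfty.single b 1 + centralProj J := Linfty.ext fun a => by
      rw [Linfty.add_apply]
      by_cases hab : a = b
      · subst hab
        rw [centralProj_apply_of_mem (Finset.mem_insert_self a J), Linfty.single_self,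
          centralProj_apply_of_notMem hb, add_zero]
      · rw [Linfty.single_of_ne hab, zero_add]
        by_cases ha : a ∈ J
        · rw [centralProj_apply_of_mem ha, centralProj_apply_of_mem (Finset.mem_insert_of_mem ha)]
        · rw [centralProj_apply_of_notMem ha, centralProj_apply_of_notMem]
          rw [Finset.mem_insert]
          exact not_or.2 ⟨hab, ha⟩
    rw [this, map_add, Linfty.add_apply, _root_.add_apply, ih, map_single_eq_zero φ hx b, add_zero]

theorem isPositive_of_adjoint_eq_of_mul_self {E : Type*} [NormedAddCommGroup E]
    [InnerProductSpace ℂ E] [CompleteSpace E] {T : E →L[ℂ] E} (h : adjoint T = T) (h' : T * T = T) :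
    T.IsPositive := by
  have := ContinuousLinearMap.isPositive_adjoint_comp_self T
  rw [h] at this
  rwa [← ContinuousLinearMap.mul_def, h'] at this

/-- By normality the images of the finite central projections have supremum 1. A unit vector `u` in
the common kernel is killed by all of them, so `1 - |u⟩⟨u|` would be a smaller upper bound. -/
theorem isTotal_ofHom {φ : Y.Linfty →⋆ₐ[ℂ] X.Linfty} (hφ : IsNormal φ) : (ofHom φ).IsTotal := by
  intro p x hx
  by_contra hx0
  obtain ⟨u, hu, hu1⟩ : ∃ u : X.space p, (∀ b, ∀ f ∈ ofHom φ p b, f u = 0) ∧ ‖u‖ = 1 := by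
    refine ⟨((‖x‖⁻¹ : ℝ) : ℂ) • x, fun b f hf => by rw [map_smul, hx b f hf, smul_zero], ?_⟩
    rw [norm_smul, Complex.norm_real, norm_inv, norm_norm]
    exact inv_mul_cancel₀ (norm_ne_zero_iff.2 hx0)
  have hsup := hφ _ _ (Set.range_nonempty _) directedOn_centralProj
    (by rintro _ ⟨J, rfl⟩; exact star_centralProj J) isSup_centralProj
  rw [map_one] at hsup
  have hQ : (rankOne ℂ u u : X.space p →L[ℂ] X.space p) * rankOne ℂ u u = rankOne ℂ u u :=
    InnerProductSpace.isIdempotentElem_rankOne_self hu1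
  -- The difference between this candidate and an image is positive because in each component it is
  -- a self-adjoint idempotent; at `p` this uses that the image and `|u⟩⟨u|` annihilate each other.
  have hle := hsup.2 (1 - Linfty.single p (rankOne ℂ u u)) (by
    rintro _ ⟨_, ⟨J, rfl⟩, rfl⟩ q
    have hs : adjoint (φ (centralProj J) q) = φ (centralProj J) q := by
      rw [← Linfty.star_apply, ← map_star, star_centralProj]
    have hm : φ (centralProj J) q * φ (centralProj J) q = φ (centralProj J) q := by
      rw [← Linfty.mul_apply, ← map_mul, centralProj_mul_self]
    have h1 : adjoint (1 : X.space q →L[ℂ] X.space q) = 1 := star_one _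
    refine isPositive_of_adjoint_eq_of_mul_self ?_ ?_
    · rw [map_sub, hs, Linfty.sub_apply, map_sub, Linfty.one_apply, h1]
      by_cases hq : q = p
      · subst hq
        rw [Linfty.single_self, InnerProductSpace.adjoint_rankOne]
      · rw [Linfty.single_of_ne hq, map_zero]
    · rw [Linfty.sub_apply, Linfty.one_apply]
      by_cases hq : q = p
      · subst hq
        have hPQ : φ (centralProj J) q * rankOne ℂ u u = 0 := by
          refine (InnerProductSpace.comp_rankOne u u _).trans ?_
          rw [map_centralProj_eq_zero φ hu, map_zero]
          rfl
        have hQP : rankOne ℂ u u * φ (centralProj J) q = 0 := by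
          have h2 := congrArg adjoint hPQ
          rw [ContinuousLinearMap.mul_def, ContinuousLinearMap.adjoint_comp, hs,
            InnerProductSpace.adjoint_rankOne, map_zero] at h2
          exact h2
        rw [Linfty.single_self]
        simp only [mul_sub, sub_mul, one_mul, mul_one, hPQ, hQP, hm, hQ]
        abel
      · rw [Linfty.single_of_ne hq, sub_zero]
        simp only [mul_sub, sub_mul, one_mul, mul_one, hm]
        abel) p
  rw [Linfty.sub_apply, Linfty.one_apply, Linfty.single_self, sub_sub_cancel_left] at hle
  have h3 := hle.re_inner_nonneg_left u
  rw [_root_.neg_apply, InnerProductSpace.rankOne_apply, inner_neg_left,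
    inner_smul_left, inner_self_eq_norm_sq_to_K, hu1] at h3
  norm_num at h3

end BinRel
end QSet

/-! ### Surjective and injective homomorphisms, and the correspondence -/

namespace QSet
open ContinuousLinearMap (adjoint)

namespace BinRel

variable {X Y : QSet.{u, v}} {F : BinRel X Y}

theorem intertwines_of_mem_id {p q : X.At} {k : X.space p →L[ℂ] X.space q} (hk : k ∈ id X p q)
    (d : X.Linfty) : d q ∘L k = k ∘L d p := by
  by_cases hpq : p = q
  · subst hpq
    obtain ⟨c, rfl⟩ := mem_id_self.1 hk
    rw [ContinuousLinearMap.comp_smul, ContinuousLinearMap.smul_comp]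
    rfl
  · rw [(mem_id_of_ne hpq).1 hk, ContinuousLinearMap.comp_zero, ContinuousLinearMap.zero_comp]

theorem exists_comp_adjoint_eq (hF : comp F F.dagger ≤ id Y) {p : X.At} {b : Y.At}
    {f : X.space p →L[ℂ] Y.space b} (hf : f ∈ F p b) (hf0 : f ≠ 0) :
    ∃ r : ℂ, r ≠ 0 ∧ f ∘L adjoint f = r • 1 := by
  obtain ⟨r, hr⟩ := mem_id_self.1 (comp_dagger_le_id_iff.1 hF p b b f hf f hf)
  refine ⟨r, ?_, hr⟩
  rintro rfl
  rw [zero_smul] at hr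
  have h1 : adjoint f = 0 := by
    refine ContinuousLinearMap.ext fun y => ?_
    have h2 := ContinuousLinearMap.adjoint_inner_left f (adjoint f y) y
    rw [← ContinuousLinearMap.comp_apply, hr, _root_.zero_apply, inner_zero_right] at h2
    exact inner_self_eq_zero.1 h2
  apply hf0
  rw [← ContinuousLinearMap.adjoint_adjoint f, h1, map_zero]

/-- With `g g† = r ≠ 0`, the operator `r⁻¹ g d g†` works for every `f`: `g†f` intertwines the
components of `d`, and `r⁻¹ g g† f = f`. The norm bound is `‖g‖ ^ 2 = ‖r‖`. If `F` does not reach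
the atom, zero works. -/
theorem exists_pushforward (hF : comp F F.dagger ≤ id Y) (hinj : comp F.dagger F ≤ id X)
    (d : X.Linfty) (b : Y.At) :
    ∃ t : Y.space b →L[ℂ] Y.space b, ‖t‖ ≤ ‖d‖ ∧ ∀ p, ∀ f ∈ F p b, t ∘L f = f ∘L d p := by
  by_cases hb : ∃ p, ∃ f ∈ F p b, f ≠ 0
  · obtain ⟨q, g, hg, hg0⟩ := hb
    obtain ⟨r, hr0, hr⟩ := exists_comp_adjoint_eq hF hg hg0
    refine ⟨r⁻¹ • g ∘L d q ∘L adjoint g, ?_, fun p f hf => ?_⟩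
    · have h1 : ‖g‖ * ‖g‖ = ‖r‖ := by
        have h2 := ContinuousLinearMap.norm_adjoint_comp_self (adjoint g)
        rw [ContinuousLinearMap.adjoint_adjoint, hr, norm_smul, norm_one, mul_one,
          LinearIsometryEquiv.norm_map] at h2
        exact h2.symm
      have h3 : ‖g ∘L d q ∘L adjoint g‖ ≤ ‖g‖ * (‖d q‖ * ‖g‖) := by
        refine (ContinuousLinearMap.opNorm_comp_le _ _).trans
          (mul_le_mul_of_nonneg_left ?_ (norm_nonneg _))
        refine (ContinuousLinearMap.opNorm_comp_le _ _).trans_eq ?_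
        rw [LinearIsometryEquiv.norm_map]
      rw [norm_smul, norm_inv, inv_mul_le_iff₀ (norm_pos_iff.2 hr0), ← h1]
      refine h3.trans ?_
      calc ‖g‖ * (‖d q‖ * ‖g‖) = ‖g‖ * ‖g‖ * ‖d q‖ := by ring
        _ ≤ ‖g‖ * ‖g‖ * ‖d‖ :=
          mul_le_mul_of_nonneg_left (Linfty.norm_apply_le d q) (mul_self_nonneg _)
    · have h1 := intertwines_of_mem_id (dagger_comp_le_id_iff.1 hinj p q b f hf g hg) d
      have h2 : f = r⁻¹ • g ∘L adjoint g ∘L f := by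
        rw [← ContinuousLinearMap.comp_assoc, hr, ContinuousLinearMap.smul_comp, smul_smul,
          inv_mul_cancel₀ hr0, one_smul]
        rfl
      calc (r⁻¹ • g ∘L d q ∘L adjoint g) ∘L f
          = r⁻¹ • g ∘L (d q ∘L adjoint g ∘L f) := rfl
        _ = (r⁻¹ • g ∘L adjoint g ∘L f) ∘L d p := by rw [h1]; rfl
        _ = f ∘L d p := by rw [← h2]
  · push Not at hb
    exact ⟨0, by rw [norm_zero]; exact norm_nonneg d, fun p f hf => by
      rw [hb p f hf, ContinuousLinearMap.zero_comp, ContinuousLinearMap.zero_comp]⟩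

/-- Each `g†f` intertwines the range of `φ`; if this is all of `ℓ^∞(X)`, Schur's lemma applies.
Conversely, the pushforwards of `d` form a bounded family that `φ` sends to `d`. -/
theorem IsStar.surjective_iff {φ : Y.Linfty →⋆ₐ[ℂ] X.Linfty} (h : F.IsStar φ) (ht : F.IsTotal)
    (hF : comp F F.dagger ≤ id Y) :
    Function.Surjective φ ↔ comp F.dagger F ≤ id X := by
  constructor
  · intro hs
    refine dagger_comp_le_id_iff.2 fun p q b f hf g hg => mem_id_of_intertwines fun d => ?_
    obtain ⟨c, rfl⟩ := hs d
    rw [← ContinuousLinearMap.comp_assoc, h.adjoint_comp hg, ContinuousLinearMap.comp_assoc,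
      h p b f hf]
    rfl
  · intro hinj d
    choose t ht1 ht2 using exists_pushforward hF hinj d
    refine ⟨Linfty.ofBounded t ‖d‖ ht1, Linfty.ext fun p => ht.ext fun b f hf => ?_⟩
    rw [← h p b f hf]
    exact ht2 b p f hf

/-- The unit of an atom that `F` misses is in the kernel of `φ`. On an atom reached by a nonzero
`f`, `φ(c) = 0` gives `c f f† = 0`, where `f f†` is a nonzero scalar. -/
theorem IsStar.injective_iff {φ : Y.Linfty →⋆ₐ[ℂ] X.Linfty} (h : F.IsStar φ) (ht : F.IsTotal)
    (hF : comp F F.dagger ≤ id Y) :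
    Function.Injective φ ↔ ∀ b, ∃ p, ∃ f ∈ F p b, f ≠ 0 := by
  constructor
  · intro hi b
    by_contra! hb
    have h1 : φ (Linfty.single b 1) = 0 := Linfty.ext fun p => ht.ext fun a f hf => by
      rw [← h p a f hf, Linfty.zero_apply, ContinuousLinearMap.comp_zero]
      by_cases hab : a = b
      · subst hab
        rw [hb p f hf, ContinuousLinearMap.comp_zero]
      · rw [Linfty.single_of_ne hab, ContinuousLinearMap.zero_comp]
    have h2 : Linfty.single b (1 : Y.space b →L[ℂ] Y.space b) b = 0 := by
      rw [hi (h1.trans (map_zero φ).symm), Linfty.zero_apply]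
    rw [Linfty.single_self] at h2
    exact one_ne_zero h2
  · intro hs
    rw [injective_iff_map_eq_zero]
    intro c hc
    refine Linfty.ext fun b => ?_
    obtain ⟨p, f, hf, hf0⟩ := hs b
    obtain ⟨r, hr0, hr⟩ := exists_comp_adjoint_eq hF hf hf0
    have h1 : c b ∘L f ∘L adjoint f = 0 := by
      rw [← ContinuousLinearMap.comp_assoc, h p b f hf, hc, Linfty.zero_apply,
        ContinuousLinearMap.comp_zero, ContinuousLinearMap.zero_comp]
    rw [hr, ContinuousLinearMap.comp_smul, smul_eq_zero, or_iff_right hr0] at h1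
    exact h1

theorem surjectivitySentence_isTrue_iff_exists (hF : comp F F.dagger ≤ id Y) :
    F.surjectivitySentence.IsTrue ↔ ∀ b, ∃ p, ∃ f ∈ F p b, f ≠ 0 := by
  rw [surjectivitySentence_isTrue_iff]
  refine forall_congr' fun b => ⟨fun h => ?_, ?_⟩
  · by_contra! hb
    obtain ⟨y, hy⟩ := exists_ne (0 : Y.space b)
    refine hy (eq_zero_of_forall_dual fun η => ?_)
    rw [h η fun p f hf x => by rw [hb p f hf, _root_.zero_apply, map_zero], _root_.zero_apply]
  · rintro ⟨p, f, hf, hf0⟩ η hη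
    obtain ⟨r, hr0, hr⟩ := exists_comp_adjoint_eq hF hf hf0
    refine ContinuousLinearMap.ext fun y => ?_
    have h1 := hη p f hf (adjoint f y)
    rw [← ContinuousLinearMap.comp_apply f, hr] at h1
    change η (r • y) = 0 at h1
    rw [map_smul, smul_eq_zero, or_iff_right hr0] at h1
    exact h1

theorem comp_dagger_eq_id_iff (hF : comp F F.dagger ≤ id Y) :
    comp F F.dagger = id Y ↔ ∀ b, ∃ p, ∃ f ∈ F p b, f ≠ 0 := by
  constructor
  · intro h b
    by_contra! hb
    have h1 : (1 : Y.space b →L[ℂ] Y.space b) ∈ comp F F.dagger b b := by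
      rw [h]
      exact mem_id_self.2 ⟨1, (one_smul ℂ _).symm⟩
    have h2 : comp F F.dagger b b ≤ ⊥ := Submodule.span_le.2 (by
      rintro _ ⟨p, f, hf, g, -, rfl⟩
      rw [hb p f hf, ContinuousLinearMap.zero_comp]
      exact Submodule.zero_mem _)
    exact one_ne_zero ((Submodule.mem_bot ℂ).1 (h2 h1))
  · refine fun h => le_antisymm hF fun b b' k hk => ?_
    by_cases hb : b = b'
    · subst hb
      obtain ⟨c, rfl⟩ := mem_id_self.1 hk
      obtain ⟨p, f, hf, hf0⟩ := h b
      obtain ⟨r, hr0, hr⟩ := exists_comp_adjoint_eq hF hf hf0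
      have h1 : f ∘L adjoint f ∈ comp F F.dagger b b :=
        Submodule.subset_span ⟨p, f, hf, _, mem_dagger.2 ⟨f, hf, rfl⟩, rfl⟩
      have h2 : c • (1 : Y.space b →L[ℂ] Y.space b) = (c * r⁻¹) • f ∘L adjoint f := by
        rw [hr, smul_smul, mul_assoc, inv_mul_cancel₀ hr0, mul_one]
      rw [h2]
      exact Submodule.smul_mem _ _ h1
    · rw [(mem_id_of_ne hb).1 hk]
      exact Submodule.zero_mem _

theorem isTotal_and_univalent_iff : F.totalitySentence.IsTrue ∧ F.univalenceSentence.IsTrue ↔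
    F.IsFunction := by
  rw [isFunction_iff, univalenceSentence_isTrue_iff, totalitySentence_isTrue_iff]
  rfl

/-- The correspondence between functions and unital normal `*`-homomorphisms. -/
def starEquiv (X Y : QSet.{u, v}) :
    {F : BinRel X Y // F.totalitySentence.IsTrue ∧ F.univalenceSentence.IsTrue} ≃
      {φ : Y.Linfty →⋆ₐ[ℂ] X.Linfty // IsNormal φ} where
  toFun F :=
    have h := isTotal_and_univalent_iff.1 F.2
    ⟨starHom (isFunction_iff.1 h).1 (isFunction_iff.1 h).2,
      isNormal_of_isStar h (isStar_starHom _ _)⟩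
  invFun φ := ⟨ofHom φ.1, isTotal_and_univalent_iff.2
    (isFunction_iff.2 ⟨isTotal_ofHom φ.2, (isStar_ofHom φ.1).comp_dagger_le⟩)⟩
  left_inv F := Subtype.ext
    (eq_ofHom_of_isStar (isTotal_and_univalent_iff.1 F.2) (isStar_starHom _ _)).symm
  right_inv φ := Subtype.ext
    (IsStar.unique (isTotal_ofHom φ.2) (isStar_starHom _ _) (isStar_ofHom φ.1))

theorem isStar_starEquiv
    (F : {F : BinRel X Y // F.totalitySentence.IsTrue ∧ F.univalenceSentence.IsTrue}) :
    F.1.IsStar (starEquiv X Y F).1 := isStar_starHom _ _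

end BinRel
end QSet

end

theorem mainTheorem12 (X Y : QSet.{u, v}) :
    (∃ Φ : {F : QSet.BinRel X Y // F.totalitySentence.IsTrue ∧ F.univalenceSentence.IsTrue} ≃
        {φ : Y.Linfty →⋆ₐ[ℂ] X.Linfty // QSet.IsNormal φ},
      (∀ F φ, Φ F = φ ↔ F.1.IsStar φ.1) ∧
      (∀ F, Function.Surjective (Φ F).1 ↔ F.1.injectivitySentence.IsTrue) ∧
      (∀ F, Function.Injective (Φ F).1 ↔ F.1.surjectivitySentence.IsTrue)) ∧
    (∀ F : QSet.BinRel X Y,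
      F.totalitySentence.IsTrue ∧ F.univalenceSentence.IsTrue ↔ F.IsFunction) ∧
    (∀ F : QSet.BinRel X Y,
      F.totalitySentence.IsTrue ∧ F.univalenceSentence.IsTrue ∧ F.injectivitySentence.IsTrue ↔
        F.IsInjectiveFunction) ∧
    (∀ F : QSet.BinRel X Y,
      F.totalitySentence.IsTrue ∧ F.univalenceSentence.IsTrue ∧ F.surjectivitySentence.IsTrue ↔
        F.IsSurjectiveFunction) := by
  have hfun (F : {F : QSet.BinRel X Y //
      F.totalitySentence.IsTrue ∧ F.univalenceSentence.IsTrue}) :=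
    QSet.BinRel.isFunction_iff.1 (QSet.BinRel.isTotal_and_univalent_iff.1 F.2)
  refine ⟨⟨QSet.BinRel.starEquiv X Y, fun F φ => ⟨?_, fun h => ?_⟩, fun F => ?_, fun F => ?_⟩,
    fun F => QSet.BinRel.isTotal_and_univalent_iff, fun F => ?_, fun F => ?_⟩
  · rintro rfl
    exact QSet.BinRel.isStar_starEquiv F
  · exact Subtype.ext (QSet.BinRel.IsStar.unique (hfun F).1 (QSet.BinRel.isStar_starEquiv F) h)
  · rw [QSet.BinRel.injectivitySentence_isTrue_iff]
    exact (QSet.BinRel.isStar_starEquiv F).surjective_iff (hfun F).1 (hfun F).2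
  · rw [QSet.BinRel.surjectivitySentence_isTrue_iff_exists (hfun F).2]
    exact (QSet.BinRel.isStar_starEquiv F).injective_iff (hfun F).1 (hfun F).2
  · rw [← and_assoc, QSet.BinRel.isTotal_and_univalent_iff,
      QSet.BinRel.injectivitySentence_isTrue_iff]
    exact and_congr_right fun h => ⟨fun h' => le_antisymm h' h.1, fun h' => h'.le⟩
  · rw [← and_assoc, QSet.BinRel.isTotal_and_univalent_iff]
    refine and_congr_right fun h => ?_
    rw [QSet.BinRel.surjectivitySentence_isTrue_iff_exists h.2,
      QSet.BinRel.comp_dagger_eq_id_iff h.2]
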